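/- Let $\mathbb F$ be a non-archimedean local field and $\mathbb E\supset\mathbb F$ a quadratic extension (again a local field) of the form $\mathbb E=\mathbb F\oplus\mathbb F\alpha$ with $\alpha^2\in\mathbb F$. For $k\in\{\mathbb E,\mathbb F\}$ let $\mathcal O_k$ be the ring of integers, $q_k$ the cardinality of the residue field, $\nu_k$ the normalized valuation, $|x|_k=q_k^{-\nu_k(x)}$, and fix a uniformizer $\varpi_k$. For a unitary character $\chi$ of $\mathcal O_k^\times$ and $s\in\mathbb C$ put $\chi_s(x)=\chi(\varpi_k^{-\nu_k(x)}x)\,|x|_k^s$ ($x\in k^\times$). For a character $\xi$ of $\mathbb F^\times$ let $L(z,\xi)=(1-\xi(\varpi_{\mathbb F})q_{\mathbb F}^{-z})^{-1}$ if $\xi|_{\mathcal O_{\mathbb F}^\times}=1$, and $L(z,\xi)=1$ otherwise. Let $C_c^\infty(\mathbb E)$ be the space of locally constant, compactly supported functions $\mathbb E\to\mathbb C$, and $\mathcal D'(\mathbb E)$ its algebraic dual; a locally integrable function is regarded as a distribution by means of the Haar measure $dx$ on $\mathbb E$ with $\int_{\mathcal O_{\mathbb E}}dx=1$. A family of distributions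 is called holomorphic (meromorphic) if its pairing with every test function is. Fix characters $\chi$ of $\mathcal O_{\mathbb E}^\times$ and $\eta$ of $\mathcal O_{\mathbb F}^\times$. For $s,t\in\mathbb C$ let $$K_{s,t}^{\chi,\eta}(x)=\chi_{s-\frac12}(x^2)\,(\chi_{s-\frac12}\eta_{t+\frac12})\Big(\frac{x_2}{x_1^2-x_2^2\alpha^2}\Big)\qquad(x=x_1+x_2\alpha\in\mathbb E\setminus\mathbb F,\ x_1,x_2\in\mathbb F),$$ and let $\mathcal D'(\mathbb E)_{s,t}^{\chi,\eta}$ be the space of symmetry breaking kernels, i.e. of those $u\in\mathcal D'(\mathbb E)$ which satisfy, in the sense of distributions, (a) $u(ax)=\chi_{s-\frac12}(a)\,\eta_{t+\frac12}(a)^{-1}u(x)$ on $\mathbb E$ for all $a\in\mathbb F^\times$, (b) $u\big(\tfrac{x}{1-bx}\big)=\chi_{s-\frac12}((1-bx)^2)^{-1}u(x)$ on $\mathbb E\setminus\{b^{-1}\}$ for all $b\in\mathbb F^\times$. Let $\backslash\!\backslash\subseteq\mathbb C^2$ be the set of all $(s,t)$ with $\chi_0(\varpi_{\mathbb F})\,q_{\mathbb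 F}^{-(2s+t+\frac12)}=1$ if $\chi|_{\mathcal O_{\mathbb F}^\times}\cdot\eta=1$, and the empty set otherwise; let $/\!/\subseteq\mathbb C^2$ be the set of all $(s,t)$ with $\chi_0(\varpi_{\mathbb F})\,q_{\mathbb F}^{-(2s-t+\frac12)}=1$ if $\chi|_{\mathcal O_{\mathbb F}^\times}\cdot\eta^{-1}=1$, and the empty set otherwise. (These are the pole sets of $L(\frac12,\chi_s|_{\mathbb F^\times}\cdot\eta_t)$ and $L(\frac12,\chi_s|_{\mathbb F^\times}\cdot\eta_t^{-1})$. If $\varpi_{\mathbb F}$ is a power of $\varpi_{\mathbb E}$, then $\chi_0(\varpi_{\mathbb F})=1$ and the equations say $2s\pm t+\frac12\in\frac{2\pi i}{\ln q_{\mathbb F}}\mathbb Z$.) Then: 1. If $\mathrm{Re}(2s+t+\frac12)>0$ and $\mathrm{Re}(2s-t+\frac12)>0$, then $K_{s,t}^{\chi,\eta}$ is locally integrable on $\mathbb E$. 2. The resulting family of distributions extends to a meromorphic family $K_{s,t}^{\chi,\eta}\in\mathcal D'(\mathbb E)$, $(s,t)\in\mathbb C^2$, with simple poles exactly along $\backslash\!\backslash\cup/\!/$: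 it is holomorphic outside this set, has a pole of order at most one along each of the lines that form it, and no point of the set is a removable singularity of the family. For $(s,t)\notin\backslash\!\backslash\cup/\!/$ one has $K_{s,t}^{\chi,\eta}\in\mathcal D'(\mathbb E)_{s,t}^{\chi,\eta}$. 3. The renormalized family $$\widetilde K_{s,t}^{\chi,\eta}=L(\tfrac12,\chi_s|_{\mathbb F^\times}\cdot\eta_t)^{-1}\,L(\tfrac12,\chi_s|_{\mathbb F^\times}\cdot\eta_t^{-1})^{-1}\,K_{s,t}^{\chi,\eta}$$ extends to a holomorphic family of distributions on $\mathbb C^2$, and $\widetilde K_{s,t}^{\chi,\eta}\in\mathcal D'(\mathbb E)_{s,t}^{\chi,\eta}$ for all $(s,t)\in\mathbb C^2$. -/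

import Mathlib

open scoped ValuativeRel Topology
open MeasureTheory ValuativeRel

namespace SymBreak

noncomputable section

/-! ### Non-archimedean local fields: valuation, absolute value, uniformizers -/

section LocalField

variable (K : Type*) [Field K] [ValuativeRel K] [TopologicalSpace K]
  [IsNonarchimedeanLocalField K]

/-- The cardinality `q_K` of the residue field of `K`. -/
def resCard : ℕ := Nat.card 𝓀[K]

variable {K}

/-- The normalized additive valuation `ν_K`, with values in `ℤ` (only meaningful for `x ≠ 0`;
the value at `0` is `0` by convention). -/
def nu (x : K) : ℤ :=
  -(WithZero.log (IsNonarchimedeanLocalField.valueGroupWithZeroIsoInt K (valuation K x)))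

open Classical in
/-- The normalized absolute value `|x|_K = q_K ^ (-ν_K(x))`, `|0|_K = 0`; it is the modulus of
multiplication by `x` on the additive group of `K`. -/
def nabs (x : K) : ℝ :=
  if x = 0 then 0 else (resCard K : ℝ) ^ (-nu x)

variable (K) in
/-- A uniformizer of `K`: an element of valuation `1`. -/
abbrev Uniformizer : Type _ := {ϖ : K // nu ϖ = 1}

lemma val_iso_ne_zero {x : K} (hx : x ≠ 0) :
    IsNonarchimedeanLocalField.valueGroupWithZeroIsoInt K (valuation K x) ≠ 0 := by
  simpa using hx

lemma nu_zero : nu (0 : K) = 0 := by simp [nu]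

lemma nu_one : nu (1 : K) = 0 := by simp [nu]

lemma nu_mul {x y : K} (hx : x ≠ 0) (hy : y ≠ 0) : nu (x * y) = nu x + nu y := by
  simp only [nu, map_mul]
  rw [WithZero.log_mul (val_iso_ne_zero hx) (val_iso_ne_zero hy)]
  ring

lemma nu_zpow (x : K) (n : ℤ) : nu (x ^ n) = n * nu x := by
  simp [nu, WithZero.log_zpow]

lemma Uniformizer.ne_zero (ϖ : Uniformizer K) : (ϖ : K) ≠ 0 := by
  intro h
  have := ϖ.2
  rw [h, nu_zero] at this
  exact absurd this (by norm_num)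

lemma valuation_eq_one_of_nu {x : K} (hx : x ≠ 0) (h : nu x = 0) : valuation K x = 1 := by
  have h0 : WithZero.log (IsNonarchimedeanLocalField.valueGroupWithZeroIsoInt K
      (valuation K x)) = 0 := by simpa [nu] using h
  have h1 := WithZero.exp_log (val_iso_ne_zero hx)
  rw [h0, WithZero.exp_zero] at h1
  exact (map_eq_one_iff _ (IsNonarchimedeanLocalField.valueGroupWithZeroIsoInt K).injective).1
    h1.symm

/-- An element `x ≠ 0` of valuation `0`, as a unit of the ring of integers. -/
def mkUnit (x : K) (hx : x ≠ 0) (h : nu x = 0) : 𝒪[K]ˣ where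
  val := ⟨x, (Valuation.mem_integer_iff _ _).2 (valuation_eq_one_of_nu hx h).le⟩
  inv := ⟨x⁻¹, (Valuation.mem_integer_iff _ _).2 (by
    rw [map_inv₀, valuation_eq_one_of_nu hx h, inv_one])⟩
  val_inv := Subtype.ext (mul_inv_cancel₀ hx)
  inv_val := Subtype.ext (inv_mul_cancel₀ hx)

/-- The unit `ϖ ^ (-ν(x)) x` of the ring of integers attached to `x ≠ 0`. -/
def unitPart (ϖ : Uniformizer K) (x : K) (hx : x ≠ 0) : 𝒪[K]ˣ :=
  mkUnit ((ϖ : K) ^ (-nu x) * x) (mul_ne_zero (zpow_ne_zero _ ϖ.ne_zero) hx) (by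
    rw [nu_mul (zpow_ne_zero _ ϖ.ne_zero) hx, nu_zpow, ϖ.2]; ring)

open Classical in
/-- For a (unitary, continuous) character `χ` of the group of units `𝒪_K^×` and `s ∈ ℂ`, the
character `χ_s(x) = χ(ϖ ^ (-ν(x)) x) |x| ^ s` of `K^×`, extended by `0` to `x = 0`. -/
def charExt (ϖ : Uniformizer K) (χ : PontryaginDual 𝒪[K]ˣ) (s : ℂ) (x : K) : ℂ :=
  if hx : x = 0 then 0 else (χ (unitPart ϖ x hx) : ℂ) * (nabs x : ℂ) ^ s

open Classical in
/-- The local `L`-factor `L(z, ξ)` of a character `ξ` of `K^×`: it equals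
`(1 - ξ(ϖ) q ^ (-z))⁻¹` if `ξ` is trivial on the units and `1` otherwise. At a pole the value is
`0` by convention, so the reciprocal `(localL ϖ z ξ)⁻¹` is always the correct one. -/
def localL (ϖ : Uniformizer K) (z : ℂ) (ξ : K → ℂ) : ℂ :=
  if ∀ u : K, u ≠ 0 → nu u = 0 → ξ u = 1 then (1 - ξ ϖ * (resCard K : ℂ) ^ (-z))⁻¹ else 1

end LocalField

/-! ### Test functions and distributions -/

section Distributions

variable (E : Type*) [TopologicalSpace E]

/-- The space `C_c^∞(E)` of locally constant complex functions with compact support. -/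
def TestFunction : Submodule ℂ (E → ℂ) where
  carrier := {f | IsLocallyConstant f ∧ HasCompactSupport f}
  add_mem' hf hg := ⟨hf.1.add hg.1, hf.2.add hg.2⟩
  zero_mem' := ⟨IsLocallyConstant.const 0, HasCompactSupport.zero⟩
  smul_mem' c _ hf := ⟨hf.1.comp (fun z => c • z), hf.2.smul_left (f := fun _ => c)⟩

/-- The space `𝒟'(E)` of distributions: all linear functionals on `C_c^∞(E)`. -/
abbrev Distribution : Type _ := TestFunction E →ₗ[ℂ] ℂ

variable {E}

/-- A family of distributions on `E` is holomorphic on `ℂ²` if its pairing with every test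
function is. -/
def IsHolomorphicFamily (T : ℂ × ℂ → Distribution E) : Prop :=
  ∀ φ : TestFunction E, Differentiable ℂ (fun z => T z φ)

/-- `f`, given outside the nowhere dense set `S`, extends holomorphically to a neighbourhood of
`p`. -/
def ExtendsHolomorphicallyAt (f : ℂ × ℂ → ℂ) (S : Set (ℂ × ℂ)) (p : ℂ × ℂ) : Prop :=
  ∃ g : ℂ × ℂ → ℂ, AnalyticAt ℂ g p ∧ ∀ᶠ z in 𝓝 p, z ∉ S → f z = g z

open Classical in
/-- Let `P` be a union of parallel lines `2s + t = const` and `Q` a union of parallel lines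
`2s - t = const` in `ℂ²`. The family `T` of distributions, given for parameters outside `P ∪ Q`, is
meromorphic on `ℂ²`, with simple poles exactly along `P` and `Q`: locally at each point `p`, the
pairings with test functions become holomorphic when they are multiplied with one linear equation
for each of the lines in `P` and `Q` through `p`, and no point of `P ∪ Q` is a removable
singularity. -/
def HasSimplePolesExactlyAlong (T : ℂ × ℂ → Distribution E) (P Q : Set (ℂ × ℂ)) : Prop :=
  (∀ (φ : TestFunction E) (p : ℂ × ℂ),
    ExtendsHolomorphicallyAt
      (fun z => (if p ∈ P then (2 * z.1 + z.2) - (2 * p.1 + p.2) else 1) *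
        (if p ∈ Q then (2 * z.1 - z.2) - (2 * p.1 - p.2) else 1) * T z φ) (P ∪ Q) p) ∧
  ∀ p ∈ P ∪ Q, ∃ φ : TestFunction E,
    ¬ ExtendsHolomorphicallyAt (fun z => T z φ) (P ∪ Q) p

end Distributions

/-! ### Quadratic extensions and symmetry breaking kernels -/

section Quadratic

variable {F E : Type*}
  [Field F] [ValuativeRel F] [TopologicalSpace F] [IsNonarchimedeanLocalField F]
  [Field E] [ValuativeRel E] [TopologicalSpace E] [IsNonarchimedeanLocalField E]
  [Algebra F E]

/-- The function `K_{s,t}^{χ,η}(x) = χ_{s-1/2}(x²) (χ_{s-1/2} η_{t+1/2})(x₂ / (x₁² - x₂² α²))` for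
`x = x₁ + x₂ α`, where `(1, α)` is the basis `B` of `E` over `F` and `α² = d ∈ F`. (On the null set
`F`, where the formula is not defined, the value is `0`.) -/
def kernel (ϖF : Uniformizer F) (ϖE : Uniformizer E) (B : Module.Basis (Fin 2) F E) (d : F)
    (χ : PontryaginDual 𝒪[E]ˣ) (η : PontryaginDual 𝒪[F]ˣ) (s t : ℂ) (x : E) : ℂ :=
  let x₁ : F := B.repr x 0
  let x₂ : F := B.repr x 1
  let y : F := x₂ / (x₁ ^ 2 - x₂ ^ 2 * d)
  charExt ϖE χ (s - 1 / 2) (x ^ 2) *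
    (charExt ϖE χ (s - 1 / 2) (algebraMap F E y) * charExt ϖF η (t + 1 / 2) y)

/-- `u ∈ 𝒟'(E)_{s,t}^{χ,η}`, that is, `u` is a symmetry breaking kernel: in the sense of
distributions,

(a) `u(ax) = χ_{s-1/2}(a) η_{t+1/2}(a)⁻¹ u(x)` for `a ∈ F^×`, that is,
`⟨u, φ(a⁻¹ ·)⟩ = |a|_E χ_{s-1/2}(a) η_{t+1/2}(a)⁻¹ ⟨u, φ⟩` for all test functions `φ`;

(b) `u(x / (1 - b x)) = χ_{s-1/2}((1 - b x)²)⁻¹ u(x)` on `E ∖ {b⁻¹}` for `b ∈ F^×`, that is,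
`⟨u, |1 + b ·|_E⁻² φ(· / (1 + b ·))⟩ = ⟨u, χ_{s-1/2}((1 - b ·)²)⁻¹ φ⟩` for all test functions `φ` on
`E ∖ {b⁻¹}`.

All functions to which `u` is applied are again test functions on `E`; in (b) both of them vanish
near the point where the formula has a zero denominator. -/
def IsSymmetryBreakingKernel (ϖF : Uniformizer F) (ϖE : Uniformizer E)
    (χ : PontryaginDual 𝒪[E]ˣ) (s : ℂ) (η : PontryaginDual 𝒪[F]ˣ) (t : ℂ)
    (u : Distribution E) : Prop :=
  (∀ a : F, a ≠ 0 → ∀ φ ψ : TestFunction E,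
    (∀ x : E, ψ.1 x = φ.1 ((algebraMap F E a)⁻¹ * x)) →
    u ψ = (nabs (algebraMap F E a) : ℂ) * charExt ϖE χ (s - 1 / 2) (algebraMap F E a) *
      (charExt ϖF η (t + 1 / 2) a)⁻¹ * u φ) ∧
  (∀ b : F, b ≠ 0 → ∀ φ ψ₁ ψ₂ : TestFunction E,
    φ.1 (algebraMap F E b)⁻¹ = 0 →
    (∀ x : E, ψ₁.1 x = ((nabs (1 + algebraMap F E b * x) : ℂ) ^ 2)⁻¹ *
      φ.1 (x / (1 + algebraMap F E b * x))) →
    (∀ x : E, ψ₂.1 x =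
      (charExt ϖE χ (s - 1 / 2) ((1 - algebraMap F E b * x) ^ 2))⁻¹ * φ.1 x) →
    u ψ₁ = u ψ₂)

/-- The character `χ_s|_{F^×} · η_t` of `F^×`. -/
def charPlus (ϖF : Uniformizer F) (ϖE : Uniformizer E)
    (χ : PontryaginDual 𝒪[E]ˣ) (η : PontryaginDual 𝒪[F]ˣ) (s t : ℂ) (a : F) : ℂ :=
  charExt ϖE χ s (algebraMap F E a) * charExt ϖF η t a

/-- The character `χ_s|_{F^×} · η_t⁻¹` of `F^×`. -/
def charMinus (ϖF : Uniformizer F) (ϖE : Uniformizer E)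
    (χ : PontryaginDual 𝒪[E]ˣ) (η : PontryaginDual 𝒪[F]ˣ) (s t : ℂ) (a : F) : ℂ :=
  charExt ϖE χ s (algebraMap F E a) * (charExt ϖF η t a)⁻¹

/-- The union of hyperplanes `\\`: it is empty unless `χ|_{𝒪_F^×} · η = 1`, and then it is given by
`χ_0(ϖ_F) q_F ^ (-(2s + t + 1/2)) = 1`. If `ϖ_F` is a power of `ϖ_E`, then `χ_0(ϖ_F) = 1` and the
last condition says that `2s + t + 1/2 ∈ (2πi / ln q_F) ℤ`, see `mem_backslashes_iff`. -/
def backslashes (ϖF : Uniformizer F) (ϖE : Uniformizer E)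
    (χ : PontryaginDual 𝒪[E]ˣ) (η : PontryaginDual 𝒪[F]ˣ) : Set (ℂ × ℂ) :=
  {p | (∀ u : F, u ≠ 0 → nu u = 0 →
      charExt ϖE χ 0 (algebraMap F E u) * charExt ϖF η 0 u = 1) ∧
    charExt ϖE χ 0 (algebraMap F E (ϖF : F)) *
      (resCard F : ℂ) ^ (-(2 * p.1 + p.2 + 1 / 2)) = 1}

/-- The union of hyperplanes `//`: it is empty unless `χ|_{𝒪_F^×} · η⁻¹ = 1`, and then it is given
by `χ_0(ϖ_F) q_F ^ (-(2s - t + 1/2)) = 1`. If `ϖ_F` is a power of `ϖ_E`, then `χ_0(ϖ_F) = 1` and the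
last condition says that `2s - t + 1/2 ∈ (2πi / ln q_F) ℤ`, see `mem_slashes_iff`. -/
def slashes (ϖF : Uniformizer F) (ϖE : Uniformizer E)
    (χ : PontryaginDual 𝒪[E]ˣ) (η : PontryaginDual 𝒪[F]ˣ) : Set (ℂ × ℂ) :=
  {p | (∀ u : F, u ≠ 0 → nu u = 0 →
      charExt ϖE χ 0 (algebraMap F E u) * (charExt ϖF η 0 u)⁻¹ = 1) ∧
    charExt ϖE χ 0 (algebraMap F E (ϖF : F)) *
      (resCard F : ℂ) ^ (-(2 * p.1 - p.2 + 1 / 2)) = 1}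

lemma charExt_zero_uniformizer (ϖF : Uniformizer F) (ϖE : Uniformizer E)
    (χ : PontryaginDual 𝒪[E]ˣ) {n : ℕ} (h : algebraMap F E (ϖF : F) = (ϖE : E) ^ n) :
    charExt ϖE χ 0 (algebraMap F E (ϖF : F)) = 1 := by
  have h0 : algebraMap F E (ϖF : F) ≠ 0 := by simpa using ϖF.ne_zero
  have hn : nu (algebraMap F E (ϖF : F)) = n := by
    rw [h, ← zpow_natCast, nu_zpow, ϖE.2, mul_one]
  have hu : unitPart ϖE (algebraMap F E (ϖF : F)) h0 = 1 := by
    apply Units.ext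
    apply Subtype.ext
    change (ϖE : E) ^ (-nu (algebraMap F E (ϖF : F))) * algebraMap F E (ϖF : F) = 1
    rw [hn, h, ← zpow_natCast, ← zpow_add₀ ϖE.ne_zero]
    simp
  rw [charExt, dif_neg h0, hu]
  simp

lemma cpow_neg_eq_one_iff (z : ℂ) :
    (resCard F : ℂ) ^ (-z) = 1 ↔
      ∃ k : ℤ, z = 2 * Real.pi * Complex.I / Real.log (resCard F) * k := by
  have hq : 1 < resCard F := Finite.one_lt_card
  have hl : (Real.log (resCard F) : ℂ) ≠ 0 := by
    exact_mod_cast (Real.log_pos (by exact_mod_cast hq)).ne'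
  have hq0 : (resCard F : ℂ) ≠ 0 := by exact_mod_cast (by omega : resCard F ≠ 0)
  rw [Complex.cpow_def_of_ne_zero hq0, Complex.exp_eq_one_iff, ← Complex.natCast_log]
  generalize (Real.log (resCard F) : ℂ) = L at hl ⊢
  constructor
  · rintro ⟨n, hn⟩
    refine ⟨-n, ?_⟩
    push_cast
    rw [div_mul_eq_mul_div, eq_div_iff hl]
    linear_combination (-1 : ℂ) * hn
  · rintro ⟨k, rfl⟩
    refine ⟨-k, ?_⟩
    push_cast
    field_simp

/-- For compatible uniformizers the set `\\` is given by `χ|_{𝒪_F^×} · η = 1` and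
`2s + t + 1/2 ∈ (2πi / ln q_F) ℤ`. -/
lemma mem_backslashes_iff (ϖF : Uniformizer F) (ϖE : Uniformizer E)
    (χ : PontryaginDual 𝒪[E]ˣ) (η : PontryaginDual 𝒪[F]ˣ) {n : ℕ}
    (h : algebraMap F E (ϖF : F) = (ϖE : E) ^ n) (s t : ℂ) :
    (s, t) ∈ backslashes ϖF ϖE χ η ↔
      (∀ u : F, u ≠ 0 → nu u = 0 →
        charExt ϖE χ 0 (algebraMap F E u) * charExt ϖF η 0 u = 1) ∧
      ∃ k : ℤ, 2 * s + t + 1 / 2 = 2 * Real.pi * Complex.I / Real.log (resCard F) * k := by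
  rw [backslashes, Set.mem_ofPred_eq, charExt_zero_uniformizer ϖF ϖE χ h, one_mul,
    cpow_neg_eq_one_iff]

/-- For compatible uniformizers the set `//` is given by `χ|_{𝒪_F^×} · η⁻¹ = 1` and
`2s - t + 1/2 ∈ (2πi / ln q_F) ℤ`. -/
lemma mem_slashes_iff (ϖF : Uniformizer F) (ϖE : Uniformizer E)
    (χ : PontryaginDual 𝒪[E]ˣ) (η : PontryaginDual 𝒪[F]ˣ) {n : ℕ}
    (h : algebraMap F E (ϖF : F) = (ϖE : E) ^ n) (s t : ℂ) :
    (s, t) ∈ slashes ϖF ϖE χ η ↔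
      (∀ u : F, u ≠ 0 → nu u = 0 →
        charExt ϖE χ 0 (algebraMap F E u) * (charExt ϖF η 0 u)⁻¹ = 1) ∧
      ∃ k : ℤ, 2 * s - t + 1 / 2 = 2 * Real.pi * Complex.I / Real.log (resCard F) * k := by
  rw [slashes, Set.mem_ofPred_eq, charExt_zero_uniformizer ϖF ϖE χ h, one_mul,
    cpow_neg_eq_one_iff]

end Quadratic

end

end SymBreak

/-!
Write `x = x₁ + x₂ α`, `N(x) = x₁² - x₂² d`. The kernel is the product of the function
`χ_{s-1/2}(x²) (χ_{s-1/2} η_{t+1/2})(N(x))⁻¹`, which is smooth outside of `0`, and of the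
quasi-character `χ_{s-1/2} η_{t+1/2}` of the coordinate `x₂`. In absolute value these are powers of
`|x|` and `|x₂|`, and local integrability follows from the product structure of the Haar measure in
the coordinates `x₁, x₂` (`locallyIntegrable_kernel`).

The meromorphic continuation is obtained by taking two differences. For `a₁ ∈ F^×`, pairing the kernel with
`φ - φ(a₁⁻¹ ·)` instead of `φ` multiplies the value by `1 - c₁`, where
`c₁ = |a₁|_E χ_{s-1/2}(a₁) η_{t+1/2}(a₁)⁻¹`, and this difference vanishes near `0`. After
multiplication with the smooth factor, the analogous difference for the dilation by `a₂` in the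
coordinate `x₂` vanishes near the line `F`, and it contributes the factor `1 - c₂` with
`c₂ = |a₂|_F (χ_{s-1/2} η_{t+1/2})(a₂)`. The result is the regularized distribution
`T₀ = (1 - c₁) (1 - c₂) K` (`regDist`, `regDist_eq_integral`); it is an integral over a locally
constant, compactly supported function with values in the entire functions of `(s, t)`, hence a
finite sum, and so it is entire (`analyticAt_regDist`). Both equivariance properties are changes of
variables in the domain of convergence, for the second one with the help of the inversion
`x ↦ x⁻¹`, and they extend by uniqueness of analytic continuation
(`isSymmetryBreakingKernel_regDist`). If `χ|_{𝒪_F^×} η = 1`, then `a₂ = ϖ_F` gives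
`(1 - c₂)⁻¹ = L(1/2, χ_s η_t)`; otherwise a unit `a₂` with `(χ η)(a₂) ≠ 1` gives a constant
`1 - c₂ ≠ 0`. The same holds for `a₁` and `χ η⁻¹` (`exists_poleDatum_plus`,
`exists_poleDatum_minus`).

It remains to show that no pole is removable. Along `\\` one uses the indicator function of a small
neighbourhood of `1`, for which everything can be computed
(`exists_not_extends_backslashes`). A removable point of a line in `//` would force `T₀` to
vanish on that line (`exists_not_extends_slashes`). On the line the kernel has the form
`χ(ξ)² |ξ|^{2s-1} |x₂ / N(x)|_E` with `ξ = x₂ / x̄`, and evaluating at the points where `2s - 1` is a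
large natural number shows that all moments of `|ξ|` vanish. By the Weierstrass approximation theorem
the integral over each fibre of `|ξ|` vanishes, and on a fibre the integral is a multiple of the
integral of the character `χ⁻²` over a sphere in the affine line `F + α`. Not all of these integrals
can vanish (`exists_lineIntegral_ne_zero`). Otherwise the integrals of the character, restricted to
the units, over the lines `1 + F u` would vanish for almost all `u ∈ E`; but by Fubini their integral
over the `u` in a shell just inside the conductor can be computed, and it is not zero.
-/

namespace SymBreak

set_option linter.unusedSectionVars false

/-! ### The normalized absolute value and the topology of a local field -/

section AbsoluteValue

variable {K : Type*} [Field K] [ValuativeRel K] [TopologicalSpace K]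
  [IsNonarchimedeanLocalField K]

variable (K) in
lemma one_lt_resCard : 1 < resCard K := Finite.one_lt_card

variable (K) in
lemma resCard_pos : (0 : ℝ) < resCard K := by
  exact_mod_cast zero_lt_one.trans (one_lt_resCard K)

variable (K) in
lemma one_lt_resCard_real : (1 : ℝ) < resCard K := by exact_mod_cast one_lt_resCard K

@[simp] lemma nabs_zero : nabs (0 : K) = 0 := by simp [nabs]

lemma nabs_of_ne_zero {x : K} (hx : x ≠ 0) : nabs x = (resCard K : ℝ) ^ (-nu x) := by
  simp [nabs, hx]

lemma nabs_pos {x : K} (hx : x ≠ 0) : 0 < nabs x := by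
  rw [nabs_of_ne_zero hx]; exact zpow_pos (resCard_pos K) _

lemma nabs_nonneg (x : K) : 0 ≤ nabs x := by
  by_cases hx : x = 0
  · simp [hx]
  · exact (nabs_pos hx).le

@[simp] lemma nabs_eq_zero {x : K} : nabs x = 0 ↔ x = 0 :=
  ⟨fun h => by_contra fun hx => (nabs_pos hx).ne' h, fun h => by simp [h]⟩

@[simp] lemma nabs_one : nabs (1 : K) = 1 := by
  rw [nabs_of_ne_zero one_ne_zero, nu_one]; simp

@[simp] lemma nabs_mul (x y : K) : nabs (x * y) = nabs x * nabs y := by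
  by_cases hx : x = 0
  · simp [hx]
  by_cases hy : y = 0
  · simp [hy]
  rw [nabs_of_ne_zero hx, nabs_of_ne_zero hy, nabs_of_ne_zero (mul_ne_zero hx hy), nu_mul hx hy,
    ← zpow_add₀ (resCard_pos K).ne']
  congr 1; ring

@[simp] lemma nabs_inv (x : K) : nabs x⁻¹ = (nabs x)⁻¹ := by
  by_cases hx : x = 0
  · simp [hx]
  · rw [eq_comm, inv_eq_iff_eq_inv, ← div_eq_one_iff_eq (inv_ne_zero (nabs_pos (inv_ne_zero hx)).ne'),
      div_inv_eq_mul, ← nabs_mul, mul_inv_cancel₀ hx, nabs_one]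

@[simp] lemma nabs_div (x y : K) : nabs (x / y) = nabs x / nabs y := by
  rw [div_eq_mul_inv, nabs_mul, nabs_inv, div_eq_mul_inv]

@[simp] lemma nabs_pow (x : K) (n : ℕ) : nabs (x ^ n) = nabs x ^ n := by
  induction n with
  | zero => simp
  | succ n ih => rw [pow_succ, nabs_mul, ih, pow_succ]

@[simp] lemma nabs_zpow (x : K) (n : ℤ) : nabs (x ^ n) = nabs x ^ n := by
  cases n with
  | ofNat n => simp
  | negSucc n => simp [zpow_negSucc]

lemma nabs_le_nabs_iff {x y : K} : nabs x ≤ nabs y ↔ valuation K x ≤ valuation K y := by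
  by_cases hx : x = 0
  · simp [hx, nabs_nonneg]
  by_cases hy : y = 0
  · subst hy
    simp only [nabs_zero, map_zero, le_zero_iff, map_eq_zero]
    exact ⟨fun h => absurd h (nabs_pos hx).not_ge, fun h => absurd h hx⟩
  rw [nabs_of_ne_zero hx, nabs_of_ne_zero hy, zpow_le_zpow_iff_right₀ (one_lt_resCard_real K), nu,
    nu, neg_neg, neg_neg, WithZero.log_le_log (val_iso_ne_zero hx) (val_iso_ne_zero hy)]
  exact map_le_map_iff (IsNonarchimedeanLocalField.valueGroupWithZeroIsoInt K)

lemma nabs_lt_nabs_iff {x y : K} : nabs x < nabs y ↔ valuation K x < valuation K y := by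
  rw [← not_le, ← not_le, nabs_le_nabs_iff]

lemma mem_integer_iff_nabs {x : K} : x ∈ 𝒪[K] ↔ nabs x ≤ 1 := by
  rw [← nabs_one (K := K), nabs_le_nabs_iff, map_one, Valuation.mem_integer_iff]

lemma nabs_add_le_max (x y : K) : nabs (x + y) ≤ max (nabs x) (nabs y) := by
  rcases le_total (nabs x) (nabs y) with h | h
  · rw [max_eq_right h, nabs_le_nabs_iff]
    exact (Valuation.map_add _ x y).trans (max_le (nabs_le_nabs_iff.1 h) le_rfl)
  · rw [max_eq_left h, nabs_le_nabs_iff]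
    exact (Valuation.map_add _ x y).trans (max_le le_rfl (nabs_le_nabs_iff.1 h))

@[simp] lemma nabs_neg (x : K) : nabs (-x) = nabs x :=
  le_antisymm (nabs_le_nabs_iff.2 (Valuation.map_neg _ x).le)
    (nabs_le_nabs_iff.2 (Valuation.map_neg _ x).ge)

lemma nabs_sub_le_max (x y : K) : nabs (x - y) ≤ max (nabs x) (nabs y) := by
  rw [sub_eq_add_neg, ← nabs_neg y]; exact nabs_add_le_max _ _

lemma nabs_add_eq_left {x y : K} (h : nabs y < nabs x) : nabs (x + y) = nabs x := by
  apply le_antisymm ((nabs_add_le_max x y).trans (max_le le_rfl h.le))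
  have := nabs_sub_le_max (x + y) y
  rw [add_sub_cancel_right] at this
  rcases le_max_iff.1 this with h' | h'
  · exact h'
  · exact absurd h h'.not_gt

lemma nabs_eq_one_iff {x : K} : nabs x = 1 ↔ x ≠ 0 ∧ nu x = 0 := by
  by_cases hx : x = 0
  · simp [hx]
  rw [nabs_of_ne_zero hx, zpow_eq_one_iff_right₀ (resCard_pos K).le (one_lt_resCard_real K).ne']
  simp [hx]

variable (K) in
lemma exists_uniformizer : Nonempty (Uniformizer K) := by
  obtain ⟨x, hx⟩ := ValuativeRel.valuation_surjective
    ((IsNonarchimedeanLocalField.valueGroupWithZeroIsoInt K).symm (WithZero.exp (-1 : ℤ)))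
  exact ⟨x, by simp [nu, hx]⟩

lemma Uniformizer.nabs_eq (ϖ : Uniformizer K) : nabs (ϖ : K) = (resCard K : ℝ)⁻¹ := by
  rw [nabs_of_ne_zero ϖ.ne_zero, ϖ.2, zpow_neg_one]

lemma Uniformizer.nabs_lt_one (ϖ : Uniformizer K) : nabs (ϖ : K) < 1 := by
  rw [ϖ.nabs_eq]; exact inv_lt_one_of_one_lt₀ (one_lt_resCard_real K)

lemma Uniformizer.nabs_zpow_eq (ϖ : Uniformizer K) (n : ℤ) :
    nabs ((ϖ : K) ^ n) = (resCard K : ℝ) ^ (-n) := by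
  rw [nabs_zpow, ϖ.nabs_eq, inv_zpow, zpow_neg]

/-- The absolute value takes no value strictly between two consecutive powers of `q`. -/
lemma nabs_lt_iff_le_mul (ϖ : Uniformizer K) {x y : K} (hy : y ≠ 0) :
    nabs x < nabs y ↔ nabs x ≤ nabs ((ϖ : K) * y) := by
  by_cases hx : x = 0
  · simp [hx, nabs_pos hy, nabs_nonneg]
  rw [nabs_of_ne_zero hx, nabs_of_ne_zero hy, nabs_of_ne_zero (mul_ne_zero ϖ.ne_zero hy),
    nu_mul ϖ.ne_zero hy, ϖ.2, zpow_lt_zpow_iff_right₀ (one_lt_resCard_real K),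
    zpow_le_zpow_iff_right₀ (one_lt_resCard_real K)]
  omega

lemma mem_nhds_zero_iff_nabs {s : Set K} : s ∈ 𝓝 (0 : K) ↔ ∃ r > 0, {x : K | nabs x < r} ⊆ s := by
  rw [(IsValuativeTopology.hasBasis_nhds_zero' K).mem_iff]
  constructor
  · rintro ⟨γ, hγ, h⟩
    obtain ⟨y, rfl⟩ := ValuativeRel.valuation_surjective γ
    exact ⟨nabs y, nabs_pos (by simpa using hγ), fun x hx => h (nabs_lt_nabs_iff.1 hx)⟩
  · rintro ⟨r, hr, h⟩
    obtain ⟨ϖ⟩ := exists_uniformizer K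
    obtain ⟨n, hn⟩ := exists_pow_lt_of_lt_one hr ϖ.nabs_lt_one
    refine ⟨valuation K ((ϖ : K) ^ n), by simp [ϖ.ne_zero], fun x hx => h ?_⟩
    have := nabs_lt_nabs_iff.2 hx
    rw [nabs_pow] at this
    exact this.trans hn

lemma eventually_nabs_sub_lt (x : K) {r : ℝ} (hr : 0 < r) : ∀ᶠ y in 𝓝 x, nabs (y - x) < r := by
  have h : {z : K | nabs z < r} ∈ 𝓝 (x - x) := by
    rw [sub_self]; exact mem_nhds_zero_iff_nabs.2 ⟨r, hr, subset_rfl⟩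
  exact (continuous_id.sub continuous_const).continuousAt.preimage_mem_nhds h

lemma mem_nhds_iff_nabs {s : Set K} {x : K} :
    s ∈ 𝓝 x ↔ ∃ r > 0, {y : K | nabs (y - x) < r} ⊆ s := by
  constructor
  · intro h
    have : (fun z => z + x) ⁻¹' s ∈ 𝓝 (0 : K) :=
      (continuous_id.add continuous_const).continuousAt.preimage_mem_nhds (by simpa using h)
    obtain ⟨r, hr, hs⟩ := mem_nhds_zero_iff_nabs.1 this
    exact ⟨r, hr, fun y hy => by simpa using hs hy⟩
  · rintro ⟨r, hr, h⟩
    exact Filter.mem_of_superset (eventually_nabs_sub_lt x hr) h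

lemma eventually_nabs_eq {x : K} (hx : x ≠ 0) : ∀ᶠ y in 𝓝 x, nabs y = nabs x := by
  filter_upwards [eventually_nabs_sub_lt x (nabs_pos hx)] with y hy
  have := nabs_add_eq_left hy
  rwa [add_sub_cancel] at this

lemma continuous_nabs : Continuous (nabs : K → ℝ) := by
  rw [continuous_iff_continuousAt]
  intro x
  by_cases hx : x = 0
  · subst hx
    rw [ContinuousAt, nabs_zero, Metric.tendsto_nhds]
    intro ε hε
    filter_upwards [eventually_nabs_sub_lt (0 : K) hε] with y hy
    rw [sub_zero] at hy
    rwa [dist_zero_right, Real.norm_of_nonneg (nabs_nonneg y)]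
  · exact continuousAt_const.congr ((eventually_nabs_eq hx).mono fun y hy => hy.symm)

instance : T2Space K := by
  have : T1Space K := by
    refine ⟨fun x => ?_⟩
    have : {x} = (fun y => nabs (y - x)) ⁻¹' {0} := by
      ext y; simp [sub_eq_zero]
    rw [this]
    exact isClosed_singleton.preimage (continuous_nabs.comp (continuous_id.sub continuous_const))
  infer_instance

instance : SecondCountableTopology K := by
  let := IsTopologicalAddGroup.rightUniformSpace K
  have := isUniformAddGroup_of_addCommGroup (G := K)
  let : (Valued.v (R := K)).RankOne :=
  { hom' := IsRankLeOne.nonempty.some.emb (R := K).comp MonoidWithZeroHom.ValueGroup₀.embedding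
    strictMono' := IsRankLeOne.nonempty.some.strictMono.comp
        MonoidWithZeroHom.ValueGroup₀.embedding_strictMono }
  open scoped Valued in
  have : ProperSpace K := .of_nontriviallyNormedField_of_weaklyLocallyCompactSpace K
  exact secondCountable_of_proper

lemma isClosed_nabs_le (r : ℝ) : IsClosed {x : K | nabs x ≤ r} :=
  isClosed_le continuous_nabs continuous_const

lemma isOpen_nabs_lt (r : ℝ) : IsOpen {x : K | nabs x < r} :=
  isOpen_lt continuous_nabs continuous_const

lemma exists_nabs_ge (r : ℝ) : ∃ y : K, y ≠ 0 ∧ r ≤ nabs y := by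
  obtain ⟨ϖ⟩ := exists_uniformizer K
  obtain ⟨n, hn⟩ := pow_unbounded_of_one_lt r (one_lt_resCard_real K)
  refine ⟨((ϖ : K)⁻¹) ^ n, by simp [ϖ.ne_zero], ?_⟩
  rw [nabs_pow, nabs_inv, ϖ.nabs_eq, inv_inv]
  exact hn.le

lemma isCompact_nabs_le (r : ℝ) : IsCompact {x : K | nabs x ≤ r} := by
  obtain ⟨y, -, hy⟩ := exists_nabs_ge (K := K) r
  refine (IsNonarchimedeanLocalField.isCompact_closedBall K (valuation K y)).of_isClosed_subset
    (isClosed_nabs_le r) fun x hx => nabs_le_nabs_iff.1 (le_trans hx hy)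

lemma isOpen_nabs_le {r : ℝ} (hr : 0 < r) : IsOpen {x : K | nabs x ≤ r} := by
  rw [isOpen_iff_mem_nhds]
  intro x hx
  filter_upwards [eventually_nabs_sub_lt x hr] with y hy
  have := nabs_add_le_max (y - x) x
  rw [sub_add_cancel] at this
  exact this.trans (max_le hy.le hx)

/-- A union of shells around `0` is open. -/
lemma isOpen_nabs_preimage (s : Set ℝ) (hs : (0 : ℝ) ∉ s) : IsOpen {x : K | nabs x ∈ s} := by
  rw [isOpen_iff_mem_nhds]
  intro x hx
  have hx0 : x ≠ 0 := by rintro rfl; exact hs (by simpa using hx)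
  filter_upwards [eventually_nabs_eq hx0] with y hy
  have hx' : nabs x ∈ s := hx
  rwa [hy]

end AbsoluteValue

/-! ### Haar measure on a local field -/

section Haar

variable {K : Type*} [Field K] [ValuativeRel K] [TopologicalSpace K]
  [IsNonarchimedeanLocalField K] [MeasurableSpace K]

lemma measure_nabs_le_pos (μ : Measure K) [μ.IsAddHaarMeasure] {r : ℝ} (hr : 0 < r) :
    0 < μ {x : K | nabs x ≤ r} :=
  (isOpen_nabs_le hr).measure_pos μ ⟨0, by simpa using hr.le⟩

lemma measure_nabs_le_lt_top (μ : Measure K) [μ.IsAddHaarMeasure] (r : ℝ) :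
    μ {x : K | nabs x ≤ r} < ⊤ :=
  (isCompact_nabs_le r).measure_lt_top

omit [MeasurableSpace K] in
open scoped Pointwise in
lemma smul_integer_of_ne_zero (u : Kˣ) :
    u • {x : K | nabs x ≤ 1} = {x : K | nabs x ≤ nabs (u : K)} := by
  ext x
  rw [Set.mem_smul_set_iff_inv_smul_mem]
  simp only [Units.smul_def, Units.val_inv_eq_inv_val, smul_eq_mul, Set.mem_ofPred_eq, nabs_mul,
    nabs_inv]
  rw [inv_mul_le_iff₀ (nabs_pos u.ne_zero), mul_one]

variable [BorelSpace K]

lemma measurableSet_nabs_le (r : ℝ) : MeasurableSet {x : K | nabs x ≤ r} :=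
  (isClosed_nabs_le r).measurableSet

variable (μ : Measure K) [μ.IsAddHaarMeasure]

/-- The ring of integers is the disjoint union of `q` translates of its maximal ideal. -/
lemma measure_integer_eq (ϖ : Uniformizer K) :
    μ {x : K | nabs x ≤ 1} = resCard K * μ {x : K | nabs x ≤ nabs (ϖ : K)} := by
  classical
  have : Fintype 𝓀[K] := Fintype.ofFinite _
  have hlift : ∀ c : 𝓀[K], ∃ a : 𝒪[K], IsLocalRing.residue 𝒪[K] a = c :=
    fun c => IsLocalRing.residue_surjective c
  choose l hl using hlift
  have hmem : ∀ a : 𝒪[K], IsLocalRing.residue 𝒪[K] a = 0 ↔ nabs (a : K) ≤ nabs (ϖ : K) := by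
    intro a
    have h1 := nabs_lt_iff_le_mul ϖ (x := (a : K)) (y := 1) one_ne_zero
    rw [mul_one] at h1
    rw [IsLocalRing.residue_eq_zero_iff, ← h1, IsLocalRing.mem_maximalIdeal, mem_nonunits_iff,
      lt_iff_le_and_ne, nabs_one]
    have ha : nabs (a : K) ≤ 1 := mem_integer_iff_nabs.1 a.2
    constructor
    · intro h
      refine ⟨ha, fun h' => h ?_⟩
      have h0 := nabs_eq_one_iff.1 h'
      exact ⟨mkUnit (a : K) h0.1 h0.2, Subtype.ext rfl⟩
    · rintro ⟨-, h⟩ ⟨u, rfl⟩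
      apply h
      have h2 : nabs ((u : 𝒪[K]) : K) * nabs (((u⁻¹ : 𝒪[K]ˣ) : 𝒪[K]) : K) = 1 := by
        rw [← nabs_mul, ← nabs_one (K := K)]
        congr 1
        exact congrArg Subtype.val (Units.mul_inv u)
      have h3 : nabs (((u⁻¹ : 𝒪[K]ˣ) : 𝒪[K]) : K) ≤ 1 := mem_integer_iff_nabs.1 (Subtype.property _)
      nlinarith [nabs_nonneg ((u : 𝒪[K]) : K)]
  have hU : {x : K | nabs x ≤ 1} =
      ⋃ c : 𝓀[K], (fun x => (l c : K) + x) '' {x : K | nabs x ≤ nabs (ϖ : K)} := by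
    ext x
    simp only [Set.mem_ofPred_eq, Set.mem_iUnion, Set.mem_image]
    constructor
    · intro hx
      let a : 𝒪[K] := ⟨x, mem_integer_iff_nabs.2 hx⟩
      refine ⟨IsLocalRing.residue _ a, x - l (IsLocalRing.residue _ a), ?_, by ring⟩
      refine (hmem (a - l (IsLocalRing.residue _ a))).1 ?_
      rw [map_sub, hl, sub_self]
    · rintro ⟨c, y, hy, rfl⟩
      exact (nabs_add_le_max _ _).trans
        (max_le (mem_integer_iff_nabs.1 (l c).2) (hy.trans ϖ.nabs_lt_one.le))
  have hd : Pairwise (Function.onFun Disjoint fun c : 𝓀[K] =>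
      (fun x => (l c : K) + x) '' {x : K | nabs x ≤ nabs (ϖ : K)}) := by
    intro c c' hc
    rw [Function.onFun, Set.disjoint_left]
    rintro _ ⟨y, hy, rfl⟩ ⟨y', hy', he⟩
    apply hc
    have h1 : ((l c - l c' : 𝒪[K]) : K) = y' - y := by
      push_cast
      simp only at he
      linear_combination -he
    have h2 : IsLocalRing.residue 𝒪[K] (l c - l c') = 0 := by
      rw [hmem, h1]
      exact (nabs_sub_le_max _ _).trans (max_le hy' hy)
    rw [map_sub, hl, hl] at h2
    exact sub_eq_zero.1 h2
  have hm (c : 𝓀[K]) : MeasurableSet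
      ((fun x => (l c : K) + x) '' {x : K | nabs x ≤ nabs (ϖ : K)}) :=
    (Homeomorph.addLeft (l c : K)).isClosedMap _ (isClosed_nabs_le _) |>.measurableSet
  conv_lhs => rw [hU]
  rw [measure_iUnion hd hm, tsum_fintype]
  simp only [Set.image_add_left, measure_preimage_add, Finset.sum_const, Finset.card_univ,
    nsmul_eq_mul, resCard, Nat.card_eq_fintype_card]

omit [MeasurableSpace K] [BorelSpace K] in
/-- The normalized absolute value is the modulus of multiplication. -/
lemma distribHaarChar_eq_nabs (u : Kˣ) : (distribHaarChar K u : ℝ) = nabs (u : K) := by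
  borelize K
  let μ : Measure K := Measure.addHaar
  have hpos := (measure_nabs_le_pos μ one_pos).ne'
  have htop := (measure_nabs_le_lt_top μ 1).ne
  have h1 : ∀ v : Kˣ, nabs (v : K) = 1 → distribHaarChar K v = 1 := by
    intro v hv
    apply distribHaarChar_eq_of_measure_smul_eq_mul (μ := μ) hpos htop
    rw [smul_integer_of_ne_zero, hv]; simp
  obtain ⟨ϖ⟩ := exists_uniformizer K
  have h2 : distribHaarChar K (Units.mk0 (ϖ : K) ϖ.ne_zero) = (resCard K : NNReal)⁻¹ := by
    apply distribHaarChar_eq_of_measure_smul_eq_mul (μ := μ) hpos htop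
    rw [smul_integer_of_ne_zero, Units.val_mk0, measure_integer_eq μ ϖ, ← mul_assoc,
      ENNReal.coe_inv (by exact_mod_cast (resCard_pos K).ne'), ENNReal.coe_natCast,
      ENNReal.inv_mul_cancel (by exact_mod_cast (resCard_pos K).ne') (by simp), one_mul]
  set v : Kˣ := u * (Units.mk0 (ϖ : K) ϖ.ne_zero) ^ (-nu (u : K)) with hv
  have hn : nabs (v : K) = 1 := by
    rw [hv, Units.val_mul, Units.val_zpow_eq_zpow_val, Units.val_mk0, nabs_mul, ϖ.nabs_zpow_eq,
      nabs_of_ne_zero u.ne_zero, ← zpow_add₀ (resCard_pos K).ne']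
    simp
  have hu : u = v * (Units.mk0 (ϖ : K) ϖ.ne_zero) ^ (nu (u : K)) := by
    rw [hv, mul_assoc, ← zpow_add]; simp
  rw [hu, map_mul, h1 v hn, map_zpow, h2, one_mul, ← hu, nabs_of_ne_zero u.ne_zero]
  simp

open scoped Pointwise in
lemma measure_smul_eq_nabs (u : Kˣ) (s : Set K) :
    μ (u • s) = ENNReal.ofReal (nabs (u : K)) * μ s := by
  rw [← distribHaarChar_mul, ← distribHaarChar_eq_nabs, ENNReal.ofReal_coe_nnreal]

open scoped Pointwise in
lemma map_mul_left_eq {a : K} (ha : a ≠ 0) :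
    μ.map (fun x => a * x) = ENNReal.ofReal (nabs a)⁻¹ • μ := by
  have hm : Measurable (fun x : K => a * x) := (continuous_const.mul continuous_id).measurable
  ext s hs
  rw [Measure.map_apply hm hs, Measure.smul_apply, smul_eq_mul]
  have : (fun x : K => a * x) ⁻¹' s = (Units.mk0 a ha)⁻¹ • s := by
    ext x
    rw [Set.mem_smul_set_iff_inv_smul_mem]
    simp [Units.smul_def]
  rw [this, measure_smul_eq_nabs]
  simp

open scoped Pointwise in
lemma measure_nabs_le_nabs {a : K} (ha : a ≠ 0) :
    μ {x : K | nabs x ≤ nabs a} = ENNReal.ofReal (nabs a) * μ {x : K | nabs x ≤ 1} := by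
  have h := measure_smul_eq_nabs μ (Units.mk0 a ha) {x : K | nabs x ≤ 1}
  rwa [smul_integer_of_ne_zero, Units.val_mk0] at h

lemma integral_mul_left_eq {E : Type*} [NormedAddCommGroup E] [NormedSpace ℝ E] {a : K}
    (ha : a ≠ 0) (f : K → E) : ∫ x, f (a * x) ∂μ = (nabs a)⁻¹ • ∫ x, f x ∂μ := by
  have h := (Homeomorph.mulLeft₀ a ha).measurableEmbedding.integral_map (μ := μ) f
  rw [Homeomorph.coe_mulLeft₀, map_mul_left_eq μ ha, integral_smul_measure,
    ENNReal.toReal_ofReal (inv_nonneg.2 (nabs_nonneg a))] at h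
  exact h.symm

end Haar

/-! ### The multiplicative Haar measure and inversion -/

section HaarIntegration

variable {K : Type*} [Field K] [ValuativeRel K] [TopologicalSpace K]
  [IsNonarchimedeanLocalField K] [MeasurableSpace K] [BorelSpace K]
  (μ : Measure K) [μ.IsAddHaarMeasure]

open scoped Pointwise in
lemma measure_singleton_eq_zero (x : K) : μ {x} = 0 := by
  have h0 : μ ({0} : Set K) = 0 := by
    obtain ⟨ϖ⟩ := exists_uniformizer K
    have h := measure_smul_eq_nabs μ (Units.mk0 (ϖ : K) ϖ.ne_zero) {0}
    have ht : μ ({0} : Set K) ≠ ⊤ := isCompact_singleton.measure_lt_top.ne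
    rw [Set.smul_set_singleton, smul_zero, Units.val_mk0] at h
    by_contra hne
    have h1 : ENNReal.ofReal (nabs (ϖ : K)) = 1 := by
      rw [← ENNReal.mul_left_inj hne ht, ← h, one_mul]
    rw [ENNReal.ofReal_eq_one] at h1
    exact ϖ.nabs_lt_one.ne h1
  have h := measure_preimage_add μ (-x) ({0} : Set K)
  rw [h0] at h
  convert h
  ext y
  simp [eq_comm]

lemma ae_ne_zero : ∀ᵐ x ∂μ, x ≠ 0 := by
  rw [ae_iff]; simpa using measure_singleton_eq_zero μ (0 : K)

lemma lintegral_mul_left_eq' {a : K} (ha : a ≠ 0) {f : K → ENNReal} (hf : Measurable f) :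
    ∫⁻ x, f (a * x) ∂μ = ENNReal.ofReal (nabs a)⁻¹ * ∫⁻ x, f x ∂μ := by
  have hm : Measurable fun x : K => a * x := measurable_const_mul a
  rw [← lintegral_map hf hm, map_mul_left_eq μ ha, lintegral_smul_measure, smul_eq_mul]

/-- The Haar measure `|x|⁻¹ dx` of the multiplicative group, as a measure on the field. -/
noncomputable def mulHaar : Measure K := μ.withDensity fun x => ENNReal.ofReal (nabs x)⁻¹

lemma measurable_ofReal_nabs_inv : Measurable fun x : K => ENNReal.ofReal (nabs x)⁻¹ :=
  (continuous_nabs.measurable.inv).ennreal_ofReal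

lemma lintegral_mulHaar_mul_left {a : K} (ha : a ≠ 0) {f : K → ENNReal} (hf : Measurable f) :
    ∫⁻ x, f (a * x) ∂(mulHaar μ) = ∫⁻ x, f x ∂(mulHaar μ) := by
  have hfa : Measurable fun x => f (a * x) :=
    hf.comp (measurable_const_mul a)
  have hd := measurable_ofReal_nabs_inv (K := K)
  rw [mulHaar, lintegral_withDensity_eq_lintegral_mul _ hd hfa,
    lintegral_withDensity_eq_lintegral_mul _ hd hf]
  have h := lintegral_mul_left_eq' μ ha (hd.mul hf)
  have h1 : ∀ x : K, ((fun x : K => ENNReal.ofReal (nabs x)⁻¹) * f) (a * x) =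
      ENNReal.ofReal (nabs a)⁻¹ *
        ((fun x : K => ENNReal.ofReal (nabs x)⁻¹) * fun x => f (a * x)) x := by
    intro x
    simp only [Pi.mul_apply, nabs_mul, mul_inv]
    rw [ENNReal.ofReal_mul (inv_nonneg.2 (nabs_nonneg a)), mul_assoc]
  simp_rw [h1] at h
  rw [lintegral_const_mul _ (hd.mul hfa)] at h
  have ha' := nabs_pos ha
  exact (ENNReal.mul_right_inj (by simpa using ha') ENNReal.ofReal_ne_top).1 h

lemma mulHaar_zero : mulHaar μ ({0} : Set K) = 0 :=
  withDensity_absolutelyContinuous _ _ (measure_singleton_eq_zero μ 0)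

lemma mulHaar_units : mulHaar μ {x : K | nabs x = 1} = μ {x : K | nabs x = 1} := by
  have hm : MeasurableSet {x : K | nabs x = 1} :=
    (isClosed_eq continuous_nabs continuous_const).measurableSet
  rw [mulHaar, withDensity_apply _ hm, setLIntegral_congr_fun hm (g := fun _ => 1)
    (fun x hx => by simp [Set.mem_ofPred_eq ▸ hx])]
  simp

lemma measure_units_pos : 0 < μ {x : K | nabs x = 1} :=
  (isOpen_nabs_preimage {1} (by simp)).measure_pos μ ⟨1, by simp⟩

lemma measure_units_lt_top : μ {x : K | nabs x = 1} < ⊤ :=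
  (measure_mono fun _ hx => le_of_eq hx).trans_lt (measure_nabs_le_lt_top μ 1)

/-- Uniqueness of Haar measure on the commutative group `K^×` in the guise of Tonelli's theorem:
`∫ f(x⁻¹) d^×x ∫ g(y) d^×y = ∫∫ f(x⁻¹) g(xy) = ∫∫ f(y x⁻¹) g(x) = ∫ f ∫ g`. -/
lemma lintegral_mulHaar_inv {f : K → ENNReal} (hf : Measurable f) :
    ∫⁻ x, f x⁻¹ ∂(mulHaar μ) = ∫⁻ x, f x ∂(mulHaar μ) := by
  have : SFinite (mulHaar μ) := by unfold mulHaar; infer_instance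
  have hS : MeasurableSet {x : K | nabs x = 1} :=
    (isClosed_eq continuous_nabs continuous_const).measurableSet
  have hinv : Measurable (fun x : K => x⁻¹) := by
    have : MeasurableInv K := inferInstance
    exact measurable_inv
  let g : K → ENNReal := Set.indicator {x : K | nabs x = 1} 1
  have hg : Measurable g := measurable_const.indicator hS
  have hgi : ∫⁻ x, g x ∂(mulHaar μ) = μ {x : K | nabs x = 1} := by
    simp only [g]
    rw [lintegral_indicator_one hS, mulHaar_units]
  have hne : ∀ᵐ x ∂(mulHaar μ), x ≠ 0 := by
    rw [ae_iff]; simpa using mulHaar_zero μ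
  have hmul : Measurable fun p : K × K => p.1 * p.2 := continuous_mul.measurable
  have h1 : (∫⁻ x, f x⁻¹ ∂(mulHaar μ)) * ∫⁻ y, g y ∂(mulHaar μ) =
      ∫⁻ x, ∫⁻ y, f x⁻¹ * g (x * y) ∂(mulHaar μ) ∂(mulHaar μ) := by
    have hm : Measurable fun x => f x⁻¹ := hf.comp hinv
    rw [← lintegral_mul_const _ hm]
    refine lintegral_congr_ae ?_
    filter_upwards [hne] with x hx
    have hm : Measurable fun y => g (x * y) := hg.comp (measurable_const_mul x)
    rw [lintegral_const_mul _ hm, lintegral_mulHaar_mul_left μ hx hg]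
  have h2 : (∫⁻ x, f x ∂(mulHaar μ)) * ∫⁻ y, g y ∂(mulHaar μ) =
      ∫⁻ y, ∫⁻ x, f x⁻¹ * g (x * y) ∂(mulHaar μ) ∂(mulHaar μ) := by
    have h3 : ∀ᵐ y ∂(mulHaar μ), ∫⁻ x, f x⁻¹ * g (x * y) ∂(mulHaar μ) =
        ∫⁻ x, f (y * x⁻¹) * g x ∂(mulHaar μ) := by
      filter_upwards [hne] with y hy
      have hm : Measurable fun x : K => f (y * x⁻¹) * g x :=
        (hf.comp ((measurable_const_mul y).comp hinv)).mul hg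
      rw [← lintegral_mulHaar_mul_left μ hy hm]
      refine lintegral_congr_ae ?_
      filter_upwards [hne] with x hx
      rw [mul_inv, mul_inv_cancel_left₀ hy, mul_comm x y]
    have hm2 : Measurable (Function.uncurry fun y x : K => f (y * x⁻¹) * g x) :=
      (hf.comp (hmul.comp (measurable_fst.prodMk (hinv.comp measurable_snd)))).mul
        (hg.comp measurable_snd)
    rw [lintegral_congr_ae h3, lintegral_lintegral_swap hm2.aemeasurable,
      ← lintegral_const_mul _ hg]
    refine lintegral_congr_ae ?_
    filter_upwards [hne] with x hx
    have hm : Measurable fun y => f (y * x⁻¹) := hf.comp (measurable_mul_const x⁻¹)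
    rw [lintegral_mul_const _ hm]
    congr 1
    simp_rw [mul_comm _ x⁻¹]
    rw [lintegral_mulHaar_mul_left μ (inv_ne_zero hx) hf]
  have hm3 : Measurable (Function.uncurry fun x y : K => f x⁻¹ * g (x * y)) :=
    (hf.comp (hinv.comp measurable_fst)).mul (hg.comp hmul)
  rw [lintegral_lintegral_swap hm3.aemeasurable, ← h2, hgi] at h1
  exact (ENNReal.mul_left_inj (measure_units_pos μ).ne' (measure_units_lt_top μ).ne).1 h1

lemma map_inv_mulHaar : (mulHaar μ).map (fun x : K => x⁻¹) = mulHaar μ := by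
  have hinv : Measurable (fun x : K => x⁻¹) := by
    have : MeasurableInv K := inferInstance
    exact measurable_inv
  ext s hs
  rw [Measure.map_apply hinv hs, ← lintegral_indicator_one hs, ← lintegral_mulHaar_inv μ
    (measurable_one.indicator hs), ← lintegral_indicator_one (hinv hs)]
  rfl

lemma integral_mulHaar {E : Type*} [NormedAddCommGroup E] [NormedSpace ℝ E] (f : K → E) :
    ∫ x, f x ∂(mulHaar μ) = ∫ x, (nabs x)⁻¹ • f x ∂μ := by
  have h := integral_withDensity_eq_integral_toReal_smul (μ := μ)
    (measurable_ofReal_nabs_inv (K := K)) (by simp) f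
  rw [mulHaar, h]
  simp_rw [ENNReal.toReal_ofReal (inv_nonneg.2 (nabs_nonneg _))]

/-- Change of variables under the inversion `x ↦ x⁻¹`. -/
lemma integral_comp_inv (f : K → ℂ) :
    ∫ x, ((nabs x : ℂ) ^ 2)⁻¹ * f x⁻¹ ∂μ = ∫ x, f x ∂μ := by
  have hemb : MeasurableEmbedding (fun x : K => x⁻¹) := by
    have : MeasurableInv K := inferInstance
    exact (MeasurableEquiv.inv K).measurableEmbedding
  have h := hemb.integral_map (μ := mulHaar μ) (fun x => nabs x • f x)
  rw [map_inv_mulHaar, integral_mulHaar, integral_mulHaar] at h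
  have h1 : ∫ x, f x ∂μ = ∫ x, (nabs x)⁻¹ • nabs x • f x ∂μ := by
    refine integral_congr_ae ?_
    filter_upwards [ae_ne_zero μ] with x hx
    rw [smul_smul, inv_mul_cancel₀ (nabs_pos hx).ne', one_smul]
  rw [h1, h]
  refine integral_congr_ae (.of_forall fun x => ?_)
  simp only [nabs_inv, Complex.real_smul, Complex.ofReal_inv]
  rw [sq, mul_inv, mul_assoc]

lemma lintegral_nabs_rpow_lt_top {p : ℝ} (hp : 0 < p) {a : K} (ha : a ≠ 0) :
    ∫⁻ x in {x : K | nabs x ≤ nabs a}, ENNReal.ofReal (nabs x ^ (p - 1)) ∂μ < ⊤ := by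
  obtain ⟨ϖ⟩ := exists_uniformizer K
  set q : ℝ := nabs (ϖ : K) with hq
  have hq0 : 0 < q := nabs_pos ϖ.ne_zero
  have hna := nabs_pos ha
  let S : ℕ → Set K := fun n => {x | nabs x = nabs ((ϖ : K) ^ n * a)}
  have hnz (n : ℕ) : (ϖ : K) ^ n * a ≠ 0 := mul_ne_zero (pow_ne_zero _ ϖ.ne_zero) ha
  have hS (n : ℕ) : MeasurableSet (S n) :=
    (isClosed_eq continuous_nabs continuous_const).measurableSet
  have hcov : {x : K | nabs x ≤ nabs a} ⊆ (⋃ n, S n) ∪ {0} := by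
    intro x hx
    by_cases hx0 : x = 0
    · right; exact hx0
    left
    rw [Set.mem_iUnion]
    have h2 : nu a ≤ nu x := by
      have : nabs x ≤ nabs a := hx
      rw [nabs_of_ne_zero hx0, nabs_of_ne_zero ha,
        zpow_le_zpow_iff_right₀ (one_lt_resCard_real K)] at this
      omega
    refine ⟨(nu x - nu a).toNat, ?_⟩
    change nabs x = _
    rw [nabs_of_ne_zero hx0, nabs_of_ne_zero (hnz _), nu_mul (pow_ne_zero _ ϖ.ne_zero) ha,
      ← zpow_natCast, nu_zpow, ϖ.2]
    congr 1
    omega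
  have hterm (n : ℕ) : ∫⁻ x in S n, ENNReal.ofReal (nabs x ^ (p - 1)) ∂μ ≤
      (ENNReal.ofReal (nabs a ^ p) * μ {x : K | nabs x ≤ 1}) * (ENNReal.ofReal (q ^ p)) ^ n := by
    rw [setLIntegral_congr_fun (hS n)
      (g := fun _ => ENNReal.ofReal (nabs ((ϖ : K) ^ n * a) ^ (p - 1))) (fun x hx => by
        have : nabs x = _ := hx
        simp only [this])]
    rw [setLIntegral_const]
    have hle : μ (S n) ≤ ENNReal.ofReal (nabs ((ϖ : K) ^ n * a)) * μ {x : K | nabs x ≤ 1} := by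
      rw [← measure_nabs_le_nabs μ (hnz n)]
      exact measure_mono fun x hx => le_of_eq hx
    refine (mul_le_mul_right hle _).trans (le_of_eq ?_)
    have hn := nabs_pos (hnz n)
    rw [← mul_assoc, ← ENNReal.ofReal_mul (by positivity), ← Real.rpow_add_one hn.ne',
      sub_add_cancel, nabs_mul, nabs_pow, Real.mul_rpow (by positivity) hna.le, ← hq,
      ← ENNReal.ofReal_pow (by positivity), ← Real.rpow_natCast, ← Real.rpow_mul hq0.le,
      ← Real.rpow_natCast (q ^ p), ← Real.rpow_mul hq0.le, mul_comm (n : ℝ) p,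
      ENNReal.ofReal_mul (by positivity)]
    ring
  calc ∫⁻ x in {x : K | nabs x ≤ nabs a}, ENNReal.ofReal (nabs x ^ (p - 1)) ∂μ
      ≤ ∫⁻ x in (⋃ n, S n) ∪ {0}, ENNReal.ofReal (nabs x ^ (p - 1)) ∂μ :=
        lintegral_mono_set hcov
    _ ≤ ∫⁻ x in ⋃ n, S n, ENNReal.ofReal (nabs x ^ (p - 1)) ∂μ +
        ∫⁻ x in ({0} : Set K), ENNReal.ofReal (nabs x ^ (p - 1)) ∂μ := lintegral_union_le _ _ _
    _ = ∫⁻ x in ⋃ n, S n, ENNReal.ofReal (nabs x ^ (p - 1)) ∂μ := by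
        rw [setLIntegral_measure_zero _ _ (measure_singleton_eq_zero μ 0), add_zero]
    _ ≤ ∑' n, ∫⁻ x in S n, ENNReal.ofReal (nabs x ^ (p - 1)) ∂μ := lintegral_iUnion_le _ _
    _ ≤ ∑' n, (ENNReal.ofReal (nabs a ^ p) * μ {x : K | nabs x ≤ 1}) *
        (ENNReal.ofReal (q ^ p)) ^ n := ENNReal.tsum_le_tsum hterm
    _ < ⊤ := by
        rw [ENNReal.tsum_mul_left, ENNReal.tsum_geometric]
        refine ENNReal.mul_lt_top
          (ENNReal.mul_lt_top ENNReal.ofReal_lt_top (measure_nabs_le_lt_top μ 1)) ?_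
        rw [ENNReal.inv_lt_top, tsub_pos_iff_lt, ENNReal.ofReal_lt_one]
        exact Real.rpow_lt_one hq0.le ϖ.nabs_lt_one hp

lemma integrableOn_nabs_rpow {p : ℝ} (hp : 0 < p) (r : ℝ) :
    IntegrableOn (fun x : K => nabs x ^ (p - 1)) {x : K | nabs x ≤ r} μ := by
  obtain ⟨a, ha, hr⟩ := exists_nabs_ge (K := K) r
  refine IntegrableOn.mono_set (t := {x : K | nabs x ≤ nabs a}) ?_ fun x hx => le_trans hx hr
  refine ⟨(continuous_nabs.measurable.pow_const _).aestronglyMeasurable, ?_⟩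
  rw [hasFiniteIntegral_iff_ofReal (.of_forall fun x => Real.rpow_nonneg (nabs_nonneg x) _)]
  exact lintegral_nabs_rpow_lt_top μ hp ha

end HaarIntegration

/-! ### Quasi-characters -/

section Characters

variable {K : Type*} [Field K] [ValuativeRel K] [TopologicalSpace K]
  [IsNonarchimedeanLocalField K]

/-- The circle group has no small subgroups: the doubling map expands the distance to `1`. -/
lemma eq_one_of_norm_pow_sub_one_lt {z : ℂ} (hz : ‖z‖ = 1) (h : ∀ n : ℕ, ‖z ^ n - 1‖ < 1) :
    z = 1 := by
  have hre : ∀ w : ℂ, ‖w‖ = 1 → ‖w - 1‖ ^ 2 = 2 - 2 * w.re := by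
    intro w hw
    have h1 : w.re * w.re + w.im * w.im = 1 := by
      rw [← Complex.normSq_apply, Complex.normSq_eq_norm_sq, hw, one_pow]
    rw [← Complex.normSq_eq_norm_sq, Complex.normSq_apply]
    simp only [Complex.sub_re, Complex.one_re, Complex.sub_im, Complex.one_im]
    linear_combination h1
  have hdbl : ∀ w : ℂ, ‖w‖ = 1 → (w ^ 2).re = 2 * w.re ^ 2 - 1 := by
    intro w hw
    have h1 : w.re * w.re + w.im * w.im = 1 := by
      rw [← Complex.normSq_apply, Complex.normSq_eq_norm_sq, hw, one_pow]
    rw [sq, Complex.mul_re]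
    linear_combination -h1
  have hn : ∀ n : ℕ, ‖z ^ n‖ = 1 := fun n => by rw [norm_pow, hz, one_pow]
  have hhalf : ∀ n : ℕ, 1 / 2 < (z ^ n).re := by
    intro n
    have h1 := hre _ (hn n)
    have h2 := h n
    nlinarith [norm_nonneg (z ^ n - 1)]
  have hgrow : ∀ n : ℕ, 3 ^ n * (1 - z.re) ≤ 1 - (z ^ (2 ^ n)).re := by
    intro n
    induction n with
    | zero => simp
    | succ n ih =>
      have h1 := hdbl _ (hn (2 ^ n))
      rw [← pow_mul, ← pow_succ] at h1
      rw [h1, pow_succ]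
      have h2 := hhalf (2 ^ n)
      have h3 : (z ^ (2 ^ n)).re ≤ 1 := (Complex.re_le_norm _).trans (hn _).le
      nlinarith
  have hle : z.re ≤ 1 := (Complex.re_le_norm z).trans hz.le
  have h1 : z.re = 1 := by
    by_contra hne
    have hpos : 0 < 1 - z.re := sub_pos.2 (lt_of_le_of_ne hle hne)
    obtain ⟨n, hn'⟩ := pow_unbounded_of_one_lt (1 / (1 - z.re)) (by norm_num : (1 : ℝ) < 3)
    rw [div_lt_iff₀ hpos] at hn'
    linarith [hgrow n, hhalf (2 ^ n)]
  have h2 := hre z hz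
  rw [h1] at h2
  have h3 : ‖z - 1‖ = 0 := by nlinarith [norm_nonneg (z - 1)]
  exact sub_eq_zero.1 (norm_eq_zero.1 h3)

variable (ϖ : Uniformizer K) (χ : PontryaginDual 𝒪[K]ˣ)

@[simp] lemma charExt_zero (s : ℂ) : charExt ϖ χ s 0 = 0 := by simp [charExt]

lemma charExt_of_ne_zero (s : ℂ) {x : K} (hx : x ≠ 0) :
    charExt ϖ χ s x = (χ (unitPart ϖ x hx) : ℂ) * (nabs x : ℂ) ^ s := by simp [charExt, hx]

lemma unitPart_mul {x y : K} (hx : x ≠ 0) (hy : y ≠ 0) :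
    unitPart ϖ (x * y) (mul_ne_zero hx hy) = unitPart ϖ x hx * unitPart ϖ y hy := by
  apply Units.ext
  apply Subtype.ext
  change (ϖ : K) ^ (-nu (x * y)) * (x * y) = ((ϖ : K) ^ (-nu x) * x) * ((ϖ : K) ^ (-nu y) * y)
  rw [nu_mul hx hy, neg_add, zpow_add₀ ϖ.ne_zero]
  ring

@[simp] lemma charExt_mul (s : ℂ) (x y : K) :
    charExt ϖ χ s (x * y) = charExt ϖ χ s x * charExt ϖ χ s y := by
  by_cases hx : x = 0
  · simp [hx]
  by_cases hy : y = 0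
  · simp [hy]
  rw [charExt_of_ne_zero ϖ χ s hx, charExt_of_ne_zero ϖ χ s hy,
    charExt_of_ne_zero ϖ χ s (mul_ne_zero hx hy), unitPart_mul ϖ hx hy, map_mul, nabs_mul,
    Complex.ofReal_mul, Complex.mul_cpow_ofReal_nonneg (nabs_nonneg x) (nabs_nonneg y),
    Circle.coe_mul]
  ring

lemma charExt_ne_zero (s : ℂ) {x : K} (hx : x ≠ 0) : charExt ϖ χ s x ≠ 0 := by
  rw [charExt_of_ne_zero ϖ χ s hx]
  refine mul_ne_zero (Circle.coe_ne_zero _) ?_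
  rw [Complex.cpow_ne_zero_iff]
  left
  exact_mod_cast (nabs_pos hx).ne'

@[simp] lemma charExt_one (s : ℂ) : charExt ϖ χ s 1 = 1 := by
  have h := charExt_mul ϖ χ s 1 1
  rw [mul_one] at h
  exact (mul_eq_left₀ (charExt_ne_zero ϖ χ s one_ne_zero)).1 h.symm

@[simp] lemma charExt_inv (s : ℂ) (x : K) : charExt ϖ χ s x⁻¹ = (charExt ϖ χ s x)⁻¹ := by
  by_cases hx : x = 0
  · simp [hx]
  · exact eq_inv_of_mul_eq_one_left (by rw [← charExt_mul, inv_mul_cancel₀ hx, charExt_one])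

@[simp] lemma charExt_div (s : ℂ) (x y : K) :
    charExt ϖ χ s (x / y) = charExt ϖ χ s x / charExt ϖ χ s y := by
  rw [div_eq_mul_inv, charExt_mul, charExt_inv, div_eq_mul_inv]

@[simp] lemma charExt_pow (s : ℂ) (x : K) (n : ℕ) :
    charExt ϖ χ s (x ^ n) = charExt ϖ χ s x ^ n := by
  induction n with
  | zero => simp
  | succ n ih => rw [pow_succ, charExt_mul, ih, pow_succ]

lemma charExt_eq_mul_cpow (s : ℂ) {x : K} (hx : x ≠ 0) :
    charExt ϖ χ s x = charExt ϖ χ 0 x * (nabs x : ℂ) ^ s := by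
  simp [charExt_of_ne_zero ϖ χ _ hx]

lemma norm_charExt (s : ℂ) {x : K} (hx : x ≠ 0) : ‖charExt ϖ χ s x‖ = nabs x ^ s.re := by
  rw [charExt_of_ne_zero ϖ χ s hx, norm_mul, Circle.norm_coe, one_mul,
    Complex.norm_cpow_eq_rpow_re_of_pos (nabs_pos hx)]

lemma norm_charExt_zero_le_one (x : K) : ‖charExt ϖ χ 0 x‖ ≤ 1 := by
  by_cases hx : x = 0
  · simp [hx]
  · rw [norm_charExt ϖ χ 0 hx]; simp

lemma charExt_of_nabs_eq_one (s : ℂ) {x : K} (hx : nabs x = 1) :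
    charExt ϖ χ s x = charExt ϖ χ 0 x := by
  rw [charExt_eq_mul_cpow ϖ χ s (nabs_eq_one_iff.1 hx).1, hx]; simp

lemma charExt_zero_uniformizer_self : charExt ϖ χ 0 (ϖ : K) = 1 := by
  have hu : unitPart ϖ (ϖ : K) ϖ.ne_zero = 1 := by
    apply Units.ext
    apply Subtype.ext
    change (ϖ : K) ^ (-nu (ϖ : K)) * (ϖ : K) = 1
    rw [ϖ.2, zpow_neg_one, inv_mul_cancel₀ ϖ.ne_zero]
  rw [charExt_of_ne_zero ϖ χ 0 ϖ.ne_zero, hu]; simp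

lemma nabs_eq_one_of_sub_lt {x : K} (h : nabs (x - 1) < 1) : nabs x = 1 := by
  have := nabs_add_eq_left (x := 1) (y := x - 1) (by simpa using h)
  simpa using this

/-- Quasi-characters are trivial on a neighbourhood of `1`, uniformly in the parameter `s`. -/
lemma exists_charExt_eq_one : ∃ r > 0, r ≤ 1 ∧ ∀ x : K, nabs (x - 1) < r → ∀ s,
    charExt ϖ χ s x = 1 := by
  let U := {x : K // nabs (x - 1) < 1}
  have hU (x : U) := nabs_eq_one_iff.1 (nabs_eq_one_of_sub_lt x.2)
  let g : U → 𝒪[K]ˣ := fun x => mkUnit (x : K) (hU x).1 (hU x).2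
  have hg : Continuous g := by
    rw [Units.continuous_iff]
    constructor
    · exact Continuous.subtype_mk continuous_subtype_val _
    · refine Continuous.subtype_mk ?_ _
      exact continuous_subtype_val.inv₀ fun x => (hU x).1
  have hgχ : ∀ (x : U) (s : ℂ), charExt ϖ χ s (x : K) = (χ (g x) : ℂ) := by
    intro x s
    have hu : unitPart ϖ (x : K) (hU x).1 = g x := by
      apply Units.ext
      apply Subtype.ext
      change (ϖ : K) ^ (-nu (x : K)) * (x : K) = (x : K)
      rw [(hU x).2]; simp
    rw [charExt_of_nabs_eq_one ϖ χ s (nabs_eq_one_of_sub_lt x.2),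
      charExt_of_ne_zero ϖ χ 0 (hU x).1, hu]
    simp
  have h1 : nabs ((1 : K) - 1) < 1 := by simp
  have hc : Continuous fun x : U => (χ (g x) : ℂ) :=
    continuous_induced_dom.comp ((map_continuous χ).comp hg)
  have hev : ∀ᶠ x : U in 𝓝 ⟨1, h1⟩, ‖(χ (g x) : ℂ) - 1‖ < 1 := by
    have : ContinuousAt (fun x : U => ‖(χ (g x) : ℂ) - 1‖) ⟨1, h1⟩ :=
      (hc.sub continuous_const).norm.continuousAt
    refine this.eventually_lt continuousAt_const ?_
    have := hgχ ⟨1, h1⟩ 0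
    rw [← this]
    simp
  rw [(nhds_subtype_eq_comap : 𝓝 (⟨1, h1⟩ : U) = _), Filter.eventually_comap] at hev
  obtain ⟨r, hr, hrs⟩ := mem_nhds_iff_nabs.1 hev
  refine ⟨min r 1, lt_min hr one_pos, min_le_right _ _, fun x hx s => ?_⟩
  have hx1 : nabs (x - 1) < 1 := hx.trans_le (min_le_right _ _)
  have hpow : ∀ n : ℕ, nabs (x ^ n - 1) < min r 1 := by
    intro n
    induction n with
    | zero => simpa using hr
    | succ n ih =>
      have : x ^ (n + 1) - 1 = x * (x ^ n - 1) + (x - 1) := by ring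
      rw [this]
      refine (nabs_add_le_max _ _).trans_lt (max_lt ?_ hx)
      rwa [nabs_mul, nabs_eq_one_of_sub_lt hx1, one_mul]
  apply eq_one_of_norm_pow_sub_one_lt
  · rw [norm_charExt ϖ χ s (nabs_eq_one_iff.1 (nabs_eq_one_of_sub_lt hx1)).1,
      nabs_eq_one_of_sub_lt hx1, Real.one_rpow]
  · intro n
    have hn1 : nabs (x ^ n - 1) < 1 := (hpow n).trans_le (min_le_right _ _)
    have := hrs ((hpow n).trans_le (min_le_left _ _)) ⟨x ^ n, hn1⟩ rfl
    rw [← charExt_pow]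
    rwa [← hgχ ⟨x ^ n, hn1⟩ s] at this

/-- Quasi-characters are locally constant on `K^×`, uniformly in the parameter `s`. -/
lemma eventually_charExt_eq {x : K} (hx : x ≠ 0) :
    ∀ᶠ y in 𝓝 x, ∀ s, charExt ϖ χ s y = charExt ϖ χ s x := by
  obtain ⟨r, hr, -, h⟩ := exists_charExt_eq_one ϖ χ
  filter_upwards [eventually_nabs_sub_lt x (mul_pos hr (nabs_pos hx))] with y hy s
  have h1 : charExt ϖ χ s (y / x) = 1 := by
    apply h
    rwa [div_sub_one hx, nabs_div, div_lt_iff₀ (nabs_pos hx)]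
  rw [charExt_div, div_eq_one_iff_eq (charExt_ne_zero ϖ χ s hx)] at h1
  exact h1

lemma measurable_charExt [MeasurableSpace K] [BorelSpace K] (s : ℂ) :
    Measurable (charExt ϖ χ s) := by
  have h : ContinuousOn (charExt ϖ χ s) {0}ᶜ := fun x hx =>
    (continuousAt_const.congr ((eventually_charExt_eq ϖ χ (x := x) hx).mono
      fun y hy => (hy s).symm)).continuousWithinAt
  exact measurable_of_continuousOn_compl_singleton 0 h

lemma analyticAt_charExt {E : Type*} [NormedAddCommGroup E] [NormedSpace ℂ E] {f : E → ℂ}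
    {p : E} (hf : AnalyticAt ℂ f p) (x : K) :
    AnalyticAt ℂ (fun z => charExt ϖ χ (f z) x) p := by
  by_cases hx : x = 0
  · simp only [hx, charExt_zero]; exact analyticAt_const
  · have hn : (nabs x : ℂ) ≠ 0 := by exact_mod_cast (nabs_pos hx).ne'
    have : (fun z => charExt ϖ χ (f z) x) =
        fun z => charExt ϖ χ 0 x * Complex.exp (Complex.log (nabs x) * f z) := by
      funext z
      rw [charExt_eq_mul_cpow ϖ χ _ hx, Complex.cpow_def_of_ne_zero hn]
    rw [this]
    exact analyticAt_const.mul ((analyticAt_const.mul hf).cexp)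

end Characters

/-! ### Coordinates on a quadratic extension -/

section Coordinates

variable {F E : Type*}
  [Field F] [ValuativeRel F] [TopologicalSpace F] [IsNonarchimedeanLocalField F]
  [Field E] [ValuativeRel E] [TopologicalSpace E] [IsNonarchimedeanLocalField E]
  [Algebra F E] [ValuativeExtension F E]

lemma nabs_algebraMap_le_iff {a b : F} :
    nabs (algebraMap F E a) ≤ nabs (algebraMap F E b) ↔ nabs a ≤ nabs b := by
  rw [nabs_le_nabs_iff, nabs_le_nabs_iff, ← Valuation.Compatible.vle_iff_le,
    ← Valuation.Compatible.vle_iff_le]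
  exact ValuativeExtension.vle_iff_vle a b

lemma nabs_algebraMap_lt_iff {a b : F} :
    nabs (algebraMap F E a) < nabs (algebraMap F E b) ↔ nabs a < nabs b := by
  rw [← not_le, nabs_algebraMap_le_iff, not_le]

variable (F E) in
lemma continuous_algebraMap_localField : Continuous (algebraMap F E) := by
  refine continuous_of_continuousAt_zero (algebraMap F E).toAddMonoidHom ?_
  change Filter.Tendsto (algebraMap F E) (𝓝 0) (𝓝 (algebraMap F E 0))
  rw [map_zero]
  intro s hs
  obtain ⟨r, hr, h⟩ := mem_nhds_zero_iff_nabs.1 hs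
  obtain ⟨ϖ⟩ := exists_uniformizer F
  have h1 : nabs (algebraMap F E (ϖ : F)) < 1 := by
    rw [← nabs_one (K := E), ← map_one (algebraMap F E), nabs_algebraMap_lt_iff, nabs_one]
    exact ϖ.nabs_lt_one
  obtain ⟨n, hn⟩ := exists_pow_lt_of_lt_one hr h1
  refine mem_nhds_zero_iff_nabs.2 ⟨nabs ((ϖ : F) ^ n), nabs_pos (pow_ne_zero _ ϖ.ne_zero),
    fun x hx => h ?_⟩
  have h2 := nabs_algebraMap_lt_iff (E := E).2 hx
  rw [map_pow, nabs_pow] at h2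
  exact h2.trans hn

variable (B : Module.Basis (Fin 2) F E)

lemma repr_sum (x : E) : B.repr x 0 • B 0 + B.repr x 1 • B 1 = x := by
  have := B.sum_repr x
  rwa [Fin.sum_univ_two] at this

@[simp] lemma repr_comb_zero (a b : F) : B.repr (a • B 0 + b • B 1) 0 = a := by
  simp

@[simp] lemma repr_comb_one (a b : F) : B.repr (a • B 0 + b • B 1) 1 = b := by
  simp

/-- The coordinates with respect to a basis, as an isomorphism of topological groups
`F × F ≃ E`. Its inverse is continuous by the open mapping theorem for locally compact groups. -/
noncomputable def coordHomeo : F × F ≃ₜ E :=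
  let f : F × F →+ E :=
    { toFun := fun p => p.1 • B 0 + p.2 • B 1
      map_zero' := by simp
      map_add' := fun p q => by simp only [Prod.fst_add, Prod.snd_add, add_smul]; abel }
  let e : F × F ≃ E :=
    { toFun := f
      invFun := fun x => (B.repr x 0, B.repr x 1)
      left_inv := fun p => Prod.ext (repr_comb_zero B _ _) (repr_comb_one B _ _)
      right_inv := fun x => repr_sum B x }
  have hc : Continuous f := by
    have h := continuous_algebraMap_localField F E
    change Continuous fun p : F × F => p.1 • B 0 + p.2 • B 1
    simp only [Algebra.smul_def]
    exact ((h.comp continuous_fst).mul continuous_const).add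
      ((h.comp continuous_snd).mul continuous_const)
  e.toHomeomorphOfContinuousOpen hc (AddMonoidHom.isOpenMap_of_sigmaCompact f e.surjective hc)

lemma coordHomeo_apply (p : F × F) : coordHomeo B p = p.1 • B 0 + p.2 • B 1 := rfl

lemma coordHomeo_symm_apply (x : E) : (coordHomeo B).symm x = (B.repr x 0, B.repr x 1) := rfl

lemma continuous_repr (i : Fin 2) : Continuous fun x => B.repr x i := by
  have h := (coordHomeo B).symm.continuous
  fin_cases i
  · exact continuous_fst.comp h
  · exact continuous_snd.comp h

/-- The diagonal map `x₁ e₁ + x₂ e₂ ↦ a x₁ e₁ + b x₂ e₂`. -/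
noncomputable def diagMap (a b : F) (x : E) : E :=
  coordHomeo B (a * B.repr x 0, b * B.repr x 1)

lemma diagMap_coord (a b : F) (p : F × F) :
    diagMap B a b (coordHomeo B p) = coordHomeo B (a * p.1, b * p.2) := by
  simp [diagMap, coordHomeo_apply]

lemma continuous_diagMap (a b : F) : Continuous (diagMap B a b) :=
  (coordHomeo B).continuous.comp ((continuous_const.mul (continuous_repr B 0)).prodMk
    (continuous_const.mul (continuous_repr B 1)))

lemma diagMap_self (a : F) (x : E) : diagMap B a a x = algebraMap F E a * x := by
  rw [diagMap, coordHomeo_apply, ← Algebra.smul_def]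
  conv_rhs => rw [← repr_sum B x, smul_add, smul_smul, smul_smul]

lemma diagMap_inv_left {a b : F} (ha : a ≠ 0) (hb : b ≠ 0) (x : E) :
    diagMap B a⁻¹ b⁻¹ (diagMap B a b x) = x := by
  rw [← (coordHomeo B).apply_symm_apply x, diagMap_coord, diagMap_coord]
  simp [inv_mul_cancel_left₀ ha, inv_mul_cancel_left₀ hb]

/-- The diagonal map as a homeomorphism. -/
noncomputable def diagHomeo {a b : F} (ha : a ≠ 0) (hb : b ≠ 0) : E ≃ₜ E where
  toFun := diagMap B a b
  invFun := diagMap B a⁻¹ b⁻¹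
  left_inv := diagMap_inv_left B ha hb
  right_inv x := by
    have := diagMap_inv_left B (inv_ne_zero ha) (inv_ne_zero hb) x
    rwa [inv_inv, inv_inv] at this
  continuous_toFun := continuous_diagMap B a b
  continuous_invFun := continuous_diagMap B a⁻¹ b⁻¹

variable [MeasurableSpace F] [BorelSpace F] [MeasurableSpace E] [BorelSpace E]
  (μ : Measure E) [μ.IsAddHaarMeasure] (ν : Measure F) [ν.IsAddHaarMeasure]

/-- In coordinates, a Haar measure on `E` is a multiple of the product of Haar measures. -/
lemma exists_haar_eq_smul_prod :
    ∃ c : NNReal, c ≠ 0 ∧ μ = c • (ν.prod ν).map (coordHomeo B) := by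
  have hc : Continuous (coordHomeo B) := (coordHomeo B).continuous
  let f : F × F ≃+ E :=
    { (coordHomeo B).toEquiv with
      map_add' := fun p q => by
        change (p + q).1 • B 0 + (p + q).2 • B 1 =
          (p.1 • B 0 + p.2 • B 1) + (q.1 • B 0 + q.2 • B 1)
        simp only [Prod.fst_add, Prod.snd_add, add_smul]; abel }
  have h1 : ((ν.prod ν).map f).IsAddHaarMeasure :=
    f.isAddHaarMeasure_map (ν.prod ν) hc (coordHomeo B).symm.continuous
  have h2 : (ν.prod ν).map f = (ν.prod ν).map (coordHomeo B) := rfl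
  rw [h2] at h1
  refine ⟨_, ?_, Measure.isAddLeftInvariant_eq_smul μ ((ν.prod ν).map (coordHomeo B))⟩
  exact (Measure.addHaarScalarFactor_pos_of_isAddHaarMeasure _ _).ne'

lemma map_prod_mul {a b : F} (ha : a ≠ 0) (hb : b ≠ 0) :
    (ν.prod ν).map (Prod.map (a * ·) (b * ·)) =
      (ENNReal.ofReal (nabs a)⁻¹ * ENNReal.ofReal (nabs b)⁻¹) • ν.prod ν := by
  rw [← Measure.map_prod_map ν ν (measurable_const_mul a) (measurable_const_mul b),
    map_mul_left_eq ν ha, map_mul_left_eq ν hb, Measure.prod_smul_left, Measure.prod_smul_right,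
    smul_smul]

lemma map_diagMap {a b : F} (ha : a ≠ 0) (hb : b ≠ 0) : μ.map (diagMap B a b) =
    (ENNReal.ofReal (nabs a)⁻¹ * ENNReal.ofReal (nabs b)⁻¹) • μ := by
  let ν : Measure F := Measure.addHaar
  obtain ⟨c, -, hc⟩ := exists_haar_eq_smul_prod B μ ν
  have hΦ := (coordHomeo B).continuous.measurable
  rw [hc, Measure.map_smul, Measure.map_map (continuous_diagMap B a b).measurable hΦ]
  have h1 : diagMap B a b ∘ coordHomeo B = coordHomeo B ∘ Prod.map (a * ·) (b * ·) := by
    funext p; exact diagMap_coord B a b p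
  rw [h1, ← Measure.map_map hΦ ((measurable_const_mul a).prodMap (measurable_const_mul b)),
    map_prod_mul ν ha hb, Measure.map_smul, smul_comm]

omit [MeasurableSpace F] [BorelSpace F] [MeasurableSpace E] [BorelSpace E] in
include B in
/-- The absolute value of `E` restricts to the square of the one of `F`, because multiplication by
`a ∈ F` on `E ≃ F × F` is multiplication by `a` in both coordinates. -/
lemma nabs_algebraMap (a : F) : nabs (algebraMap F E a) = nabs a ^ 2 := by
  borelize F E
  by_cases ha : a = 0
  · simp [ha]
  have ha' : algebraMap F E a ≠ 0 := by simpa using ha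
  let μ : Measure E := Measure.addHaar
  have h1 := map_diagMap B μ ha ha
  have h2 : diagMap B a a = fun x => algebraMap F E a * x := funext (diagMap_self B a)
  rw [h2, map_mul_left_eq μ ha'] at h1
  have h3 := congrArg (fun m : Measure E => m {x : E | nabs x ≤ 1}) h1
  simp only [Measure.smul_apply, smul_eq_mul] at h3
  have h4 := (ENNReal.mul_left_inj (measure_nabs_le_pos μ one_pos).ne'
    (measure_nabs_le_lt_top μ 1).ne).1 h3
  have hp := nabs_pos ha
  have hp' := nabs_pos ha'
  rw [← ENNReal.ofReal_mul (by positivity), ENNReal.ofReal_eq_ofReal_iff (by positivity)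
    (by positivity), ← mul_inv, inv_inj] at h4
  rw [h4, sq]

lemma integral_diagMap {a b : F} (ha : a ≠ 0) (hb : b ≠ 0) (f : E → ℂ) :
    ∫ x, f (diagMap B a b x) ∂μ = ((nabs a)⁻¹ * (nabs b)⁻¹ : ℝ) • ∫ x, f x ∂μ := by
  have h := (diagHomeo B ha hb).measurableEmbedding.integral_map (μ := μ) f
  have h2 : ⇑(diagHomeo B ha hb) = diagMap B a b := rfl
  have hp := nabs_pos ha
  have hp' := nabs_pos hb
  rw [h2, map_diagMap B μ ha hb, integral_smul_measure, ← ENNReal.ofReal_mul (by positivity),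
    ENNReal.toReal_ofReal (by positivity)] at h
  exact h.symm

lemma measurableEmbedding_coordHomeo : MeasurableEmbedding (coordHomeo B) :=
  (coordHomeo B).measurableEmbedding

/-- The line `F e₁` is a null set. -/
lemma ae_repr_one_ne_zero : ∀ᵐ x ∂μ, B.repr x 1 ≠ 0 := by
  let ν : Measure F := Measure.addHaar
  obtain ⟨c, -, hc⟩ := exists_haar_eq_smul_prod B μ ν
  rw [hc]
  refine Measure.ae_smul_measure ?_ c
  rw [(measurableEmbedding_coordHomeo B).ae_map_iff]
  have h : ∀ p : F × F, B.repr (coordHomeo B p) 1 = p.2 := fun p => by simp [coordHomeo_apply]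
  simp only [h]
  rw [Measure.ae_prod_iff_ae_ae]
  · exact .of_forall fun x => ae_ne_zero ν
  · exact (measurableSet_singleton (0 : F)).compl.preimage measurable_snd

end Coordinates

/-! ### Conjugation, the norm form and the kernel -/

section Kernel

variable {F E : Type*}
  [Field F] [ValuativeRel F] [TopologicalSpace F] [IsNonarchimedeanLocalField F]
  [Field E] [ValuativeRel E] [TopologicalSpace E] [IsNonarchimedeanLocalField E]
  [Algebra F E] [ValuativeExtension F E]
  (B : Module.Basis (Fin 2) F E) {α : E} {d : F}

section Repr

variable (hB : ⇑B = ![1, α])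
include hB

lemma repr_add_mul (a b : F) (i : Fin 2) :
    B.repr (algebraMap F E a + algebraMap F E b * α) i = ![a, b] i := by
  have h : algebraMap F E a + algebraMap F E b * α = a • B 0 + b • B 1 := by
    simp [hB, Algebra.smul_def]
  rw [h]
  fin_cases i
  · exact repr_comb_zero B a b
  · exact repr_comb_one B a b

lemma eq_add_mul (x : E) :
    x = algebraMap F E (B.repr x 0) + algebraMap F E (B.repr x 1) * α := by
  conv_lhs => rw [← repr_sum B x]
  simp [hB, Algebra.smul_def]

end Repr

lemma repr_algebraMap_mul (a : F) (x : E) (i : Fin 2) :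
    B.repr (algebraMap F E a * x) i = a * B.repr x i := by
  rw [← Algebra.smul_def]; simp

/-- The norm form `x₁² - x₂² d` of `x = x₁ + x₂ α`, where `α² = d`. -/
noncomputable def normForm (d : F) (x : E) : F := B.repr x 0 ^ 2 - B.repr x 1 ^ 2 * d

/-- The conjugate `x₁ - x₂ α` of `x = x₁ + x₂ α`. It is the identity in characteristic two. -/
noncomputable def conjugate (α : E) (x : E) : E :=
  algebraMap F E (B.repr x 0) - algebraMap F E (B.repr x 1) * α

lemma continuous_conjugate : Continuous (conjugate B α) := by
  have h := continuous_algebraMap_localField F E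
  exact (h.comp (continuous_repr B 0)).sub ((h.comp (continuous_repr B 1)).mul continuous_const)

lemma continuous_normForm : Continuous (normForm B d) :=
  ((continuous_repr B 0).pow 2).sub (((continuous_repr B 1).pow 2).mul continuous_const)

lemma normForm_algebraMap_mul (a : F) (x : E) :
    normForm B d (algebraMap F E a * x) = a ^ 2 * normForm B d x := by
  simp only [normForm, repr_algebraMap_mul]; ring

variable (hα : α ^ 2 = algebraMap F E d) (hB : ⇑B = ![1, α])
include hα hB

lemma mul_conjugate (x : E) : x * conjugate B α x = algebraMap F E (normForm B d x) := by
  conv_lhs => rw [eq_add_mul B hB x]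
  simp only [conjugate, normForm, repr_add_mul B hB, map_sub, map_mul, map_pow,
    Matrix.cons_val_zero, Matrix.cons_val_one, ← hα]
  ring

lemma conjugate_mul (x y : E) : conjugate B α (x * y) = conjugate B α x * conjugate B α y := by
  have h : x * y = algebraMap F E (B.repr x 0 * B.repr y 0 + B.repr x 1 * B.repr y 1 * d) +
      algebraMap F E (B.repr x 0 * B.repr y 1 + B.repr x 1 * B.repr y 0) * α := by
    conv_lhs => rw [eq_add_mul B hB x, eq_add_mul B hB y]
    simp only [map_add, map_mul, ← hα]
    ring
  rw [h, conjugate, repr_add_mul B hB, repr_add_mul B hB]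
  simp only [conjugate, map_add, map_mul, Matrix.cons_val_zero, Matrix.cons_val_one, ← hα]
  ring

lemma conjugate_one : conjugate B α (1 : E) = 1 := by
  have h : (1 : E) = algebraMap F E 1 + algebraMap F E 0 * α := by simp
  have h0 : B.repr (1 : E) 0 = 1 := by rw [h, repr_add_mul B hB]; rfl
  have h1 : B.repr (1 : E) 1 = 0 := by rw [h, repr_add_mul B hB]; rfl
  simp [conjugate, h0, h1]

lemma conjugate_conjugate (x : E) : conjugate B α (conjugate B α x) = x := by
  have h : conjugate B α x = algebraMap F E (B.repr x 0) + algebraMap F E (-B.repr x 1) * α := by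
    rw [conjugate, map_neg]; ring
  conv_rhs => rw [eq_add_mul B hB x]
  rw [h, conjugate, repr_add_mul B hB, repr_add_mul B hB]
  simp

lemma conjugate_eq_zero {x : E} : conjugate B α x = 0 ↔ x = 0 := by
  have h0 : conjugate B α (0 : E) = 0 := by simp [conjugate]
  refine ⟨fun h => ?_, fun h => by rw [h, h0]⟩
  rw [← conjugate_conjugate B hα hB x, h, h0]

lemma conjugate_pow (x : E) (n : ℕ) : conjugate B α (x ^ n) = conjugate B α x ^ n := by
  induction n with
  | zero => simp [conjugate_one B hα hB]
  | succ n ih => rw [pow_succ, conjugate_mul B hα hB, ih, pow_succ]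

/-- If `|x̄| < |x|`, then `y = x̄ / x` satisfies `yⁿ → 0`, hence `ȳⁿ → 0` by continuity,
although `ȳ = y⁻¹`. -/
lemma nabs_conjugate_le (x : E) : nabs x ≤ nabs (conjugate B α x) := by
  by_contra! hlt
  have hx : x ≠ 0 := by
    rintro rfl
    exact absurd hlt (by simp [nabs_nonneg])
  have hpx := nabs_pos hx
  set y := conjugate B α x * x⁻¹ with hy
  have hc : conjugate B α x ≠ 0 := fun h => hx ((conjugate_eq_zero B hα hB).1 h)
  have hy1 : nabs y < 1 := by
    rw [hy, nabs_mul, nabs_inv, ← div_eq_mul_inv, div_lt_one hpx]; exact hlt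
  have hyc : y * conjugate B α y = 1 := by
    have h1 : conjugate B α x⁻¹ * conjugate B α x = 1 := by
      rw [← conjugate_mul B hα hB, inv_mul_cancel₀ hx, conjugate_one B hα hB]
    rw [hy, conjugate_mul B hα hB, conjugate_conjugate B hα hB]
    calc conjugate B α x * x⁻¹ * (x * conjugate B α x⁻¹) =
        (x⁻¹ * x) * (conjugate B α x⁻¹ * conjugate B α x) := by ring
      _ = 1 := by rw [h1, inv_mul_cancel₀ hx, one_mul]
  have hnc : 1 ≤ nabs (conjugate B α y) := by
    have := congrArg nabs hyc
    rw [nabs_mul, nabs_one] at this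
    by_contra! h
    nlinarith [nabs_nonneg y, nabs_nonneg (conjugate B α y)]
  have hlim : conjugate B α ⁻¹' {z | nabs z < 1} ∈ 𝓝 (0 : E) := by
    refine (continuous_conjugate B).continuousAt.preimage_mem_nhds
      ((isOpen_nabs_lt 1).mem_nhds ?_)
    simp [conjugate]
  obtain ⟨r, hr, hs⟩ := mem_nhds_zero_iff_nabs.1 hlim
  obtain ⟨n, hn⟩ := exists_pow_lt_of_lt_one hr hy1
  have h2 : nabs (conjugate B α (y ^ n)) < 1 := hs (by simpa using hn)
  rw [conjugate_pow B hα hB, nabs_pow] at h2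
  exact absurd (one_le_pow₀ hnc) h2.not_ge

lemma nabs_conjugate (x : E) : nabs (conjugate B α x) = nabs x := by
  refine le_antisymm ?_ (nabs_conjugate_le B hα hB x)
  have := nabs_conjugate_le B hα hB (conjugate B α x)
  rwa [conjugate_conjugate B hα hB] at this

lemma nabs_normForm (x : E) : nabs (normForm B d x) = nabs x := by
  have h1 := congrArg nabs (mul_conjugate B hα hB x)
  rw [nabs_mul, nabs_conjugate B hα hB, nabs_algebraMap B] at h1
  nlinarith [nabs_nonneg x, nabs_nonneg (normForm B d x)]

lemma normForm_ne_zero {x : E} (hx : x ≠ 0) : normForm B d x ≠ 0 := by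
  intro h
  have h1 := nabs_normForm B hα hB x
  rw [h, nabs_zero] at h1
  exact (nabs_pos hx).ne h1

lemma repr_inv_one (x : E) : B.repr x⁻¹ 1 = -(B.repr x 1 / normForm B d x) := by
  by_cases hx : x = 0
  · simp [hx]
  have hN := normForm_ne_zero B hα hB hx
  have hN' : algebraMap F E (normForm B d x) ≠ 0 := by simpa using hN
  have h : x⁻¹ = algebraMap F E (B.repr x 0 / normForm B d x) +
      algebraMap F E (-(B.repr x 1 / normForm B d x)) * α := by
    refine inv_eq_of_mul_eq_one_right ?_
    have h1 := mul_conjugate B hα hB x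
    rw [conjugate] at h1
    simp only [map_div₀, map_neg]
    field_simp
    linear_combination h1
  rw [h, repr_add_mul B hB]
  rfl

omit hα hB

variable (ϖF : Uniformizer F) (ϖE : Uniformizer E)
  (χ : PontryaginDual 𝒪[E]ˣ) (η : PontryaginDual 𝒪[F]ˣ) (s t : ℂ)

lemma kernel_eq (x : E) : kernel ϖF ϖE B d χ η s t x = charExt ϖE χ (s - 1 / 2) (x ^ 2) *
    (charExt ϖE χ (s - 1 / 2) (algebraMap F E (B.repr x 1 / normForm B d x)) *
      charExt ϖF η (t + 1 / 2) (B.repr x 1 / normForm B d x)) := rfl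

/-- The character `χ_{s-1/2} η_{t+1/2}` of `F^×`. -/
noncomputable def restrChar (a : F) : ℂ :=
  charExt ϖE χ (s - 1 / 2) (algebraMap F E a) * charExt ϖF η (t + 1 / 2) a

/-- The factor `χ_{s-1/2}(x²) (χ_{s-1/2} η_{t+1/2})(x₁² - x₂² d)⁻¹` of the kernel, which is smooth
outside of `0`. -/
noncomputable def smoothPart (d : F) (x : E) : ℂ :=
  charExt ϖE χ (s - 1 / 2) (x ^ 2) * (restrChar ϖF ϖE χ η s t (normForm B d x))⁻¹

lemma restrChar_mul (a b : F) : restrChar ϖF ϖE χ η s t (a * b) =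
    restrChar ϖF ϖE χ η s t a * restrChar ϖF ϖE χ η s t b := by
  simp only [restrChar, map_mul, charExt_mul]; ring

lemma restrChar_div (a b : F) : restrChar ϖF ϖE χ η s t (a / b) =
    restrChar ϖF ϖE χ η s t a * (restrChar ϖF ϖE χ η s t b)⁻¹ := by
  simp only [restrChar, map_div₀, charExt_div, mul_inv]; ring

lemma restrChar_ne_zero {a : F} (ha : a ≠ 0) : restrChar ϖF ϖE χ η s t a ≠ 0 :=
  mul_ne_zero (charExt_ne_zero _ _ _ (by simpa using ha)) (charExt_ne_zero _ _ _ ha)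

/-- The kernel is the product of a function which is smooth outside of `0` and a character of
the coordinate `x₂`. -/
lemma kernel_eq_smoothPart_mul (x : E) : kernel ϖF ϖE B d χ η s t x =
    smoothPart B ϖF ϖE χ η s t d x * restrChar ϖF ϖE χ η s t (B.repr x 1) := by
  rw [kernel_eq, ← restrChar, restrChar_div, smoothPart]; ring

lemma kernel_algebraMap_mul {a : F} (ha : a ≠ 0) (x : E) :
    kernel ϖF ϖE B d χ η s t (algebraMap F E a * x) =
      charExt ϖE χ (s - 1 / 2) (algebraMap F E a) * (charExt ϖF η (t + 1 / 2) a)⁻¹ *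
        kernel ϖF ϖE B d χ η s t x := by
  rw [kernel_eq, kernel_eq, normForm_algebraMap_mul, repr_algebraMap_mul]
  have h : a * B.repr x 1 / (a ^ 2 * normForm B d x) = a⁻¹ * (B.repr x 1 / normForm B d x) := by
    field_simp
  have h1 : charExt ϖE χ (s - 1 / 2) (algebraMap F E a) ≠ 0 :=
    charExt_ne_zero _ _ _ (by simpa using ha)
  rw [h, mul_pow]
  simp only [map_mul, map_inv₀, charExt_mul, charExt_inv, charExt_pow]
  field_simp

include hα hB in
/-- In the coordinate `x⁻¹` the map `x ↦ x / (1 - b x)` is the translation by `-b ∈ F`, and the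
second factor of the kernel depends only on the component of `x⁻¹` along `α`. -/
lemma kernel_moebius (b : F) (x : E) :
    kernel ϖF ϖE B d χ η s t (x / (1 - algebraMap F E b * x)) =
      (charExt ϖE χ (s - 1 / 2) ((1 - algebraMap F E b * x) ^ 2))⁻¹ *
        kernel ϖF ϖE B d χ η s t x := by
  by_cases hx : x = 0
  · simp [hx, kernel_eq]
  by_cases hb : 1 - algebraMap F E b * x = 0
  · simp [hb, kernel_eq]
  have h : B.repr (x / (1 - algebraMap F E b * x)) 1 /
      normForm B d (x / (1 - algebraMap F E b * x)) = B.repr x 1 / normForm B d x := by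
    rw [← neg_inj, ← repr_inv_one B hα hB, ← repr_inv_one B hα hB]
    have h1 : (x / (1 - algebraMap F E b * x))⁻¹ = x⁻¹ - algebraMap F E b := by
      field_simp
    have h2 : B.repr (algebraMap F E b) 1 = 0 := by
      have := repr_add_mul B hB b 0 1
      simpa using this
    rw [h1, map_sub, Finsupp.sub_apply, h2, sub_zero]
  rw [kernel_eq, kernel_eq, h, div_pow, charExt_div]
  ring

include B in
lemma norm_restrChar {a : F} (ha : a ≠ 0) :
    ‖restrChar ϖF ϖE χ η s t a‖ = nabs a ^ ((2 * s + t + 1 / 2).re - 1) := by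
  have hp := nabs_pos ha
  rw [restrChar, norm_mul, norm_charExt _ _ _ (by simpa using ha), norm_charExt _ _ _ ha,
    nabs_algebraMap B, ← Real.rpow_natCast, ← Real.rpow_mul hp.le, ← Real.rpow_add hp]
  congr 1
  simp
  ring

include hα hB in
lemma norm_smoothPart {x : E} (hx : x ≠ 0) :
    ‖smoothPart B ϖF ϖE χ η s t d x‖ = nabs x ^ (-(t.re + 1 / 2)) := by
  have hp := nabs_pos hx
  rw [smoothPart, norm_mul, norm_inv, norm_restrChar B _ _ _ _ _ _ (normForm_ne_zero B hα hB hx),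
    nabs_normForm B hα hB, norm_charExt _ _ _ (pow_ne_zero 2 hx), nabs_pow, ← Real.rpow_natCast,
    ← Real.rpow_mul hp.le, ← Real.rpow_neg hp.le, ← Real.rpow_add hp]
  congr 1
  simp
  ring

end Kernel

/-! ### Local integrability of the kernel -/

section Integrability

variable {F E : Type*}
  [Field F] [ValuativeRel F] [TopologicalSpace F] [IsNonarchimedeanLocalField F]
  [Field E] [ValuativeRel E] [TopologicalSpace E] [IsNonarchimedeanLocalField E]
  [Algebra F E] [ValuativeExtension F E]
  (B : Module.Basis (Fin 2) F E)

lemma exists_nabs_repr_sq_le (i : Fin 2) :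
    ∃ c > 0, ∀ x : E, nabs (B.repr x i) ^ 2 ≤ c * nabs x := by
  have h : {x : E | nabs (B.repr x i) < 1} ∈ 𝓝 (0 : E) :=
    (continuous_repr B i).continuousAt.preimage_mem_nhds
      ((isOpen_nabs_lt 1).mem_nhds (by simp))
  obtain ⟨r, hr, hs⟩ := mem_nhds_zero_iff_nabs.1 h
  refine ⟨r⁻¹, inv_pos.2 hr, fun x => ?_⟩
  by_cases ha : B.repr x i = 0
  · rw [ha, nabs_zero]; simp [hr.le, nabs_nonneg, mul_nonneg]
  have hp := nabs_pos ha
  have hy : r ≤ nabs (algebraMap F E (B.repr x i)⁻¹ * x) := by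
    by_contra! hlt
    have := hs hlt
    simp only [Set.mem_ofPred_eq, repr_algebraMap_mul, inv_mul_cancel₀ ha, nabs_one] at this
    exact lt_irrefl _ this
  rw [nabs_mul, nabs_algebraMap B, nabs_inv] at hy
  rw [inv_mul_eq_div, le_div_iff₀ hr]
  calc nabs (B.repr x i) ^ 2 * r
      ≤ nabs (B.repr x i) ^ 2 * ((nabs (B.repr x i))⁻¹ ^ 2 * nabs x) := by gcongr
    _ = nabs x := by field_simp

variable [MeasurableSpace E] [BorelSpace E] (μ : Measure E) [μ.IsAddHaarMeasure]

lemma integrableOn_nabs_repr_rpow {p r : ℝ} (hp : 0 < p) (hr : 0 < r) (R : ℝ) :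
    IntegrableOn (fun x : E => nabs (B.repr x 0) ^ (p - 1) * nabs (B.repr x 1) ^ (r - 1))
      {x : E | nabs x ≤ R} μ := by
  borelize F
  let ν : Measure F := Measure.addHaar
  obtain ⟨c, -, hc⟩ := exists_haar_eq_smul_prod B μ ν
  obtain ⟨c₀, hc₀, h₀⟩ := exists_nabs_repr_sq_le B 0
  obtain ⟨c₁, hc₁, h₁⟩ := exists_nabs_repr_sq_le B 1
  rw [hc, IntegrableOn, Measure.restrict_smul]
  refine Integrable.smul_measure_nnreal ?_
  change IntegrableOn _ _ _
  rw [(measurableEmbedding_coordHomeo B).integrableOn_map_iff]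
  refine IntegrableOn.mono_set (t := {a : F | nabs a ≤ √(c₀ * R)} ×ˢ {a : F | nabs a ≤ √(c₁ * R)})
    ?_ ?_
  · have h := (integrableOn_nabs_rpow ν hp √(c₀ * R)).mul_prod
      (integrableOn_nabs_rpow ν hr √(c₁ * R))
    rw [Measure.prod_restrict] at h
    refine Integrable.congr h (.of_forall fun q => ?_)
    simp [coordHomeo_apply]
  · intro q hq
    have hq' : nabs (coordHomeo B q) ≤ R := hq
    have e0 := h₀ (coordHomeo B q)
    have e1 := h₁ (coordHomeo B q)
    rw [coordHomeo_apply, repr_comb_zero, ← coordHomeo_apply] at e0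
    rw [coordHomeo_apply, repr_comb_one, ← coordHomeo_apply] at e1
    constructor
    · exact Real.le_sqrt_of_sq_le (e0.trans (by gcongr))
    · exact Real.le_sqrt_of_sq_le (e1.trans (by gcongr))

omit [BorelSpace E] in
lemma locallyIntegrable_of_forall_integrableOn {f : E → ℂ}
    (h : ∀ R : ℝ, IntegrableOn f {x : E | nabs x ≤ R} μ) : LocallyIntegrable f μ := fun x =>
  ⟨{y : E | nabs y ≤ nabs x + 1},
    (isOpen_nabs_le (by linarith [nabs_nonneg x])).mem_nhds (by simp), h _⟩

variable {α : E} {d : F} (hα : α ^ 2 = algebraMap F E d) (hB : ⇑B = ![1, α])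
  (ϖF : Uniformizer F) (ϖE : Uniformizer E)
  (χ : PontryaginDual 𝒪[E]ˣ) (η : PontryaginDual 𝒪[F]ˣ) (s t : ℂ)

lemma measurable_restrChar_repr :
    Measurable fun x : E => restrChar ϖF ϖE χ η s t (B.repr x 1) := by
  borelize F
  have h1 := (continuous_repr B 1).measurable
  have h2 := (continuous_algebraMap_localField F E).measurable
  exact ((measurable_charExt ϖE χ _).comp (h2.comp h1)).mul ((measurable_charExt ϖF η _).comp h1)

lemma measurable_smoothPart : Measurable (smoothPart B ϖF ϖE χ η s t d) := by
  borelize F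
  have h1 := (continuous_normForm B (d := d)).measurable
  have h2 := (continuous_algebraMap_localField F E).measurable
  have h3 : Measurable fun x : E => x ^ 2 := (continuous_pow 2).measurable
  exact ((measurable_charExt ϖE χ _).comp h3).mul
    (((measurable_charExt ϖE χ _).comp (h2.comp h1)).mul
      ((measurable_charExt ϖF η _).comp h1)).inv

lemma measurable_kernel : Measurable (kernel ϖF ϖE B d χ η s t) := by
  have : kernel ϖF ϖE B d χ η s t = fun x => smoothPart B ϖF ϖE χ η s t d x *
      restrChar ϖF ϖE χ η s t (B.repr x 1) :=
    funext (kernel_eq_smoothPart_mul B ϖF ϖE χ η s t)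
  rw [this]
  exact (measurable_smoothPart B ϖF ϖE χ η s t).mul (measurable_restrChar_repr B ϖF ϖE χ η s t)

lemma locallyIntegrable_restrChar_repr (h : 0 < (2 * s + t + 1 / 2).re) :
    LocallyIntegrable (fun x : E => restrChar ϖF ϖE χ η s t (B.repr x 1)) μ := by
  borelize F
  refine locallyIntegrable_of_forall_integrableOn μ fun R => ?_
  refine Integrable.mono' (integrableOn_nabs_repr_rpow B μ one_pos h R)
    (measurable_restrChar_repr B ϖF ϖE χ η s t).aestronglyMeasurable ?_
  refine ae_restrict_of_ae ?_
  filter_upwards [ae_repr_one_ne_zero B μ] with x hx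
  rw [norm_restrChar B _ _ _ _ _ _ hx, sub_self, Real.rpow_zero, one_mul]

omit [MeasurableSpace E] [BorelSpace E] in
include B in
lemma basis_swap_repr : ∃ B' : Module.Basis (Fin 2) F E, ∀ x, B'.repr x 1 = B.repr x 0 :=
  ⟨B.reindex (Equiv.swap 0 1), fun x => by simp⟩

include hα hB in
/-- With `A = Re(2s + t + 1/2)` and `C = Re(2s - t + 1/2)` one has
`|K(x)| = |x|^((C - A - 1)/2) |x₂|^(A - 1)`, where `|x|^(1/2)` is comparable with
`max(|x₁|, |x₂|)`. On bounded sets this is at most a multiple of `|x₁|^(p - 1) |x₂|^(r - 1)` for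
`p = min(1, C/2)` and `r = min(A, C/2)`. -/
lemma locallyIntegrable_kernel (h₁ : 0 < (2 * s + t + 1 / 2).re)
    (h₂ : 0 < (2 * s - t + 1 / 2).re) : LocallyIntegrable (kernel ϖF ϖE B d χ η s t) μ := by
  borelize F
  set A := (2 * s + t + 1 / 2).re with hA
  set C := (2 * s - t + 1 / 2).re with hC
  have hAC : t.re = (A - C) / 2 := by simp [hA, hC]
  obtain ⟨B', hB'⟩ := basis_swap_repr B
  set p := min 1 (C / 2) with hp
  set r := min A (C / 2) with hr
  have hp0 : 0 < p := lt_min one_pos (by linarith)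
  have hr0 : 0 < r := lt_min h₁ (by linarith)
  have hp1 : p ≤ 1 := min_le_left _ _
  have hrA : r ≤ A := min_le_left _ _
  have hprC : p + r ≤ C := by
    have := min_le_right 1 (C / 2)
    have := min_le_right A (C / 2)
    linarith
  obtain ⟨c₀, hc₀, hb₀⟩ := exists_nabs_repr_sq_le B 0
  obtain ⟨c₁, hc₁, hb₁⟩ := exists_nabs_repr_sq_le B 1
  refine locallyIntegrable_of_forall_integrableOn μ fun R => ?_
  set M : ℝ := (√c₀)⁻¹ ^ (p - 1) * (√c₁)⁻¹ ^ (r - A) * √R ^ (C - p - r) with hM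
  refine Integrable.mono' ((integrableOn_nabs_repr_rpow B μ hp0 hr0 R).const_mul M)
    (measurable_kernel B ϖF ϖE χ η s t).aestronglyMeasurable ?_
  have h0 : ∀ᵐ x ∂μ, B.repr x 0 ≠ 0 := by
    filter_upwards [ae_repr_one_ne_zero B' μ] with x hx
    rwa [hB'] at hx
  rw [ae_restrict_iff' (measurableSet_nabs_le R)]
  filter_upwards [ae_repr_one_ne_zero B μ, h0] with x hx₁ hx₀ hxR
  have hx : x ≠ 0 := by rintro rfl; simp at hx₁
  have hR : nabs x ≤ R := hxR
  set n := √(nabs x) with hn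
  have hnx : nabs x = n ^ 2 := (Real.sq_sqrt (nabs_nonneg x)).symm
  have hn0 : 0 < n := Real.sqrt_pos.2 (nabs_pos hx)
  have hy₀ := nabs_pos hx₀
  have hy₁ := nabs_pos hx₁
  have hs₀ : 0 < √c₀ := Real.sqrt_pos.2 hc₀
  have hs₁ : 0 < √c₁ := Real.sqrt_pos.2 hc₁
  have hle₀ : (√c₀)⁻¹ * nabs (B.repr x 0) ≤ n := by
    rw [inv_mul_le_iff₀ hs₀, hn, ← Real.sqrt_mul hc₀.le]
    exact Real.le_sqrt_of_sq_le (hb₀ x)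
  have hle₁ : (√c₁)⁻¹ * nabs (B.repr x 1) ≤ n := by
    rw [inv_mul_le_iff₀ hs₁, hn, ← Real.sqrt_mul hc₁.le]
    exact Real.le_sqrt_of_sq_le (hb₁ x)
  have hnR : n ≤ √R := Real.sqrt_le_sqrt hR
  rw [kernel_eq_smoothPart_mul, norm_mul, norm_smoothPart B hα hB _ _ _ _ _ _ hx,
    norm_restrChar B _ _ _ _ _ _ hx₁, ← hA, hAC, hnx, ← Real.rpow_natCast, ← Real.rpow_mul hn0.le]
  have e : ((2 : ℕ) : ℝ) * -((A - C) / 2 + 1 / 2) = (p - 1) + (r - A) + (C - p - r) := by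
    push_cast; ring
  have e' : A - 1 = (A - r) + (r - 1) := by ring
  rw [e, Real.rpow_add hn0, Real.rpow_add hn0]
  have b0 : n ^ (p - 1) ≤ ((√c₀)⁻¹ * nabs (B.repr x 0)) ^ (p - 1) :=
    Real.rpow_le_rpow_of_nonpos (by positivity) hle₀ (by linarith)
  have b1 : n ^ (r - A) ≤ ((√c₁)⁻¹ * nabs (B.repr x 1)) ^ (r - A) :=
    Real.rpow_le_rpow_of_nonpos (by positivity) hle₁ (by linarith)
  have b2 : n ^ (C - p - r) ≤ √R ^ (C - p - r) :=
    Real.rpow_le_rpow hn0.le hnR (by linarith)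
  rw [Real.mul_rpow (by positivity) hy₀.le] at b0
  rw [Real.mul_rpow (by positivity) hy₁.le] at b1
  calc n ^ (p - 1) * n ^ (r - A) * n ^ (C - p - r) * nabs (B.repr x 1) ^ (A - 1)
      ≤ ((√c₀)⁻¹ ^ (p - 1) * nabs (B.repr x 0) ^ (p - 1)) *
        ((√c₁)⁻¹ ^ (r - A) * nabs (B.repr x 1) ^ (r - A)) * √R ^ (C - p - r) *
          nabs (B.repr x 1) ^ (A - 1) := by gcongr
    _ = M * (nabs (B.repr x 0) ^ (p - 1) * nabs (B.repr x 1) ^ (r - 1)) := by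
        have e3 : nabs (B.repr x 1) ^ (r - 1) =
            nabs (B.repr x 1) ^ (r - A) * nabs (B.repr x 1) ^ (A - 1) := by
          rw [← Real.rpow_add hy₁]; congr 1; ring
        rw [hM, e3]; ring

end Integrability

/-! ### Holomorphic families of test functions -/

section TestFamily

variable {X : Type*} [TopologicalSpace X]

/-- A family of test functions on `X` depending holomorphically on a parameter in `ℂ²`, which is
locally constant in `x ∈ X` and compactly supported uniformly in the parameter: the map which
sends `x` to a function of the parameter is locally constant with compact support. -/
structure IsTestFamily (Φ : X → ℂ × ℂ → ℂ) : Prop where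
  isLocallyConstant : IsLocallyConstant Φ
  hasCompactSupport : HasCompactSupport Φ
  analyticAt : ∀ x p, AnalyticAt ℂ (Φ x) p

namespace IsTestFamily

variable {Φ Ψ : X → ℂ × ℂ → ℂ}

lemma mem_testFunction (h : IsTestFamily Φ) (p : ℂ × ℂ) : (fun x => Φ x p) ∈ TestFunction X :=
  ⟨h.isLocallyConstant.comp fun f => f p,
    h.hasCompactSupport.comp_left (g := fun f : ℂ × ℂ → ℂ => f p) rfl⟩

lemma of_testFunction {φ : X → ℂ} (h : φ ∈ TestFunction X) : IsTestFamily fun x _ => φ x where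
  isLocallyConstant := h.1.comp fun c _ => c
  hasCompactSupport := h.2.comp_left (g := fun (c : ℂ) (_ : ℂ × ℂ) => c) rfl
  analyticAt _ _ := analyticAt_const

lemma sub (hΦ : IsTestFamily Φ) (hΨ : IsTestFamily Ψ) :
    IsTestFamily fun x p => Φ x p - Ψ x p where
  isLocallyConstant := hΦ.isLocallyConstant.comp₂ hΨ.isLocallyConstant fun f g p => f p - g p
  hasCompactSupport := hΦ.hasCompactSupport.comp₂_left hΨ.hasCompactSupport
    (m := fun f g p => f p - g p) (by funext p; simp)
  analyticAt x p := (hΦ.analyticAt x p).sub (hΨ.analyticAt x p)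

lemma comp_homeomorph (hΦ : IsTestFamily Φ) (e : X ≃ₜ X) : IsTestFamily fun x => Φ (e x) where
  isLocallyConstant := hΦ.isLocallyConstant.comp_continuous e.continuous
  hasCompactSupport := hΦ.hasCompactSupport.comp_homeomorph e
  analyticAt x p := hΦ.analyticAt (e x) p

/-- A family of test functions may be multiplied with a family which is locally constant where
it does not vanish. -/
lemma mul_left (hΦ : IsTestFamily Φ) {g : X → ℂ × ℂ → ℂ}
    (hg : ∀ x, (∀ᶠ y in 𝓝 x, g y = g x) ∨ Φ x = 0) (ha : ∀ x p, AnalyticAt ℂ (g x) p) :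
    IsTestFamily fun x p => g x p * Φ x p where
  isLocallyConstant := by
    rw [IsLocallyConstant.iff_eventually_eq]
    intro x
    rcases hg x with h | h
    · filter_upwards [h, hΦ.isLocallyConstant.eventually_eq x] with y h1 h2
      rw [h1, h2]
    · filter_upwards [hΦ.isLocallyConstant.eventually_eq x] with y h2
      rw [h2, h]
      simp
  hasCompactSupport := hΦ.hasCompactSupport.mono fun x hx => by
    contrapose! hx
    simp only [Function.mem_support, not_not] at hx ⊢
    rw [hx]
    funext p
    simp
  analyticAt x p := (ha x p).mul (hΦ.analyticAt x p)

lemma finite_range_sdiff (hΦ : IsTestFamily Φ) : (Set.range Φ \ {0}).Finite := by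
  have : CompactSpace (tsupport Φ) := isCompact_iff_compactSpace.mp hΦ.hasCompactSupport
  have hf : (Set.range fun x : tsupport Φ => Φ x).Finite :=
    (hΦ.isLocallyConstant.comp_continuous continuous_subtype_val).range_finite
  refine hf.subset ?_
  rintro _ ⟨⟨x, rfl⟩, hx⟩
  exact ⟨⟨x, subset_tsupport Φ hx⟩, rfl⟩

/-- The integral of a holomorphic family of test functions is a finite sum of holomorphic
functions. -/
lemma analyticAt_integral [MeasurableSpace X] [OpensMeasurableSpace X] (hΦ : IsTestFamily Φ)
    (μ : Measure X) [IsFiniteMeasureOnCompacts μ] (p : ℂ × ℂ) :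
    AnalyticAt ℂ (fun z => ∫ x, Φ x z ∂μ) p := by
  classical
  set V := hΦ.finite_range_sdiff.toFinset with hV
  have hmem : ∀ v, v ∈ V ↔ v ∈ Set.range Φ ∧ v ≠ 0 := fun v => by
    rw [hV, Set.Finite.mem_toFinset]; rfl
  have hms (v : ℂ × ℂ → ℂ) : MeasurableSet {x | Φ x = v} :=
    (hΦ.isLocallyConstant.isOpen_fiber v).measurableSet
  have hfin : ∀ v ∈ V, μ {x | Φ x = v} < ⊤ := fun v hv =>
    (measure_mono fun x (hx : Φ x = v) => subset_tsupport Φ (by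
      rw [Function.mem_support, hx]; exact ((hmem v).1 hv).2)).trans_lt
      hΦ.hasCompactSupport.isCompact.measure_lt_top
  have hsum : ∀ z, ∫ x, Φ x z ∂μ = ∑ v ∈ V, μ.real {x | Φ x = v} • v z := by
    intro z
    have h1 : ∀ x, Φ x z = ∑ v ∈ V, ({x | Φ x = v}.indicator (fun _ => v z) x) := by
      intro x
      by_cases hx : Φ x = 0
      · rw [Finset.sum_eq_zero, hx, Pi.zero_apply]
        intro v hv
        rw [Set.indicator_of_notMem]
        intro (hxv : Φ x = v)
        exact ((hmem v).1 hv).2 (hxv.symm.trans hx)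
      · rw [Finset.sum_eq_single_of_mem (Φ x) ((hmem _).2 ⟨⟨x, rfl⟩, hx⟩)]
        · rw [Set.indicator_of_mem]; rfl
        · intro v _ hv
          rw [Set.indicator_of_notMem]
          intro (hxv : Φ x = v)
          exact hv hxv.symm
    simp_rw [h1]
    rw [integral_finsetSum]
    · refine Finset.sum_congr rfl fun v _ => ?_
      rw [integral_indicator_const _ (hms v)]
    · intro v hv
      exact (integrableOn_const (hfin v hv).ne).integrable_indicator (hms v)
  simp_rw [hsum]
  refine Finset.analyticAt_fun_sum _ fun v hv => ?_
  obtain ⟨x, rfl⟩ := ((hmem v).1 hv).1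
  exact (hΦ.analyticAt x p).fun_const_smul (c := μ.real {y | Φ y = Φ x})

end IsTestFamily

lemma integrable_testFunction [MeasurableSpace X] [OpensMeasurableSpace X] {φ : X → ℂ}
    (hφ : φ ∈ TestFunction X) (μ : Measure X) [IsFiniteMeasureOnCompacts μ] : Integrable φ μ :=
  hφ.1.continuous.integrable_of_hasCompactSupport hφ.2

lemma integrable_mul_testFunction [MeasurableSpace X] [OpensMeasurableSpace X] [T2Space X]
    {f φ : X → ℂ} (hφ : φ ∈ TestFunction X) {μ : Measure X}
    (hf : LocallyIntegrable f μ) : Integrable (fun x => f x * φ x) μ := by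
  have h := hf.integrable_smul_left_of_hasCompactSupport hφ.1.continuous hφ.2
  simp only [smul_eq_mul] at h
  exact h.congr (.of_forall fun x => mul_comm _ _)

/-- Functions which are analytic on `ℂ²` and agree where `Re(2s ± t + 1/2) > 0` are equal. -/
lemma eq_of_analytic_of_eq {f g : ℂ × ℂ → ℂ} (hf : ∀ p, AnalyticAt ℂ f p)
    (hg : ∀ p, AnalyticAt ℂ g p) (h : ∀ p : ℂ × ℂ, 0 < (2 * p.1 + p.2 + 1 / 2).re →
      0 < (2 * p.1 - p.2 + 1 / 2).re → f p = g p) : f = g := by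
  refine AnalyticOnNhd.eq_of_eventuallyEq (𝕜 := ℂ) (z₀ := (0, 0)) (fun p _ => hf p)
    (fun p _ => hg p) ?_
  have h1 : ∀ᶠ p : ℂ × ℂ in 𝓝 (0, 0), 0 < (2 * p.1 + p.2 + 1 / 2).re :=
    continuousAt_const.eventually_lt
      (f := fun _ => (0 : ℝ)) (by fun_prop) (by norm_num)
  have h2 : ∀ᶠ p : ℂ × ℂ in 𝓝 (0, 0), 0 < (2 * p.1 - p.2 + 1 / 2).re :=
    continuousAt_const.eventually_lt
      (f := fun _ => (0 : ℝ)) (by fun_prop) (by norm_num)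
  filter_upwards [h1, h2] with p hp1 hp2 using h p hp1 hp2

end TestFamily

/-! ### The regularized distribution -/

section Regularization

variable {F E : Type*}
  [Field F] [ValuativeRel F] [TopologicalSpace F] [IsNonarchimedeanLocalField F]
  [Field E] [ValuativeRel E] [TopologicalSpace E] [IsNonarchimedeanLocalField E]
  [Algebra F E] [ValuativeExtension F E]
  (B : Module.Basis (Fin 2) F E)

/-- The difference of a function and its dilation by `a ∈ F^×`; it vanishes at `0`. -/
def dilDiff (a : F) (φ : E → ℂ) (x : E) : ℂ := φ x - φ (algebraMap F E a⁻¹ * x)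

/-- The difference of a function and its dilation by `a ∈ F^×` in the second coordinate; it
vanishes on the line `x₂ = 0`. -/
noncomputable def stretchDiff (a : F) (φ : E → ℂ) (x : E) : ℂ := φ x - φ (diagMap B 1 a⁻¹ x)

@[simp] lemma dilDiff_zero (a : F) (φ : E → ℂ) : dilDiff a φ 0 = 0 := by simp [dilDiff]

lemma stretchDiff_eq_zero (a : F) (φ : E → ℂ) {x : E} (hx : B.repr x 1 = 0) :
    stretchDiff B a φ x = 0 := by
  have : diagMap B 1 a⁻¹ x = x := by
    rw [diagMap, hx, coordHomeo_apply]
    conv_rhs => rw [← repr_sum B x, hx]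
    simp
  rw [stretchDiff, this, sub_self]

lemma IsTestFamily.dilDiff {Φ : E → ℂ × ℂ → ℂ} (hΦ : IsTestFamily Φ) {a : F} (ha : a ≠ 0) :
    IsTestFamily fun x p => SymBreak.dilDiff a (fun y => Φ y p) x :=
  hΦ.sub (hΦ.comp_homeomorph (Homeomorph.mulLeft₀ (algebraMap F E a⁻¹) (by simpa using ha)))

lemma IsTestFamily.stretchDiff {Φ : E → ℂ × ℂ → ℂ} (hΦ : IsTestFamily Φ) {a : F} (ha : a ≠ 0) :
    IsTestFamily fun x p => SymBreak.stretchDiff B a (fun y => Φ y p) x :=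
  hΦ.sub (hΦ.comp_homeomorph (diagHomeo B one_ne_zero (inv_ne_zero ha)))

variable {α : E} {d : F} (hα : α ^ 2 = algebraMap F E d) (hB : ⇑B = ![1, α])
  (ϖF : Uniformizer F) (ϖE : Uniformizer E)
  (χ : PontryaginDual 𝒪[E]ˣ) (η : PontryaginDual 𝒪[F]ˣ)

omit B in
lemma eventually_restrChar_eq {a : F} (ha : a ≠ 0) : ∀ᶠ b in 𝓝 a, ∀ s t,
    restrChar ϖF ϖE χ η s t b = restrChar ϖF ϖE χ η s t a := by
  have h1 := (continuous_algebraMap_localField F E).continuousAt (x := a) |>.eventually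
    (eventually_charExt_eq ϖE χ (x := algebraMap F E a) (by simpa using ha))
  filter_upwards [h1, eventually_charExt_eq ϖF η ha] with b hb1 hb2 s t
  rw [restrChar, restrChar, hb1, hb2]

omit B in
lemma analyticAt_restrChar (a : F) (p : ℂ × ℂ) :
    AnalyticAt ℂ (fun z : ℂ × ℂ => restrChar ϖF ϖE χ η z.1 z.2 a) p :=
  (analyticAt_charExt ϖE χ (analyticAt_fst.sub analyticAt_const) _).mul
    (analyticAt_charExt ϖF η (analyticAt_snd.add analyticAt_const) _)

include hα hB in
lemma eventually_smoothPart_eq {x : E} (hx : x ≠ 0) : ∀ᶠ y in 𝓝 x, ∀ s t,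
    smoothPart B ϖF ϖE χ η s t d y = smoothPart B ϖF ϖE χ η s t d x := by
  have h1 := (continuous_normForm B (d := d)).continuousAt (x := x) |>.eventually
    (eventually_restrChar_eq ϖF ϖE χ η (normForm_ne_zero B hα hB hx))
  filter_upwards [h1, eventually_charExt_eq ϖE χ hx] with y hy1 hy2 s t
  rw [smoothPart, smoothPart, hy1, charExt_pow, charExt_pow, hy2]

include hα hB in
lemma analyticAt_smoothPart (x : E) (p : ℂ × ℂ) :
    AnalyticAt ℂ (fun z : ℂ × ℂ => smoothPart B ϖF ϖE χ η z.1 z.2 d x) p := by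
  by_cases hx : x = 0
  · simp only [smoothPart, hx, ne_eq, OfNat.ofNat_ne_zero, not_false_eq_true, zero_pow,
      charExt_zero, zero_mul]
    exact analyticAt_const
  · exact (analyticAt_charExt ϖE χ (analyticAt_fst.sub analyticAt_const) _).mul
      ((analyticAt_restrChar ϖF ϖE χ η _ p).inv
        (restrChar_ne_zero _ _ _ _ _ _ (normForm_ne_zero B hα hB hx)))

include hα hB in
lemma IsTestFamily.smoothPart_mul {Φ : E → ℂ × ℂ → ℂ} (hΦ : IsTestFamily Φ) (h0 : Φ 0 = 0) :
    IsTestFamily fun x p => smoothPart B ϖF ϖE χ η p.1 p.2 d x * Φ x p := by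
  refine hΦ.mul_left (g := fun x p => smoothPart B ϖF ϖE χ η p.1 p.2 d x) (fun x => ?_)
    (analyticAt_smoothPart B hα hB ϖF ϖE χ η)
  by_cases hx : x = 0
  · right; rw [hx, h0]
  · left
    filter_upwards [eventually_smoothPart_eq B hα hB ϖF ϖE χ η hx] with y hy
    funext p; exact hy _ _

lemma IsTestFamily.mul_restrChar {Φ : E → ℂ × ℂ → ℂ} (hΦ : IsTestFamily Φ)
    (h0 : ∀ x, B.repr x 1 = 0 → Φ x = 0) :
    IsTestFamily fun x p => restrChar ϖF ϖE χ η p.1 p.2 (B.repr x 1) * Φ x p := by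
  refine hΦ.mul_left (g := fun x p => restrChar ϖF ϖE χ η p.1 p.2 (B.repr x 1)) (fun x => ?_)
    fun x => analyticAt_restrChar ϖF ϖE χ η _
  by_cases hx : B.repr x 1 = 0
  · right; exact h0 x hx
  · left
    filter_upwards [(continuous_repr B 1).continuousAt (x := x) |>.eventually
      (eventually_restrChar_eq ϖF ϖE χ η hx)] with y hy
    funext p; exact hy _ _

/-- The integrand of the regularized distribution attached to `a₁, a₂ ∈ F^×`. The dilation
differences remove the singularities of the kernel at `0` and along `F`, and for convergent
integrals they multiply the value by `(1 - c₁) (1 - c₂)`, see `dilFactor` and `stretchFactor`. -/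
noncomputable def regIntegrand (d a₁ a₂ : F) (s t : ℂ) (φ : E → ℂ) (x : E) : ℂ :=
  restrChar ϖF ϖE χ η s t (B.repr x 1) *
    stretchDiff B a₂ (fun y => smoothPart B ϖF ϖE χ η s t d y * dilDiff a₁ φ y) x

/-- The factor `|a|_E χ_{s-1/2}(a) η_{t+1/2}(a)⁻¹` by which the integral against the kernel changes
under the dilation by `a`. -/
noncomputable def dilFactor (a : F) (p : ℂ × ℂ) : ℂ :=
  nabs (algebraMap F E a) * charExt ϖE χ (p.1 - 1 / 2) (algebraMap F E a) *
    (charExt ϖF η (p.2 + 1 / 2) a)⁻¹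

/-- The factor `|a|_F χ_{s-1/2}(a) η_{t+1/2}(a)` by which the integral against
`(χ_{s-1/2} η_{t+1/2})(x₂)` changes under the dilation by `a` in the second coordinate. -/
noncomputable def stretchFactor (a : F) (p : ℂ × ℂ) : ℂ :=
  nabs a * restrChar ϖF ϖE χ η p.1 p.2 a

omit B in
lemma analyticAt_dilFactor {a : F} (ha : a ≠ 0) (p : ℂ × ℂ) :
    AnalyticAt ℂ (dilFactor ϖF ϖE χ η a) p :=
  (analyticAt_const.mul (analyticAt_charExt ϖE χ (analyticAt_fst.sub analyticAt_const) _)).mul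
    ((analyticAt_charExt ϖF η (analyticAt_snd.add analyticAt_const) _).inv
      (charExt_ne_zero _ _ _ ha))

include hα hB in
lemma IsTestFamily.regIntegrand {Φ : E → ℂ × ℂ → ℂ} (hΦ : IsTestFamily Φ) {a₁ a₂ : F}
    (h₁ : a₁ ≠ 0) (h₂ : a₂ ≠ 0) : IsTestFamily fun x p =>
      SymBreak.regIntegrand B ϖF ϖE χ η d a₁ a₂ p.1 p.2 (fun y => Φ y p) x := by
  refine IsTestFamily.mul_restrChar B ϖF ϖE χ η
    (((hΦ.dilDiff h₁).smoothPart_mul B hα hB ϖF ϖE χ η ?_).stretchDiff B h₂) ?_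
  · funext p; simp
  · intro x hx
    funext p
    exact stretchDiff_eq_zero B _ _ hx

variable [MeasurableSpace E] [BorelSpace E] (μ : Measure E) [μ.IsAddHaarMeasure]

/-- The regularized distribution `(1 - c₁) (1 - c₂) K_{s,t}`. -/
noncomputable def regDist {a₁ a₂ : F} (h₁ : a₁ ≠ 0) (h₂ : a₂ ≠ 0) (p : ℂ × ℂ) :
    Distribution E where
  toFun φ := ∫ x, regIntegrand B ϖF ϖE χ η d a₁ a₂ p.1 p.2 φ.1 x ∂μ
  map_add' φ ψ := by
    have hi (θ : TestFunction E) := integrable_testFunction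
      (((IsTestFamily.of_testFunction θ.2).regIntegrand B hα hB ϖF ϖE χ η h₁ h₂).mem_testFunction
        p) μ
    rw [← integral_add (hi φ) (hi ψ)]
    refine integral_congr_ae (.of_forall fun x => ?_)
    simp only [regIntegrand, stretchDiff, dilDiff, Submodule.coe_add, Pi.add_apply]
    ring
  map_smul' c φ := by
    rw [RingHom.id_apply, smul_eq_mul, ← integral_const_mul]
    refine integral_congr_ae (.of_forall fun x => ?_)
    simp only [regIntegrand, stretchDiff, dilDiff, Submodule.coe_smul, Pi.smul_apply, smul_eq_mul]
    ring

lemma regDist_apply {a₁ a₂ : F} (h₁ : a₁ ≠ 0) (h₂ : a₂ ≠ 0) (p : ℂ × ℂ) (φ : TestFunction E) :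
    regDist B hα hB ϖF ϖE χ η μ h₁ h₂ p φ =
      ∫ x, regIntegrand B ϖF ϖE χ η d a₁ a₂ p.1 p.2 φ.1 x ∂μ := rfl

lemma analyticAt_regDist {Φ : E → ℂ × ℂ → ℂ} (hΦ : IsTestFamily Φ) {a₁ a₂ : F}
    (h₁ : a₁ ≠ 0) (h₂ : a₂ ≠ 0) (p : ℂ × ℂ) : AnalyticAt ℂ (fun z =>
      regDist B hα hB ϖF ϖE χ η μ h₁ h₂ z ⟨fun x => Φ x z, hΦ.mem_testFunction z⟩) p :=
  (hΦ.regIntegrand B hα hB ϖF ϖE χ η h₁ h₂).analyticAt_integral μ p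

/-- The stretching part of the regularization, in the larger domain `Re(2s + t + 1/2) > 0`. -/
lemma integral_stretchDiff {θ : E → ℂ} (hθ : θ ∈ TestFunction E) {a : F} (ha : a ≠ 0)
    (p : ℂ × ℂ) (hp : 0 < (2 * p.1 + p.2 + 1 / 2).re) :
    ∫ x, restrChar ϖF ϖE χ η p.1 p.2 (B.repr x 1) * stretchDiff B a θ x ∂μ =
      (1 - stretchFactor ϖF ϖE χ η a p) *
        ∫ x, restrChar ϖF ϖE χ η p.1 p.2 (B.repr x 1) * θ x ∂μ := by
  borelize F
  have hli := locallyIntegrable_restrChar_repr B μ ϖF ϖE χ η p.1 p.2 hp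
  have hθ' : (fun x => θ (diagMap B 1 a⁻¹ x)) ∈ TestFunction E :=
    ((IsTestFamily.of_testFunction hθ).comp_homeomorph
      (diagHomeo B one_ne_zero (inv_ne_zero ha))).mem_testFunction p
  have h1 := integral_diagMap B μ (one_ne_zero (α := F)) (inv_ne_zero ha)
    fun x => restrChar ϖF ϖE χ η p.1 p.2 (a * B.repr x 1) * θ x
  have h2 : ∀ x, a * B.repr (diagMap B 1 a⁻¹ x) 1 = B.repr x 1 := by
    intro x
    rw [diagMap, coordHomeo_apply, repr_comb_one, mul_inv_cancel_left₀ ha]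
  simp_rw [h2, restrChar_mul, mul_assoc] at h1
  rw [integral_const_mul, nabs_one, inv_one, one_mul, nabs_inv, inv_inv, Complex.real_smul,
    ← mul_assoc, ← stretchFactor] at h1
  simp only [stretchDiff, mul_sub]
  rw [integral_sub (integrable_mul_testFunction hθ hli) (integrable_mul_testFunction hθ' hli), h1]
  ring

include hα hB in
/-- In the domain `Re(2s + t + 1/2) > 0`, for test functions vanishing at `0`. -/
lemma integral_stretchDiff_smoothPart {ψ : E → ℂ} (hψ : ψ ∈ TestFunction E) (h0 : ψ 0 = 0)
    {a : F} (ha : a ≠ 0) (p : ℂ × ℂ) (hp : 0 < (2 * p.1 + p.2 + 1 / 2).re) :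
    ∫ x, restrChar ϖF ϖE χ η p.1 p.2 (B.repr x 1) *
        stretchDiff B a (fun y => smoothPart B ϖF ϖE χ η p.1 p.2 d y * ψ y) x ∂μ =
      (1 - stretchFactor ϖF ϖE χ η a p) *
        ∫ x, kernel ϖF ϖE B d χ η p.1 p.2 x * ψ x ∂μ := by
  have hθ := ((IsTestFamily.of_testFunction hψ).smoothPart_mul B hα hB ϖF ϖE χ η
    (by funext p; exact h0)).mem_testFunction p
  rw [integral_stretchDiff B ϖF ϖE χ η μ hθ ha p hp]
  congr 1
  refine integral_congr_ae (.of_forall fun x => ?_)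
  simp only [kernel_eq_smoothPart_mul]
  ring

lemma dilDiff_mem_testFunction {φ : E → ℂ} (hφ : φ ∈ TestFunction E) {a : F} (ha : a ≠ 0) :
    dilDiff a φ ∈ TestFunction E :=
  ((IsTestFamily.of_testFunction hφ).dilDiff ha).mem_testFunction 0

lemma integral_kernel_comp_mul (φ : E → ℂ) {a : F} (ha : a ≠ 0) (p : ℂ × ℂ) :
    ∫ x, kernel ϖF ϖE B d χ η p.1 p.2 x * φ (algebraMap F E a⁻¹ * x) ∂μ =
      dilFactor ϖF ϖE χ η a p * ∫ x, kernel ϖF ϖE B d χ η p.1 p.2 x * φ x ∂μ := by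
  have ha' : algebraMap F E a ≠ 0 := by simpa using ha
  have h1 := integral_mul_left_eq μ (a := algebraMap F E a⁻¹) (by simpa using ha)
    fun x => kernel ϖF ϖE B d χ η p.1 p.2 (algebraMap F E a * x) * φ x
  have h2 : ∀ x : E, algebraMap F E a * (algebraMap F E a⁻¹ * x) = x := fun x => by
    rw [map_inv₀, mul_inv_cancel_left₀ ha']
  simp_rw [h2, kernel_algebraMap_mul B _ _ _ _ _ _ ha, mul_assoc] at h1
  rw [h1, integral_const_mul, integral_const_mul, map_inv₀, nabs_inv, inv_inv, Complex.real_smul,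
    dilFactor]
  ring

/-- In the domain of convergence the regularized distribution is a multiple of the kernel. -/
lemma regDist_eq_integral {a₁ a₂ : F} (h₁ : a₁ ≠ 0) (h₂ : a₂ ≠ 0) (p : ℂ × ℂ)
    (hp₁ : 0 < (2 * p.1 + p.2 + 1 / 2).re) (hp₂ : 0 < (2 * p.1 - p.2 + 1 / 2).re)
    (φ : TestFunction E) : regDist B hα hB ϖF ϖE χ η μ h₁ h₂ p φ =
      (1 - dilFactor ϖF ϖE χ η a₁ p) * (1 - stretchFactor ϖF ϖE χ η a₂ p) *
        ∫ x, kernel ϖF ϖE B d χ η p.1 p.2 x * φ.1 x ∂μ := by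
  have hli := locallyIntegrable_kernel B μ hα hB ϖF ϖE χ η p.1 p.2 hp₁ hp₂
  have hφ' : (fun x => φ.1 (algebraMap F E a₁⁻¹ * x)) ∈ TestFunction E :=
    ((IsTestFamily.of_testFunction φ.2).comp_homeomorph
      (Homeomorph.mulLeft₀ (algebraMap F E a₁⁻¹) (by simpa using h₁))).mem_testFunction p
  rw [regDist_apply]
  simp only [regIntegrand]
  rw [integral_stretchDiff_smoothPart B hα hB ϖF ϖE χ η μ (dilDiff_mem_testFunction φ.2 h₁)
    (dilDiff_zero _ _) h₂ p hp₁]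
  simp only [dilDiff, mul_sub]
  rw [integral_sub (integrable_mul_testFunction φ.2 hli) (integrable_mul_testFunction hφ' hli),
    integral_kernel_comp_mul B ϖF ϖE χ η μ _ h₁]
  ring

end Regularization

/-! ### The regularized distribution is a symmetry breaking kernel -/

section Equivariance

variable {F E : Type*}
  [Field F] [ValuativeRel F] [TopologicalSpace F] [IsNonarchimedeanLocalField F]
  [Field E] [ValuativeRel E] [TopologicalSpace E] [IsNonarchimedeanLocalField E]
  [Algebra F E] [ValuativeExtension F E]
  (B : Module.Basis (Fin 2) F E) {α : E} {d : F} (hα : α ^ 2 = algebraMap F E d)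
  (hB : ⇑B = ![1, α]) (ϖF : Uniformizer F) (ϖE : Uniformizer E)
  (χ : PontryaginDual 𝒪[E]ˣ) (η : PontryaginDual 𝒪[F]ˣ)
  [MeasurableSpace E] [BorelSpace E] (μ : Measure E) [μ.IsAddHaarMeasure]

omit B in
lemma IsSymmetryBreakingKernel.smul {s t : ℂ} {u : Distribution E}
    (hu : IsSymmetryBreakingKernel ϖF ϖE χ s η t u) (c : ℂ) :
    IsSymmetryBreakingKernel ϖF ϖE χ s η t (c • u) := by
  refine ⟨fun a ha φ ψ h => ?_, fun b hb φ ψ₁ ψ₂ h h₁ h₂ => ?_⟩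
  · simp only [LinearMap.smul_apply, smul_eq_mul]
    rw [hu.1 a ha φ ψ h]; ring
  · simp only [LinearMap.smul_apply]
    rw [hu.2 b hb φ ψ₁ ψ₂ h h₁ h₂]

omit [ValuativeExtension F E] B in
/-- The substitution `x ↦ x / (1 - b x)`, as the composition of two inversions and a translation. -/
lemma integral_comp_moebius (b : E) (k φ : E → ℂ) :
    ∫ x, k x * (((nabs (1 + b * x) : ℂ) ^ 2)⁻¹ * φ (x / (1 + b * x))) ∂μ =
      ∫ x, k (x / (1 - b * x)) * φ x ∂μ := by
  rw [← integral_comp_inv μ fun x => k x * (((nabs (1 + b * x) : ℂ) ^ 2)⁻¹ * φ (x / (1 + b * x)))]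
  let G : E → ℂ := fun y => ((nabs y : ℂ) ^ 2)⁻¹ * (k (y - b)⁻¹ * φ y⁻¹)
  have h1 : ∫ x, ((nabs x : ℂ) ^ 2)⁻¹ * (k x⁻¹ * (((nabs (1 + b * x⁻¹) : ℂ) ^ 2)⁻¹ *
      φ (x⁻¹ / (1 + b * x⁻¹)))) ∂μ = ∫ x, G (x + b) ∂μ := by
    refine integral_congr_ae ?_
    filter_upwards [ae_ne_zero μ] with x hx
    have e1 : 1 + b * x⁻¹ = (x + b) * x⁻¹ := by field_simp
    have e2 : x⁻¹ / ((x + b) * x⁻¹) = (x + b)⁻¹ := by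
      rw [div_eq_mul_inv, mul_inv, inv_inv, mul_comm (x + b)⁻¹, ← mul_assoc, inv_mul_cancel₀ hx,
        one_mul]
    have hn : (nabs x : ℂ) ≠ 0 := by exact_mod_cast (nabs_pos hx).ne'
    have e3 : ((nabs x : ℂ) ^ 2)⁻¹ * ((nabs ((x + b) * x⁻¹) : ℂ) ^ 2)⁻¹ =
        ((nabs (x + b) : ℂ) ^ 2)⁻¹ := by
      rw [nabs_mul, nabs_inv, ← mul_inv, ← mul_pow]
      push_cast
      rw [mul_comm (nabs (x + b) : ℂ), mul_inv_cancel_left₀ hn]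
    simp only [G, e1, e2, add_sub_cancel_right]
    rw [← e3]
    ring
  rw [h1, integral_add_right_eq_self G b]
  have h2 := integral_comp_inv μ fun z => k (z⁻¹ - b)⁻¹ * φ z
  simp only [inv_inv] at h2
  rw [h2]
  refine integral_congr_ae ?_
  filter_upwards [ae_ne_zero μ] with x hx
  have : (x⁻¹ - b)⁻¹ = x / (1 - b * x) := by
    have e : x⁻¹ - b = (1 - b * x) * x⁻¹ := by field_simp
    rw [e, mul_inv, inv_inv, div_eq_mul_inv, mul_comm]
  rw [this]

omit [ValuativeExtension F E] B in
lemma isTestFamily_moebius {b : E} {φ : E → ℂ} (hφ : φ ∈ TestFunction E)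
    (h0 : φ b⁻¹ = 0) :
    IsTestFamily fun x p => (charExt ϖE χ (p.1 - 1 / 2) ((1 - b * x) ^ 2))⁻¹ * φ x := by
  refine (IsTestFamily.of_testFunction hφ).mul_left
    (g := fun x p => (charExt ϖE χ (p.1 - 1 / 2) ((1 - b * x) ^ 2))⁻¹) (fun x => ?_)
    (fun x p => ?_)
  · by_cases hx : 1 - b * x = 0
    · right
      have : x = b⁻¹ := by
        rw [eq_comm]
        exact inv_eq_of_mul_eq_one_right (sub_eq_zero.1 hx).symm
      funext p
      rw [this, h0]; rfl
    · left
      have hc : Continuous fun y : E => (1 - b * y) ^ 2 :=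
        (continuous_const.sub (continuous_const.mul continuous_id)).pow 2
      filter_upwards [hc.continuousAt.eventually
        (eventually_charExt_eq ϖE χ (x := (1 - b * x) ^ 2) (pow_ne_zero 2 hx))] with y hy
      funext p
      rw [hy]
  · by_cases hx : 1 - b * x = 0
    · simp only [hx, ne_eq, OfNat.ofNat_ne_zero, not_false_eq_true, zero_pow, charExt_zero,
        inv_zero]
      exact analyticAt_const
    · exact (analyticAt_charExt ϖE χ (analyticAt_fst.sub analyticAt_const) _).inv
        (charExt_ne_zero _ _ _ (pow_ne_zero 2 hx))

/-- Both equivariance properties are changes of variables in the domain of convergence, and they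
extend to all parameters by uniqueness of analytic continuation. -/
lemma isSymmetryBreakingKernel_regDist {a₁ a₂ : F} (h₁ : a₁ ≠ 0) (h₂ : a₂ ≠ 0) (p : ℂ × ℂ) :
    IsSymmetryBreakingKernel ϖF ϖE χ p.1 η p.2 (regDist B hα hB ϖF ϖE χ η μ h₁ h₂ p) := by
  have han (θ : TestFunction E) (z : ℂ × ℂ) :
      AnalyticAt ℂ (fun z => regDist B hα hB ϖF ϖE χ η μ h₁ h₂ z θ) z :=
    analyticAt_regDist B hα hB ϖF ϖE χ η μ (IsTestFamily.of_testFunction θ.2) h₁ h₂ z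
  constructor
  · intro a ha φ ψ hψ
    have h := eq_of_analytic_of_eq (han ψ)
      (fun z => (analyticAt_dilFactor ϖF ϖE χ η ha z).mul (han φ z)) ?_
    · exact congrFun h p
    · intro z hz₁ hz₂
      simp only [Pi.mul_apply]
      rw [regDist_eq_integral B hα hB ϖF ϖE χ η μ h₁ h₂ z hz₁ hz₂,
        regDist_eq_integral B hα hB ϖF ϖE χ η μ h₁ h₂ z hz₁ hz₂]
      simp_rw [hψ, ← map_inv₀]
      rw [integral_kernel_comp_mul B ϖF ϖE χ η μ _ ha]
      ring
  · intro b _ φ ψ₁ ψ₂ h0 hψ₁ hψ₂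
    have hΦ := isTestFamily_moebius ϖE χ φ.2 h0
    have h := eq_of_analytic_of_eq (han ψ₁)
      (analyticAt_regDist B hα hB ϖF ϖE χ η μ hΦ h₁ h₂) ?_
    · have e : ψ₂ = ⟨_, hΦ.mem_testFunction p⟩ := Subtype.ext (funext hψ₂)
      rw [e]
      exact congrFun h p
    · intro z hz₁ hz₂
      rw [regDist_eq_integral B hα hB ϖF ϖE χ η μ h₁ h₂ z hz₁ hz₂,
        regDist_eq_integral B hα hB ϖF ϖE χ η μ h₁ h₂ z hz₁ hz₂]
      congr 1
      simp_rw [hψ₁]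
      rw [integral_comp_moebius μ]
      refine integral_congr_ae (.of_forall fun x => ?_)
      simp only [kernel_moebius B hα hB]
      ring

end Equivariance

/-! ### Simple poles -/

section Poles

/-- The function `c` is identically different from `1` or of the form `exp(-λ (ℓ - ℓ(p)))`, the
set `P` is given by the equation `c = 1`, it does not meet the half space `Re(ℓ + 1/2) > 0`, and
`(1 - c)⁻¹` is a constant multiple `κ` of the `L`-factor. -/
structure PoleDatum (ℓ : ℂ × ℂ →L[ℂ] ℂ) (c : ℂ × ℂ → ℂ) (P : Set (ℂ × ℂ)) (L : ℂ × ℂ → ℂ)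
    (κ : ℂ) : Prop where
  analyticAt : ∀ p, AnalyticAt ℂ c p
  ne_one : ∀ p ∉ P, c p ≠ 1
  notMem : ∀ p, 0 < (ℓ p + 1 / 2).re → p ∉ P
  inv_mul_inv : ∀ p ∉ P, (L p)⁻¹ * (1 - c p)⁻¹ = κ
  exp_eq : ∀ p ∈ P, ∃ l : ℂ, l ≠ 0 ∧ ∀ z, c z = Complex.exp (-l * (ℓ z - ℓ p))

namespace PoleDatum

variable {ℓ : ℂ × ℂ →L[ℂ] ℂ} {c : ℂ × ℂ → ℂ} {P : Set (ℂ × ℂ)} {L : ℂ × ℂ → ℂ} {κ : ℂ}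

lemma eq_one (h : PoleDatum ℓ c P L κ) {p : ℂ × ℂ} (hp : p ∈ P) : c p = 1 := by
  obtain ⟨l, -, hl⟩ := h.exp_eq p hp
  simp [hl]

open Classical in
/-- `u / (1 - exp(-λ u))` is holomorphic at `u = 0`. -/
lemma exists_analyticAt (h : PoleDatum ℓ c P L κ) (p : ℂ × ℂ) : ∃ g : ℂ × ℂ → ℂ,
    AnalyticAt ℂ g p ∧ ∀ᶠ z in 𝓝 p, z ∉ P →
      (if p ∈ P then ℓ z - ℓ p else 1) * (1 - c z)⁻¹ = g z := by
  by_cases hp : p ∈ P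
  · obtain ⟨l, hl0, hl⟩ := h.exp_eq p hp
    let f : ℂ → ℂ := fun u => 1 - Complex.exp (-l * u)
    have hf : Differentiable ℂ f := by fun_prop
    have hd : Differentiable ℂ (dslope f 0) := by
      rw [← differentiableOn_univ, Complex.differentiableOn_dslope Filter.univ_mem]
      exact hf.differentiableOn
    have hf' : HasDerivAt f l 0 := by
      have h1 : HasDerivAt (fun u : ℂ => -l * u) (-l) 0 := by
        simpa using (hasDerivAt_id (0 : ℂ)).const_mul (-l)
      have h2 := (h1.cexp).const_sub 1
      simpa [f] using h2
    have hd0 : dslope f 0 0 = l := by rw [dslope_same, hf'.deriv]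
    refine ⟨fun z => (dslope f 0 (ℓ z - ℓ p))⁻¹, ?_, .of_forall fun z hz => ?_⟩
    · refine AnalyticAt.inv ?_ (by rw [sub_self, hd0]; exact hl0)
      exact (hd.analyticAt _).comp ((ℓ.analyticAt p).sub analyticAt_const)
    · rw [if_pos hp]
      have h1 := h.ne_one z hz
      have h3 : (ℓ z - ℓ p) • dslope f 0 (ℓ z - ℓ p) = 1 - c z := by
        have := sub_smul_dslope f 0 (ℓ z - ℓ p)
        rw [sub_zero] at this
        rw [this, hl z]
        simp [f]
      have hu : ℓ z - ℓ p ≠ 0 := by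
        intro hu
        rw [hu, zero_smul] at h3
        exact h1 (sub_eq_zero.1 h3.symm).symm
      rw [← h3, smul_eq_mul, mul_inv, mul_inv_cancel_left₀ hu]
  · have h1 : 1 - c p ≠ 0 := sub_ne_zero.2 (h.ne_one p hp).symm
    exact ⟨fun z => (1 - c z)⁻¹, (analyticAt_const.sub (h.analyticAt p)).inv h1,
      .of_forall fun z _ => by rw [if_neg hp, one_mul]⟩

lemma eventually_notMem (h : PoleDatum ℓ c P L κ) (hℓ : ℓ (1, 0) ≠ 0) (p : ℂ × ℂ) :
    ∀ᶠ u : ℂ in 𝓝[≠] 0, p + u • (1, 0) ∉ P := by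
  by_cases hp : p ∈ P
  · obtain ⟨l, hl0, hl⟩ := h.exp_eq p hp
    have h1 : HasDerivAt (fun u : ℂ => -l * (u * ℓ (1, 0))) (-l * ℓ (1, 0)) 0 := by
      have := ((hasDerivAt_id (0 : ℂ)).mul_const (ℓ (1, 0))).const_mul (-l)
      simpa using this
    have h2 := h1.cexp
    have h3 := h2.eventually_ne (c := 1) (by simpa using ⟨hl0, hℓ⟩)
    filter_upwards [h3] with u hu hmem
    have h4 := h.eq_one hmem
    rw [hl, map_add, map_smul, smul_eq_mul, add_sub_cancel_left] at h4
    exact hu h4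
  · have hc : ContinuousAt (fun u : ℂ => c (p + u • (1, 0))) 0 := by
      refine ContinuousAt.comp (g := c) ?_ (by fun_prop)
      simpa using (h.analyticAt p).continuousAt
    have := hc.eventually_ne (y := 1) (by simpa using h.ne_one p hp)
    filter_upwards [nhdsWithin_le_nhds this] with u hu hmem
    exact hu (h.eq_one hmem)

end PoleDatum

lemma dense_compl_of_poleDatum {ℓ₁ ℓ₂ : ℂ × ℂ →L[ℂ] ℂ} {c₁ c₂ : ℂ × ℂ → ℂ} {P₁ P₂ : Set (ℂ × ℂ)}
    {L₁ L₂ : ℂ × ℂ → ℂ} {κ₁ κ₂ : ℂ} (h₁ : PoleDatum ℓ₁ c₁ P₁ L₁ κ₁) (h₂ : PoleDatum ℓ₂ c₂ P₂ L₂ κ₂)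
    (hℓ₁ : ℓ₁ (1, 0) ≠ 0) (hℓ₂ : ℓ₂ (1, 0) ≠ 0) : Dense (P₁ ∪ P₂)ᶜ := by
  intro p
  have ht : Filter.Tendsto (fun u : ℂ => p + u • ((1, 0) : ℂ × ℂ)) (𝓝[≠] 0) (𝓝 p) := by
    have : ContinuousAt (fun u : ℂ => p + u • ((1, 0) : ℂ × ℂ)) 0 := by fun_prop
    have h := this.tendsto.mono_left (nhdsWithin_le_nhds (s := {0}ᶜ))
    simpa using h
  refine mem_closure_of_tendsto ht ?_
  filter_upwards [h₁.eventually_notMem hℓ₁ p, h₂.eventually_notMem hℓ₂ p] with u hu₁ hu₂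
  rintro (h | h)
  exacts [hu₁ h, hu₂ h]

end Poles

section PoleData

/-- The linear form `2 s + t` on `ℂ²`. -/
noncomputable def linPlus : ℂ × ℂ →L[ℂ] ℂ :=
  (2 : ℂ) • ContinuousLinearMap.fst ℂ ℂ ℂ + ContinuousLinearMap.snd ℂ ℂ ℂ

/-- The linear form `2 s - t` on `ℂ²`. -/
noncomputable def linMinus : ℂ × ℂ →L[ℂ] ℂ :=
  (2 : ℂ) • ContinuousLinearMap.fst ℂ ℂ ℂ - ContinuousLinearMap.snd ℂ ℂ ℂ

@[simp] lemma linPlus_apply (p : ℂ × ℂ) : linPlus p = 2 * p.1 + p.2 := rfl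

@[simp] lemma linMinus_apply (p : ℂ × ℂ) : linMinus p = 2 * p.1 - p.2 := rfl

lemma ofReal_cpow_eq_exp {x : ℝ} (hx : 0 < x) (z : ℂ) :
    (x : ℂ) ^ z = Complex.exp (Real.log x * z) := by
  rw [Complex.cpow_def_of_ne_zero (by exact_mod_cast hx.ne'), Complex.ofReal_log hx.le]

lemma poleDatum_of_cpow {ℓ : ℂ × ℂ →L[ℂ] ℂ} {c L : ℂ × ℂ → ℂ} {P : Set (ℂ × ℂ)} {w : ℂ} {q : ℕ}
    (hq : 1 < q) (hw : ‖w‖ = 1) (hc : ∀ z, c z = w * (q : ℂ) ^ (-(ℓ z + 1 / 2)))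
    (hP : ∀ z, z ∈ P ↔ c z = 1) (hL : ∀ z, (L z)⁻¹ = 1 - c z) : PoleDatum ℓ c P L 1 := by
  have hq0 : (0 : ℝ) < q := by exact_mod_cast zero_lt_one.trans hq
  have hlog : Real.log q ≠ 0 := (Real.log_pos (by exact_mod_cast hq)).ne'
  have hexp : ∀ z : ℂ, (q : ℂ) ^ z = Complex.exp (Real.log q * z) := fun z => by
    rw [← ofReal_cpow_eq_exp hq0, Complex.ofReal_natCast]
  refine ⟨fun p => ?_, fun p hp => fun h => hp ((hP p).2 h), fun p hp hmem => ?_, fun p hp => ?_,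
    fun p hp => ⟨Real.log q, by exact_mod_cast hlog, fun z => ?_⟩⟩
  · have : c = fun z => w * Complex.exp (Real.log q * (-(ℓ z + 1 / 2))) := by
      funext z; rw [hc, hexp]
    rw [this]
    exact analyticAt_const.mul
      (analyticAt_const.mul ((ℓ.analyticAt p).add analyticAt_const).neg).cexp
  · have h := congrArg norm ((hP p).1 hmem)
    rw [hc, norm_mul, hw, one_mul, norm_one, Complex.norm_natCast_cpow_of_pos
      (zero_lt_one.trans hq), Complex.neg_re] at h
    have hlt := Real.rpow_lt_one_of_one_lt_of_neg (x := (q : ℝ)) (by exact_mod_cast hq)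
      (neg_lt_zero.2 hp)
    exact hlt.ne h
  · rw [hL, mul_inv_cancel₀]
    exact sub_ne_zero.2 fun h => hp ((hP p).2 h.symm)
  · have h1 := (hP p).1 hp
    rw [hc, hexp] at h1
    rw [hc, hexp]
    have h2 : (Real.log q : ℂ) * -(ℓ z + 1 / 2) =
        (Real.log q : ℂ) * -(ℓ p + 1 / 2) + -(Real.log q : ℂ) * (ℓ z - ℓ p) := by ring
    rw [h2, Complex.exp_add, ← mul_assoc, h1, one_mul]

lemma poleDatum_of_const {ℓ : ℂ × ℂ →L[ℂ] ℂ} {c L : ℂ × ℂ → ℂ} {c₀ : ℂ} (h : c₀ ≠ 1)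
    (hc : ∀ z, c z = c₀) (hL : ∀ z, L z = 1) : PoleDatum ℓ c ∅ L (1 - c₀)⁻¹ := by
  refine ⟨fun p => ?_, fun p _ => by rwa [hc], fun p _ => Set.notMem_empty p, fun p _ => ?_,
    fun p hp => absurd hp (Set.notMem_empty p)⟩
  · rw [show c = fun _ => c₀ from funext hc]; exact analyticAt_const
  · rw [hL, hc]; simp

variable {F E : Type*}
  [Field F] [ValuativeRel F] [TopologicalSpace F] [IsNonarchimedeanLocalField F]
  [Field E] [ValuativeRel E] [TopologicalSpace E] [IsNonarchimedeanLocalField E]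
  [Algebra F E] [ValuativeExtension F E] (B : Module.Basis (Fin 2) F E)
  (ϖF : Uniformizer F) (ϖE : Uniformizer E)
  (χ : PontryaginDual 𝒪[E]ˣ) (η : PontryaginDual 𝒪[F]ˣ)

include B

lemma charExt_algebraMap_uniformizer (s : ℂ) : charExt ϖE χ s (algebraMap F E (ϖF : F)) =
    charExt ϖE χ 0 (algebraMap F E (ϖF : F)) * Complex.exp (Real.log (resCard F) * (-2 * s)) := by
  have h0 : algebraMap F E (ϖF : F) ≠ 0 := by simpa using ϖF.ne_zero
  rw [charExt_eq_mul_cpow _ _ _ h0, ofReal_cpow_eq_exp (nabs_pos h0), nabs_algebraMap B,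
    ϖF.nabs_eq, Real.log_pow, Real.log_inv]
  congr 2
  push_cast
  ring

omit B in
lemma charExt_uniformizer (t : ℂ) : charExt ϖF η t (ϖF : F) =
    Complex.exp (Real.log (resCard F) * (-t)) := by
  rw [charExt_eq_mul_cpow _ _ _ ϖF.ne_zero, charExt_zero_uniformizer_self, one_mul,
    ofReal_cpow_eq_exp (nabs_pos ϖF.ne_zero), ϖF.nabs_eq, Real.log_inv]
  congr 1
  push_cast
  ring

variable (F) in
omit B in
lemma resCard_cpow (z : ℂ) :
    (resCard F : ℂ) ^ z = Complex.exp (Real.log (resCard F) * z) := by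
  rw [← ofReal_cpow_eq_exp (resCard_pos F), Complex.ofReal_natCast]

variable (F) in
omit B in
lemma resCard_inv_eq_exp :
    ((resCard F : ℝ)⁻¹ : ℂ) = Complex.exp (Real.log (resCard F) * (-1)) := by
  rw [← resCard_cpow, Complex.cpow_neg_one, Complex.ofReal_natCast]

lemma stretchFactor_uniformizer (p : ℂ × ℂ) : stretchFactor ϖF ϖE χ η (ϖF : F) p =
    charExt ϖE χ 0 (algebraMap F E (ϖF : F)) * (resCard F : ℂ) ^ (-(linPlus p + 1 / 2)) := by
  rw [stretchFactor, restrChar, charExt_algebraMap_uniformizer B, charExt_uniformizer,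
    ϖF.nabs_eq, Complex.ofReal_inv, resCard_inv_eq_exp, resCard_cpow, mul_left_comm,
    mul_assoc (charExt ϖE χ 0 _), ← Complex.exp_add,
    ← Complex.exp_add, linPlus_apply]
  congr 2
  ring

lemma dilFactor_uniformizer (p : ℂ × ℂ) : dilFactor ϖF ϖE χ η (ϖF : F) p =
    charExt ϖE χ 0 (algebraMap F E (ϖF : F)) * (resCard F : ℂ) ^ (-(linMinus p + 1 / 2)) := by
  rw [dilFactor, charExt_algebraMap_uniformizer B, charExt_uniformizer, nabs_algebraMap B,
    ϖF.nabs_eq, Complex.ofReal_pow, Complex.ofReal_inv, resCard_inv_eq_exp, resCard_cpow,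
    ← Complex.exp_nat_mul, ← Complex.exp_neg, mul_left_comm, mul_assoc, ← Complex.exp_add,
    ← Complex.exp_add, linMinus_apply]
  congr 2
  push_cast
  ring

lemma charPlus_of_nabs_eq_one (s t : ℂ) {u : F} (hu : nabs u = 1) :
    charPlus ϖF ϖE χ η s t u = charExt ϖE χ 0 (algebraMap F E u) * charExt ϖF η 0 u := by
  rw [charPlus, charExt_of_nabs_eq_one ϖF η t hu,
    charExt_of_nabs_eq_one ϖE χ s (by rw [nabs_algebraMap B, hu, one_pow])]

lemma charMinus_of_nabs_eq_one (s t : ℂ) {u : F} (hu : nabs u = 1) :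
    charMinus ϖF ϖE χ η s t u = charExt ϖE χ 0 (algebraMap F E u) * (charExt ϖF η 0 u)⁻¹ := by
  rw [charMinus, charExt_of_nabs_eq_one ϖF η t hu,
    charExt_of_nabs_eq_one ϖE χ s (by rw [nabs_algebraMap B, hu, one_pow])]

lemma norm_charExt_algebraMap_uniformizer :
    ‖charExt ϖE χ 0 (algebraMap F E (ϖF : F))‖ = 1 := by
  rw [norm_charExt ϖE χ 0 (by simpa using ϖF.ne_zero)]; simp

/-- If `χ η` is trivial on the units of `F`, then stretching by the uniformizer produces the
`L`-factor; otherwise stretching by a suitable unit produces a constant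
factor different from `1`. -/
lemma exists_poleDatum_plus : ∃ (a : F) (_ : a ≠ 0) (κ : ℂ),
    PoleDatum linPlus (stretchFactor ϖF ϖE χ η a) (backslashes ϖF ϖE χ η)
      (fun p => localL ϖF (1 / 2) (charPlus ϖF ϖE χ η p.1 p.2)) κ ∧
    ((backslashes ϖF ϖE χ η).Nonempty → a = ϖF) := by
  by_cases htriv : ∀ u : F, u ≠ 0 → nu u = 0 →
      charExt ϖE χ 0 (algebraMap F E u) * charExt ϖF η 0 u = 1
  · refine ⟨ϖF, ϖF.ne_zero, 1, poleDatum_of_cpow (one_lt_resCard F)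
      (norm_charExt_algebraMap_uniformizer B ϖF ϖE χ)
      (stretchFactor_uniformizer B ϖF ϖE χ η) (fun z => ?_) (fun z => ?_), fun _ => rfl⟩
    · rw [stretchFactor_uniformizer B, linPlus_apply]
      exact ⟨fun h => h.2, fun h => ⟨htriv, h⟩⟩
    · rw [localL, if_pos, inv_inv, stretchFactor_uniformizer B, charPlus,
        charExt_algebraMap_uniformizer B, charExt_uniformizer, resCard_cpow, resCard_cpow,
        mul_assoc, mul_assoc, ← Complex.exp_add, ← Complex.exp_add, linPlus_apply]
      · congr 3; ring
      · intro u hu hu'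
        rw [charPlus_of_nabs_eq_one B _ _ _ _ _ _ (nabs_eq_one_iff.2 ⟨hu, hu'⟩)]
        exact htriv u hu hu'
  · have hP : backslashes ϖF ϖE χ η = ∅ := by
      ext p; simp only [Set.mem_empty_iff_false, iff_false]; exact fun h => htriv h.1
    have htriv' := htriv
    push Not at htriv'
    obtain ⟨u, hu, hu', hne⟩ := htriv'
    have hu1 := nabs_eq_one_iff.2 ⟨hu, hu'⟩
    rw [hP]
    refine ⟨u, hu, _, poleDatum_of_const hne (fun z => ?_) (fun z => ?_), fun h => ?_⟩
    · rw [stretchFactor, restrChar, hu1, charExt_of_nabs_eq_one ϖF η _ hu1,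
        charExt_of_nabs_eq_one ϖE χ _ (by rw [nabs_algebraMap B, hu1, one_pow])]
      simp
    · rw [localL, if_neg]
      intro h
      apply hne
      rw [← charPlus_of_nabs_eq_one B ϖF ϖE χ η z.1 z.2 hu1]
      exact h u hu hu'
    · exact absurd h Set.not_nonempty_empty

/-- If `χ η⁻¹` is trivial on the units of `F`, then dilation by the uniformizer produces the
`L`-factor; otherwise dilation by a suitable unit produces a constant factor different from `1`. -/
lemma exists_poleDatum_minus : ∃ (a : F) (_ : a ≠ 0) (κ : ℂ),
    PoleDatum linMinus (dilFactor ϖF ϖE χ η a) (slashes ϖF ϖE χ η)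
      (fun p => localL ϖF (1 / 2) (charMinus ϖF ϖE χ η p.1 p.2)) κ ∧
    ((slashes ϖF ϖE χ η).Nonempty → a = ϖF) := by
  by_cases htriv : ∀ u : F, u ≠ 0 → nu u = 0 →
      charExt ϖE χ 0 (algebraMap F E u) * (charExt ϖF η 0 u)⁻¹ = 1
  · refine ⟨ϖF, ϖF.ne_zero, 1, poleDatum_of_cpow (one_lt_resCard F)
      (norm_charExt_algebraMap_uniformizer B ϖF ϖE χ)
      (dilFactor_uniformizer B ϖF ϖE χ η) (fun z => ?_) (fun z => ?_), fun _ => rfl⟩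
    · rw [dilFactor_uniformizer B, linMinus_apply]
      exact ⟨fun h => h.2, fun h => ⟨htriv, h⟩⟩
    · rw [localL, if_pos, inv_inv, dilFactor_uniformizer B, charMinus,
        charExt_algebraMap_uniformizer B, charExt_uniformizer, resCard_cpow, resCard_cpow,
        ← Complex.exp_neg, mul_assoc, mul_assoc, ← Complex.exp_add, ← Complex.exp_add,
        linMinus_apply]
      · congr 3; ring
      · intro u hu hu'
        rw [charMinus_of_nabs_eq_one B _ _ _ _ _ _ (nabs_eq_one_iff.2 ⟨hu, hu'⟩)]
        exact htriv u hu hu'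
  · have hP : slashes ϖF ϖE χ η = ∅ := by
      ext p; simp only [Set.mem_empty_iff_false, iff_false]; exact fun h => htriv h.1
    have htriv' := htriv
    push Not at htriv'
    obtain ⟨u, hu, hu', hne⟩ := htriv'
    have hu1 := nabs_eq_one_iff.2 ⟨hu, hu'⟩
    rw [hP]
    refine ⟨u, hu, _, poleDatum_of_const hne (fun z => ?_) (fun z => ?_), fun h => ?_⟩
    · have hE : nabs (algebraMap F E u) = 1 := by rw [nabs_algebraMap B, hu1, one_pow]
      rw [dilFactor, hE, charExt_of_nabs_eq_one ϖF η _ hu1, charExt_of_nabs_eq_one ϖE χ _ hE]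
      simp
    · rw [localL, if_neg]
      intro h
      apply hne
      rw [← charMinus_of_nabs_eq_one B ϖF ϖE χ η z.1 z.2 hu1]
      exact h u hu hu'
    · exact absurd h Set.not_nonempty_empty

end PoleData

/-! ### Non-vanishing of integrals of characters over lines -/

section Shells

variable {K : Type*} [Field K] [ValuativeRel K] [TopologicalSpace K]
  [IsNonarchimedeanLocalField K]

/-- A multiplicative function on `K^×` is determined by its values on `ϖ` and on the units. -/
lemma eq_one_of_multiplicative {f : K → ℂ} (ϖ : Uniformizer K)
    (hmul : ∀ x y, f (x * y) = f x * f y) (hϖ : f (ϖ : K) = 1) (hu : ∀ u, nabs u = 1 → f u = 1)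
    {x : K} (hx : x ≠ 0) : f x = 1 := by
  have h1 : f 1 = 1 := hu 1 nabs_one
  have hnat : ∀ n : ℕ, f ((ϖ : K) ^ n) = 1 := by
    intro n
    induction n with
    | zero => simpa using h1
    | succ n ih => rw [pow_succ, hmul, ih, hϖ, one_mul]
  have hint : ∀ n : ℤ, f ((ϖ : K) ^ n) = 1 := by
    intro n
    obtain ⟨m, rfl | rfl⟩ := n.eq_nat_or_neg
    · rw [zpow_natCast]; exact hnat m
    · have h2 := hmul ((ϖ : K) ^ (-(m : ℤ))) ((ϖ : K) ^ m)
      rw [hnat, mul_one, zpow_neg, zpow_natCast, inv_mul_cancel₀ (pow_ne_zero _ ϖ.ne_zero),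
        h1] at h2
      rw [zpow_neg, zpow_natCast, ← h2]
  have h2 : x = (ϖ : K) ^ (nu x) * ((ϖ : K) ^ (-nu x) * x) := by
    rw [← mul_assoc, ← zpow_add₀ ϖ.ne_zero]; simp
  rw [h2, hmul, hint, one_mul]
  apply hu
  rw [nabs_mul, ϖ.nabs_zpow_eq, nabs_of_ne_zero hx, ← zpow_add₀ (resCard_pos K).ne']
  simp

variable [MeasurableSpace K] [BorelSpace K] (μ : Measure K) [μ.IsAddHaarMeasure]

lemma measurableSet_nabs_eq (r : ℝ) : MeasurableSet {x : K | nabs x = r} :=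
  (isClosed_eq continuous_nabs continuous_const).measurableSet

lemma measureReal_nabs_le {a : K} (ha : a ≠ 0) :
    μ.real {x : K | nabs x ≤ nabs a} = nabs a * μ.real {x : K | nabs x ≤ 1} := by
  rw [Measure.real, measure_nabs_le_nabs μ ha, ENNReal.toReal_mul,
    ENNReal.toReal_ofReal (nabs_nonneg a), Measure.real]

lemma measureReal_integer_pos : 0 < μ.real {x : K | nabs x ≤ 1} :=
  ENNReal.toReal_pos (measure_nabs_le_pos μ one_pos).ne' (measure_nabs_le_lt_top μ 1).ne

end Shells

section UnitCharacter

variable {E : Type*} [Field E] [ValuativeRel E] [TopologicalSpace E]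
  [IsNonarchimedeanLocalField E] [MeasurableSpace E] [BorelSpace E]
  (μ : Measure E) [μ.IsAddHaarMeasure] (ϖE : Uniformizer E) (χ : PontryaginDual 𝒪[E]ˣ)

open Classical in
/-- The character `χ` of the units, extended by zero to `E`. -/
noncomputable def unitChar (x : E) : ℂ := if nabs x = 1 then charExt ϖE χ 0 x else 0

lemma unitChar_mul_left {u : E} (hu : nabs u = 1) (x : E) :
    unitChar ϖE χ (u * x) = charExt ϖE χ 0 u * unitChar ϖE χ x := by
  simp only [unitChar, nabs_mul, hu, one_mul, charExt_mul]
  split_ifs <;> simp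

lemma norm_unitChar_le_one (x : E) : ‖unitChar ϖE χ x‖ ≤ 1 := by
  unfold unitChar
  split_ifs
  · exact norm_charExt_zero_le_one ϖE χ x
  · simp

lemma measurable_unitChar : Measurable (unitChar ϖE χ) := by
  classical
  exact (measurable_charExt ϖE χ 0).ite (measurableSet_nabs_eq 1) measurable_const

/-- A nontrivial character of the units has an exact conductor: it is trivial on the units
`x ≡ 1` modulo `b`, and on no larger such subgroup. -/
lemma exists_conductor (hχ : ∃ u : E, nabs u = 1 ∧ charExt ϖE χ 0 u ≠ 1) : ∃ b : E, b ≠ 0 ∧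
    nabs b < 1 ∧ (∀ x, nabs x = 1 → nabs (x - 1) ≤ nabs b → charExt ϖE χ 0 x = 1) ∧
    ∀ c : E, nabs b < nabs c →
      ∃ u : E, nabs u = 1 ∧ nabs (u - 1) ≤ nabs c ∧ charExt ϖE χ 0 u ≠ 1 := by
  classical
  let p : ℕ → Prop := fun m => ∀ x : E, nabs x = 1 → nabs (x - 1) ≤ nabs ((ϖE : E) ^ m) →
    charExt ϖE χ 0 x = 1
  have hex : ∃ m, p m := by
    obtain ⟨r, hr, -, h⟩ := exists_charExt_eq_one ϖE χ
    obtain ⟨m, hm⟩ := exists_pow_lt_of_lt_one hr ϖE.nabs_lt_one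
    exact ⟨m, fun x _ hx => h x (hx.trans_lt (by rwa [nabs_pow])) 0⟩
  obtain ⟨u₀, hu₀, hne⟩ := hχ
  have hpos : Nat.find hex ≠ 0 := by
    intro h0
    have h1 := Nat.find_spec hex
    rw [h0] at h1
    refine hne (h1 u₀ hu₀ ?_)
    refine (nabs_sub_le_max _ _).trans ?_
    simp [hu₀]
  obtain ⟨m, hm⟩ := Nat.exists_eq_succ_of_ne_zero hpos
  have hspec := Nat.find_spec hex
  have hmin := Nat.find_min hex (m := m) (by omega)
  rw [hm] at hspec
  refine ⟨(ϖE : E) ^ (m + 1), pow_ne_zero _ ϖE.ne_zero, ?_, hspec, fun c hc => ?_⟩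
  · rw [nabs_pow]
    exact pow_lt_one₀ (nabs_nonneg _) ϖE.nabs_lt_one (by omega)
  · have hc0 : c ≠ 0 := by
      rintro rfl
      rw [nabs_zero] at hc
      exact absurd hc (nabs_nonneg _).not_gt
    simp only [p] at hmin
    push Not at hmin
    obtain ⟨u, hu, hu1, hu2⟩ := hmin
    refine ⟨u, hu, hu1.trans ?_, hu2⟩
    by_contra! hlt
    rw [nabs_lt_iff_le_mul ϖE (pow_ne_zero _ ϖE.ne_zero), ← pow_succ'] at hlt
    exact absurd hc hlt.not_gt

/-- The integral of the unit character over the ball of radius `|c|` around `1` vanishes if the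
radius exceeds the conductor. -/
lemma setIntegral_unitChar_eq_zero {c u : E} (hu : nabs u = 1) (huc : nabs (u - 1) ≤ nabs c)
    (hχ : charExt ϖE χ 0 u ≠ 1) :
    ∫ x in {x : E | nabs x ≤ nabs c}, unitChar ϖE χ (1 + x) ∂μ = 0 := by
  let g : E → ℂ := {x : E | nabs (x - 1) ≤ nabs c}.indicator (unitChar ϖE χ)
  have h1 : ∫ x in {x : E | nabs x ≤ nabs c}, unitChar ϖE χ (1 + x) ∂μ = ∫ x, g x ∂μ := by
    rw [← integral_indicator (measurableSet_nabs_le _), ← integral_add_left_eq_self g 1]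
    refine integral_congr_ae (.of_forall fun x => ?_)
    simp [g, Set.indicator_apply]
  have hu0 := (nabs_eq_one_iff.1 hu).1
  have hinv : ∀ w : E, nabs w = 1 → nabs (w - 1) ≤ nabs c → ∀ x, unitChar ϖE χ x ≠ 0 →
      nabs (x - 1) ≤ nabs c → nabs (w * x - 1) ≤ nabs c := by
    intro w hw hwc x _ hxc
    have : w * x - 1 = w * (x - 1) + (w - 1) := by ring
    rw [this]
    refine (nabs_add_le_max _ _).trans (max_le ?_ hwc)
    rwa [nabs_mul, hw, one_mul]
  have huinv : nabs u⁻¹ = 1 := by rw [nabs_inv, hu, inv_one]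
  have huinvc : nabs (u⁻¹ - 1) ≤ nabs c := by
    have : u⁻¹ - 1 = -(u⁻¹ * (u - 1)) := by field_simp; ring
    rwa [this, nabs_neg, nabs_mul, huinv, one_mul]
  have hg : ∀ x, g (u * x) = charExt ϖE χ 0 u * g x := by
    intro x
    by_cases h0 : unitChar ϖE χ x = 0
    · have h0' : unitChar ϖE χ (u * x) = 0 := by rw [unitChar_mul_left ϖE χ hu, h0, mul_zero]
      simp [g, Set.indicator_apply, h0, h0']
    · have h0' : unitChar ϖE χ (u * x) ≠ 0 := by
        rw [unitChar_mul_left ϖE χ hu]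
        exact mul_ne_zero (charExt_ne_zero ϖE χ 0 hu0) h0
      have hiff : nabs (u * x - 1) ≤ nabs c ↔ nabs (x - 1) ≤ nabs c := by
        refine ⟨fun h => ?_, hinv u hu huc x h0⟩
        have := hinv u⁻¹ huinv huinvc (u * x) h0' h
        rwa [inv_mul_cancel_left₀ hu0] at this
      simp only [g, Set.indicator_apply, Set.mem_ofPred_eq, hiff]
      split_ifs
      · exact unitChar_mul_left ϖE χ hu x
      · simp
  have h2 := integral_mul_left_eq μ hu0 g
  simp_rw [hg] at h2
  rw [integral_const_mul, hu, inv_one, one_smul] at h2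
  rw [h1]
  by_contra hne
  exact hχ (mul_right_cancel₀ hne (h2.trans (one_mul _).symm))

/-- Inside the conductor the integrand is `1`. -/
lemma setIntegral_unitChar_eq {b c : E} (hb1 : nabs b < 1)
    (hb : ∀ x, nabs x = 1 → nabs (x - 1) ≤ nabs b → charExt ϖE χ 0 x = 1) (hc0 : c ≠ 0)
    (hcb : nabs c ≤ nabs b) : ∫ x in {x : E | nabs x ≤ nabs c}, unitChar ϖE χ (1 + x) ∂μ =
      (nabs c * μ.real {x : E | nabs x ≤ 1} : ℝ) := by
  rw [setIntegral_congr_fun (g := fun _ => (1 : ℂ)) (measurableSet_nabs_le _) fun x hx => ?_]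
  · rw [setIntegral_const, measureReal_nabs_le μ hc0, Complex.real_smul, mul_one]
  · have hx' : nabs x ≤ nabs c := hx
    have h1 : nabs (1 + x) = 1 := by
      rw [nabs_add_eq_left (by rw [nabs_one]; exact (hx'.trans hcb).trans_lt hb1), nabs_one]
    simp only [unitChar, h1, if_true]
    exact hb _ h1 (by simpa using hx'.trans hcb)

/-- The integral of `χ(1 + v u)` over the shell `|π b| < |u| ≤ |b|`, as a difference of integrals
over balls. -/
lemma integral_shell_unitChar {b π v : E} (hπ : nabs π < 1) (hv : v ≠ 0) :
    ∫ u, {u : E | nabs u ≤ nabs b ∧ ¬ nabs u ≤ nabs (π * b)}.indicator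
        (fun u => unitChar ϖE χ (1 + v * u)) u ∂μ =
      ((nabs v)⁻¹ : ℝ) • ((∫ x in {x : E | nabs x ≤ nabs (v * b)}, unitChar ϖE χ (1 + x) ∂μ) -
        ∫ x in {x : E | nabs x ≤ nabs (v * (π * b))}, unitChar ϖE χ (1 + x) ∂μ) := by
  have hpv := nabs_pos hv
  let T : Set E := {x : E | nabs x ≤ nabs (v * b)} \ {x : E | nabs x ≤ nabs (v * (π * b))}
  have hT : MeasurableSet T := (measurableSet_nabs_le _).diff (measurableSet_nabs_le _)
  have hsub : {x : E | nabs x ≤ nabs (v * (π * b))} ⊆ {x : E | nabs x ≤ nabs (v * b)} := by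
    intro x (hx : nabs x ≤ _)
    refine hx.trans ?_
    rw [nabs_mul, nabs_mul, nabs_mul, mul_left_comm]
    exact mul_le_of_le_one_left (mul_nonneg hpv.le (nabs_nonneg _)) hπ.le
  have hint (r : ℝ) : IntegrableOn (fun x => unitChar ϖE χ (1 + x)) {x : E | nabs x ≤ r} μ := by
    refine Measure.integrableOn_of_bounded (M := 1) (measure_nabs_le_lt_top μ r).ne
      ((measurable_unitChar ϖE χ).comp (measurable_const_add 1)).aestronglyMeasurable
      (.of_forall fun x => norm_unitChar_le_one ϖE χ _)
  rw [← setIntegral_sdiff (measurableSet_nabs_le _) (hint _) hsub,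
    ← integral_indicator hT, ← integral_mul_left_eq μ hv]
  refine integral_congr_ae (.of_forall fun u => ?_)
  simp only [Set.indicator_apply, T, Set.mem_sdiff, Set.mem_ofPred_eq, nabs_mul v,
    mul_le_mul_iff_right₀ hpv]

end UnitCharacter

section Lines

variable {F E : Type*} [Field F] [ValuativeRel F] [TopologicalSpace F]
  [IsNonarchimedeanLocalField F]
  [Field E] [ValuativeRel E] [TopologicalSpace E] [IsNonarchimedeanLocalField E]
  [Algebra F E] [ValuativeExtension F E] (B : Module.Basis (Fin 2) F E)
  {α : E} {d : F} (hα : α ^ 2 = algebraMap F E d) (hB : ⇑B = ![1, α])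
  [MeasurableSpace E] [BorelSpace E] (μ : Measure E) [μ.IsAddHaarMeasure]
  [MeasurableSpace F] [BorelSpace F] (ν : Measure F) [ν.IsAddHaarMeasure]
  (ϖF : Uniformizer F) (ϖE : Uniformizer E) (χ : PontryaginDual 𝒪[E]ˣ)

/-- The integral of the character `χ` over the part of norm `R` of the affine line `F + α`. -/
noncomputable def lineIntegral (α : E) (R : ℝ) : ℂ :=
  ∫ v : F, {v : F | nabs (algebraMap F E v + α) = R}.indicator
    (fun v => charExt ϖE χ 0 (algebraMap F E v + α)) v ∂ν

include hB in
lemma generator_ne_zero : α ≠ 0 := by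
  have h := B.ne_zero 1
  rwa [hB] at h

include B hB in
lemma lineIntegral_ne_zero_of_trivial (hχ : ∀ u : E, nabs u = 1 → charExt ϖE χ 0 u = 1) :
    lineIntegral ν ϖE χ α (nabs α) ≠ 0 := by
  have hα0 := generator_ne_zero B hB
  have hpos := nabs_pos hα0
  have hone (x : E) (hx : x ≠ 0) : charExt ϖE χ 0 x = 1 :=
    eq_one_of_multiplicative ϖE (charExt_mul ϖE χ 0) (charExt_zero_uniformizer_self ϖE χ) hχ hx
  let A : Set F := {v : F | nabs (algebraMap F E v + α) = nabs α}
  have hA : IsOpen A := (isOpen_nabs_preimage {nabs α} hpos.ne).preimage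
    ((continuous_algebraMap_localField F E).add continuous_const)
  have hA0 : ν A ≠ 0 := (hA.measure_pos ν ⟨0, by simp [A]⟩).ne'
  have hA1 : ν A ≠ ⊤ := by
    refine ((measure_mono fun v (hv : _ = _) => ?_).trans_lt
      (measure_nabs_le_lt_top ν (1 + nabs α))).ne
    have h1 : nabs v ^ 2 ≤ nabs α := by
      rw [← nabs_algebraMap B]
      have := nabs_sub_le_max (algebraMap F E v + α) α
      rwa [add_sub_cancel_right, hv, max_self] at this
    have : nabs v ≤ 1 + nabs α := by nlinarith [sq_nonneg (nabs v - 1)]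
    exact this
  have : lineIntegral ν ϖE χ α (nabs α) = (ν.real A : ℂ) := by
    rw [lineIntegral, integral_indicator hA.measurableSet,
      setIntegral_congr_fun (g := fun _ => (1 : ℂ)) hA.measurableSet fun v hv => ?_]
    · simp
    · refine hone _ fun h0 => ?_
      have hv' : nabs (algebraMap F E v + α) = nabs α := hv
      rw [h0, nabs_zero] at hv'
      exact hpos.ne hv'
  rw [this]
  exact_mod_cast (ENNReal.toReal_pos hA0 hA1).ne'

include B hB in
/-- A line through `1` that is not contained in `F` is, up to a factor, a translate of
`F + α`, so the integral of a character over its units is a `lineIntegral`. -/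
lemma integral_unitChar_one_add_mul {u : E} (hu0 : u ≠ 0) (hu : B.repr u⁻¹ 1 ≠ 0) :
    ∃ (R : ℝ) (c : ℂ), 0 < R ∧
      ∫ v : F, unitChar ϖE χ (1 + algebraMap F E v * u) ∂ν = c * lineIntegral ν ϖE χ α R := by
  set a : F := B.repr u⁻¹ 0
  set β : F := B.repr u⁻¹ 1
  have hui : u⁻¹ = algebraMap F E a + algebraMap F E β * α := eq_add_mul B hB _
  have hβ : algebraMap F E β ≠ 0 := by simpa using hu
  have hw : u * algebraMap F E β ≠ 0 := mul_ne_zero hu0 hβ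
  let g : F → ℂ := {v : F | nabs (algebraMap F E v + α) = (nabs (u * algebraMap F E β))⁻¹}.indicator
    (fun v => charExt ϖE χ 0 (algebraMap F E v + α))
  refine ⟨(nabs (u * algebraMap F E β))⁻¹, charExt ϖE χ 0 (u * algebraMap F E β) *
    ((nabs β : ℝ) : ℂ), inv_pos.2 (nabs_pos hw), ?_⟩
  have h1 (v : F) : unitChar ϖE χ (1 + algebraMap F E v * u) =
      charExt ϖE χ 0 (u * algebraMap F E β) * g (β⁻¹ * (v + a)) := by
    have h2 : 1 + algebraMap F E v * u =
        u * algebraMap F E β * (algebraMap F E (β⁻¹ * (v + a)) + α) := by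
      rw [map_mul, map_inv₀, map_add]
      have : (1 : E) = u * u⁻¹ := (mul_inv_cancel₀ hu0).symm
      rw [this, hui]
      field_simp
      ring
    have h3 : nabs (u * algebraMap F E β * (algebraMap F E (β⁻¹ * (v + a)) + α)) = 1 ↔
        nabs (algebraMap F E (β⁻¹ * (v + a)) + α) = (nabs (u * algebraMap F E β))⁻¹ := by
      rw [nabs_mul, mul_comm, mul_eq_one_iff_eq_inv₀ (nabs_pos hw).ne']
    rw [h2, unitChar, charExt_mul]
    simp only [g, Set.indicator_apply, Set.mem_ofPred_eq, h3]
    split_ifs <;> simp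
  simp_rw [h1]
  rw [integral_const_mul, integral_add_right_eq_self (fun v => g (β⁻¹ * v)) a,
    integral_mul_left_eq ν (inv_ne_zero hu), nabs_inv, inv_inv, Complex.real_smul, mul_assoc]
  rfl

include B in
/-- For a character of conductor `b`, the integral of `χ(1 + v u)` over the shell
`|ϖ b| < |u| ≤ |b|`, where `v ∈ F^×`. It vanishes for `|v| > q`. -/
lemma integral_shell_unitChar_algebraMap {b : E} (hb0 : b ≠ 0) (hb1 : nabs b < 1)
    (hb : ∀ x, nabs x = 1 → nabs (x - 1) ≤ nabs b → charExt ϖE χ 0 x = 1)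
    (hc : ∀ c : E, nabs b < nabs c →
      ∃ u : E, nabs u = 1 ∧ nabs (u - 1) ≤ nabs c ∧ charExt ϖE χ 0 u ≠ 1) {v : F} (hv : v ≠ 0) :
    ∫ u, {u : E | nabs u ≤ nabs b ∧ ¬ nabs u ≤ nabs (algebraMap F E (ϖF : F) * b)}.indicator
        (fun u => unitChar ϖE χ (1 + algebraMap F E v * u)) u ∂μ =
      ((nabs b * μ.real {x : E | nabs x ≤ 1} *
        ({v : F | nabs v ≤ 1}.indicator (fun _ => (1 : ℝ)) v -
          ((resCard F : ℝ) ^ 2)⁻¹ *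
            {v : F | nabs v ≤ nabs (ϖF : F)⁻¹}.indicator (fun _ => (1 : ℝ)) v) : ℝ) : ℂ) := by
  have hq := one_lt_resCard_real F
  have hπ : nabs (algebraMap F E (ϖF : F)) = ((resCard F : ℝ) ^ 2)⁻¹ := by
    rw [nabs_algebraMap B, ϖF.nabs_eq, inv_pow]
  have hπ1 : nabs (algebraMap F E (ϖF : F)) < 1 := by
    rw [hπ]
    exact inv_lt_one_of_one_lt₀ (by nlinarith)
  have hv' : algebraMap F E v ≠ 0 := by simpa using hv
  have hbpos := nabs_pos hb0
  have hvpos := nabs_pos hv'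
  have hπ0 : algebraMap F E (ϖF : F) ≠ 0 := by simpa using ϖF.ne_zero
  have hD (c : E) (hc0 : c ≠ 0) : ∫ x in {x : E | nabs x ≤ nabs (c * b)}, unitChar ϖE χ (1 + x) ∂μ
      = ((nabs (c * b) * μ.real {x : E | nabs x ≤ 1} *
        {c : E | nabs c ≤ 1}.indicator (fun _ => (1 : ℝ)) c : ℝ) : ℂ) := by
    by_cases hc1 : nabs c ≤ 1
    · rw [setIntegral_unitChar_eq μ ϖE χ hb1 hb (mul_ne_zero hc0 hb0)
        (by rw [nabs_mul]; exact mul_le_of_le_one_left hbpos.le hc1)]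
      simp [hc1]
    · obtain ⟨u, h1, h2, h3⟩ := hc (c * b)
        (by rw [nabs_mul]; exact lt_mul_of_one_lt_left hbpos (not_le.1 hc1))
      rw [setIntegral_unitChar_eq_zero μ ϖE χ h1 h2 h3]
      simp [hc1]
  rw [integral_shell_unitChar μ ϖE χ hπ1 hv', hD _ hv', ← mul_assoc, hD _ (mul_ne_zero hv' hπ0),
    ← Complex.ofReal_sub, Complex.real_smul, ← Complex.ofReal_mul]
  congr 1
  have e1 : {c : E | nabs c ≤ 1}.indicator (fun _ => (1 : ℝ)) (algebraMap F E v) =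
      {v : F | nabs v ≤ 1}.indicator (fun _ => (1 : ℝ)) v := by
    have : nabs (algebraMap F E v) ≤ 1 ↔ nabs v ≤ 1 := by
      have := nabs_algebraMap_le_iff (F := F) (E := E) (a := v) (b := 1)
      simpa using this
    simp only [Set.indicator_apply, Set.mem_ofPred_eq, this]
  have e2 : {c : E | nabs c ≤ 1}.indicator (fun _ => (1 : ℝ))
      (algebraMap F E v * algebraMap F E (ϖF : F)) =
      {v : F | nabs v ≤ nabs (ϖF : F)⁻¹}.indicator (fun _ => (1 : ℝ)) v := by
    have : nabs (algebraMap F E v * algebraMap F E (ϖF : F)) ≤ 1 ↔ nabs v ≤ nabs (ϖF : F)⁻¹ := by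
      have := nabs_algebraMap_le_iff (F := F) (E := E) (a := v * ϖF) (b := 1)
      rw [map_one, nabs_one, map_mul, nabs_mul v, nabs_one] at this
      rw [this, nabs_inv, ← one_div, le_div_iff₀ (nabs_pos ϖF.ne_zero)]
    simp only [Set.indicator_apply, Set.mem_ofPred_eq, this]
  rw [e1, e2, nabs_mul, nabs_mul, nabs_mul (algebraMap F E v), hπ]
  field_simp

include hα hB in
/-- **Non-vanishing of line integrals.** For every character of the units of `E`, one of its
integrals over the spheres in the line `F + α` is different from `0`. Otherwise, by Fubini, the
integral over `v ∈ F` of `∫_S χ(1 + v u) du` would vanish, where `S` is a shell just inside the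
conductor; but it is a positive number. -/
lemma exists_lineIntegral_ne_zero : ∃ R : ℝ, 0 < R ∧ lineIntegral ν ϖE χ α R ≠ 0 := by
  by_cases hχ : ∀ u : E, nabs u = 1 → charExt ϖE χ 0 u = 1
  · exact ⟨_, nabs_pos (generator_ne_zero B hB), lineIntegral_ne_zero_of_trivial B hB ν ϖE χ hχ⟩
  push Not at hχ
  obtain ⟨b, hb0, hb1, hb, hc⟩ := exists_conductor ϖE χ hχ
  obtain ⟨ϖF⟩ := exists_uniformizer F
  let μ : Measure E := Measure.addHaar
  by_contra! hcon
  have hq := one_lt_resCard_real F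
  let S : Set E := {u : E | nabs u ≤ nabs b ∧ ¬ nabs u ≤ nabs (algebraMap F E (ϖF : F) * b)}
  have hS : MeasurableSet S := (measurableSet_nabs_le _).inter (measurableSet_nabs_le _).compl
  -- on the support `|v|² |u| ≤ 1`, so the integrand is bounded with bounded support
  let Ψ : F → E → ℂ := fun v u => S.indicator (fun u => unitChar ϖE χ (1 + algebraMap F E v * u)) u
  have hπb : 0 < nabs (algebraMap F E (ϖF : F) * b) :=
    nabs_pos (mul_ne_zero (by simpa using ϖF.ne_zero) hb0)
  have hΨ : Integrable (Function.uncurry Ψ) (ν.prod μ) := by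
    let Z : Set (F × E) := {v : F | nabs v ≤ 1 + (nabs (algebraMap F E (ϖF : F) * b))⁻¹} ×ˢ
      {u : E | nabs u ≤ nabs b}
    have hZ : (ν.prod μ) Z < ⊤ := by
      rw [Measure.prod_prod]
      exact ENNReal.mul_lt_top (measure_nabs_le_lt_top ν _) (measure_nabs_le_lt_top μ _)
    have hmeas : Measurable (Function.uncurry Ψ) := by
      have : Function.uncurry Ψ = (Prod.snd ⁻¹' S).indicator
          (fun z : F × E => unitChar ϖE χ (1 + algebraMap F E z.1 * z.2)) := by
        ext ⟨v, u⟩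
        by_cases huS : u ∈ S <;> simp [Ψ, Function.uncurry, huS]
      rw [this]
      refine Measurable.indicator ((measurable_unitChar ϖE χ).comp ?_) (measurable_snd hS)
      have : Continuous fun z : F × E => 1 + algebraMap F E z.1 * z.2 :=
        continuous_const.add (((continuous_algebraMap_localField F E).comp continuous_fst).mul
          continuous_snd)
      exact this.measurable
    have hsupp : Function.support (Function.uncurry Ψ) ⊆ Z := by
      rintro ⟨v, u⟩ h
      have huS : u ∈ S := by
        by_contra huS
        exact h (by simp [Ψ, Function.uncurry, huS])
      have hone : nabs (1 + algebraMap F E v * u) = 1 := by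
        by_contra hne
        exact h (by simp [Ψ, Function.uncurry, unitChar, hne])
      have h1 : nabs (algebraMap F E v) * nabs u ≤ 1 := by
        rw [← nabs_mul]
        have := nabs_sub_le_max (1 + algebraMap F E v * u) 1
        rwa [add_sub_cancel_left, hone, nabs_one, max_self] at this
      rw [nabs_algebraMap B] at h1
      refine ⟨?_, huS.1⟩
      have h2 : nabs v ^ 2 ≤ (nabs (algebraMap F E (ϖF : F) * b))⁻¹ := by
        rw [← one_div, le_div_iff₀ hπb]
        exact (mul_le_mul_of_nonneg_left (not_le.1 huS.2).le (sq_nonneg _)).trans h1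
      have : nabs v ≤ 1 + (nabs (algebraMap F E (ϖF : F) * b))⁻¹ := by
        nlinarith [sq_nonneg (nabs v - 1)]
      exact this
    rw [← integrableOn_iff_integrable_of_support_subset hsupp]
    refine Measure.integrableOn_of_bounded (M := 1) hZ.ne hmeas.aestronglyMeasurable
      (.of_forall fun z => ?_)
    simp only [Function.uncurry, Ψ, Set.indicator_apply]
    split_ifs
    · exact norm_unitChar_le_one ϖE χ _
    · simp
  have hswap := integral_integral_swap hΨ
  have hright : ∫ u, ∫ v, Ψ v u ∂ν ∂μ = 0 := by
    refine integral_eq_zero_of_ae ?_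
    filter_upwards [ae_repr_one_ne_zero B μ] with u hu
    by_cases huS : u ∈ S
    · have hu0 : u ≠ 0 := by rintro rfl; simp at hu
      obtain ⟨R, c, hR, h⟩ := integral_unitChar_one_add_mul B hB ν ϖE χ hu0 (by
        rw [repr_inv_one B hα hB]
        exact neg_ne_zero.2 (div_ne_zero hu (normForm_ne_zero B hα hB hu0)))
      simp [Ψ, huS, h, hcon R hR]
    · simp [Ψ, huS]
  have hleft : ∫ v, ∫ u, Ψ v u ∂μ ∂ν = ((nabs b * μ.real {x : E | nabs x ≤ 1} *
      (ν.real {v : F | nabs v ≤ 1} * (1 - (resCard F : ℝ)⁻¹)) : ℝ) : ℂ) := by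
    have h1 : (fun v => ∫ u, Ψ v u ∂μ) =ᵐ[ν] fun v =>
        ((nabs b * μ.real {x : E | nabs x ≤ 1} *
        ({v : F | nabs v ≤ 1}.indicator (fun _ => (1 : ℝ)) v -
          ((resCard F : ℝ) ^ 2)⁻¹ *
            {v : F | nabs v ≤ nabs (ϖF : F)⁻¹}.indicator (fun _ => (1 : ℝ)) v) : ℝ) : ℂ) := by
      filter_upwards [ae_ne_zero ν] with v hv
      exact integral_shell_unitChar_algebraMap B μ ϖF ϖE χ hb0 hb1 hb hc hv
    have hi (r : ℝ) : Integrable ({v : F | nabs v ≤ r}.indicator (fun _ => (1 : ℝ))) ν :=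
      (integrable_indicator_iff (measurableSet_nabs_le r)).2
        (integrableOn_const (measure_nabs_le_lt_top ν r).ne)
    rw [integral_congr_ae h1, integral_complex_ofReal, integral_const_mul,
      integral_sub (hi _) ((hi _).const_mul _), integral_const_mul,
      integral_indicator (measurableSet_nabs_le _), integral_indicator (measurableSet_nabs_le _),
      setIntegral_const, setIntegral_const, measureReal_nabs_le ν (inv_ne_zero ϖF.ne_zero),
      nabs_inv, ϖF.nabs_eq, inv_inv]
    congr 2
    simp only [smul_eq_mul, mul_one]
    field_simp
  rw [hright, hleft, Complex.ofReal_eq_zero] at hswap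
  have h1 := nabs_pos hb0
  have h2 := measureReal_integer_pos μ
  have h3 := measureReal_integer_pos ν
  have h4 : (resCard F : ℝ)⁻¹ < 1 := inv_lt_one_of_one_lt₀ hq
  exact (mul_pos (mul_pos h1 h2) (mul_pos h3 (sub_pos.2 h4))).ne' hswap

end Lines

/-! ### Isolating a fibre by moments -/

lemma indicator_mem_testFunction {X : Type*} [TopologicalSpace X] [R1Space X] {W : Set X} (hW : IsClopen W)
    (hc : IsCompact W) : W.indicator (fun _ => (1 : ℂ)) ∈ TestFunction X := by
  refine ⟨?_, HasCompactSupport.of_support_subset_isCompact hc Set.support_indicator_subset⟩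
  have h := (LocallyConstant.charFn ℂ hW).isLocallyConstant
  exact h

open Polynomial in
/-- If all moments of a bounded function `h` with respect to the complex measure `g μ` vanish, then
so do the integrals of all continuous functions of `h`, by the Weierstrass approximation
theorem. -/
lemma integral_mul_comp_eq_zero {X : Type*} [MeasurableSpace X] {μ : Measure X} {g : X → ℂ}
    {h : X → ℝ} {C : ℝ} (hg : Integrable g μ) (hh : Measurable h) (hC : ∀ x, h x ∈ Set.Icc 0 C)
    (hz : ∀ n : ℕ, ∫ x, g x * (h x : ℂ) ^ n ∂μ = 0) {Φ : ℝ → ℝ} (hΦ : Continuous Φ) :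
    ∫ x, g x * (Φ (h x) : ℂ) ∂μ = 0 := by
  have hint {Ψ : ℝ → ℝ} (hΨ : Continuous Ψ) : Integrable (fun x => g x * (Ψ (h x) : ℂ)) μ := by
    obtain ⟨M, hM⟩ := (isCompact_Icc (a := 0) (b := C)).exists_bound_of_continuousOn
      hΨ.continuousOn
    refine hg.mul_bdd (c := M) ?_ (.of_forall fun x => ?_)
    · exact (Complex.measurable_ofReal.comp (hΨ.measurable.comp hh)).aestronglyMeasurable
    · rw [Complex.norm_real]; exact hM _ (hC x)
  have hpoly (P : ℝ[X]) : ∫ x, g x * ((P.eval (h x) : ℝ) : ℂ) ∂μ = 0 := by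
    have h1 (x : X) : g x * ((P.eval (h x) : ℝ) : ℂ) =
        ∑ i ∈ Finset.range (P.natDegree + 1), (P.coeff i : ℂ) * (g x * (h x : ℂ) ^ i) := by
      rw [eval_eq_sum_range, Complex.ofReal_sum, Finset.mul_sum]
      refine Finset.sum_congr rfl fun i _ => ?_
      push_cast; ring
    simp_rw [h1]
    rw [integral_finsetSum]
    · refine Finset.sum_eq_zero fun i _ => ?_
      rw [integral_const_mul, hz, mul_zero]
    · intro i _
      have := hint (continuous_pow i)
      simp only [Complex.ofReal_pow] at this
      exact this.const_mul _
  have hle (ε : ℝ) (hε : 0 < ε) : ‖∫ x, g x * (Φ (h x) : ℂ) ∂μ‖ ≤ ε * ∫ x, ‖g x‖ ∂μ := by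
    obtain ⟨P, hP⟩ := exists_polynomial_near_of_continuousOn 0 C Φ hΦ.continuousOn ε hε
    rw [← sub_zero (∫ x, g x * (Φ (h x) : ℂ) ∂μ), ← hpoly P,
      ← integral_sub (hint hΦ) (hint P.continuous), ← integral_const_mul]
    refine norm_integral_le_of_norm_le (hg.norm.const_mul ε) (.of_forall fun x => ?_)
    rw [← mul_sub, norm_mul, mul_comm, ← Complex.ofReal_sub, Complex.norm_real]
    refine mul_le_mul_of_nonneg_right ?_ (norm_nonneg _)
    rw [Real.norm_eq_abs, abs_sub_comm]
    exact (hP _ (hC x)).le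
  by_contra hne
  have hpos := norm_pos_iff.2 hne
  have hI : 0 ≤ ∫ x, ‖g x‖ ∂μ := integral_nonneg fun _ => norm_nonneg _
  have h2 := hle (‖∫ x, g x * (Φ (h x) : ℂ) ∂μ‖ / (2 * (1 + ∫ x, ‖g x‖ ∂μ))) (by positivity)
  rw [div_mul_eq_mul_div, le_div_iff₀ (by positivity)] at h2
  nlinarith

/-- On the values of `nabs`, the indicator function of `nabs w` is the restriction of a continuous
function. -/
lemma exists_continuous_isolating {K : Type*} [Field K] [ValuativeRel K] [TopologicalSpace K]
    [IsNonarchimedeanLocalField K] {w : K} (hw : w ≠ 0) : ∃ Φ : ℝ → ℝ, Continuous Φ ∧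
      ∀ x : K, Φ (nabs x) = {x : K | nabs x = nabs w}.indicator (fun _ => 1) x := by
  obtain ⟨ϖ⟩ := exists_uniformizer K
  have hwpos := nabs_pos hw
  have hq := one_lt_resCard_real K
  set δ := nabs w * (1 - nabs (ϖ : K)) with hδ
  have hϖ := ϖ.nabs_lt_one
  have hϖ0 := nabs_pos ϖ.ne_zero
  have hδ0 : 0 < δ := mul_pos hwpos (sub_pos.2 hϖ)
  refine ⟨fun r => max 0 (1 - |r - nabs w| / δ), by fun_prop, fun x => ?_⟩
  by_cases hx : nabs x = nabs w
  · simp [hx]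
  · rw [Set.indicator_of_notMem (by exact hx)]
    refine max_eq_left ?_
    rw [sub_nonpos, one_le_div hδ0]
    rcases lt_or_gt_of_ne hx with h | h
    · rw [nabs_lt_iff_le_mul ϖ hw, nabs_mul] at h
      rw [abs_of_nonpos (by nlinarith)]
      linarith
    · have hx0 : x ≠ 0 := by
        rintro rfl
        rw [nabs_zero] at h
        exact hwpos.not_gt h
      rw [nabs_lt_iff_le_mul ϖ hx0, nabs_mul] at h
      have h3 : nabs w * 1 ≤ nabs x := by nlinarith [nabs_pos hx0]
      rw [abs_of_nonneg (by linarith), hδ]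
      nlinarith

section Fibre

variable {F E : Type*} [Field F] [ValuativeRel F] [TopologicalSpace F]
  [IsNonarchimedeanLocalField F]
  [Field E] [ValuativeRel E] [TopologicalSpace E] [IsNonarchimedeanLocalField E]
  [Algebra F E] [ValuativeExtension F E] (B : Module.Basis (Fin 2) F E)
  {α : E} {d : F} (hα : α ^ 2 = algebraMap F E d) (hB : ⇑B = ![1, α])
  [MeasurableSpace E] [BorelSpace E] (μ : Measure E) [μ.IsAddHaarMeasure]
  [MeasurableSpace F] [BorelSpace F] (ν : Measure F) [ν.IsAddHaarMeasure]
  (ϖF : Uniformizer F) (ϖE : Uniformizer E) (χ : PontryaginDual 𝒪[E]ˣ) (η : PontryaginDual 𝒪[F]ˣ)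

include hB in
/-- Integration in the coordinates `x = y (v + α)`. -/
lemma exists_integral_eq_slope : ∃ c : NNReal, c ≠ 0 ∧ ∀ h : E → ℂ, Integrable h μ →
    ∫ x, h x ∂μ = c • ∫ y, ∫ v, (nabs y : ℂ) *
      h (algebraMap F E y * (algebraMap F E v + α)) ∂ν ∂ν := by
  obtain ⟨c, hc0, hc⟩ := exists_haar_eq_smul_prod B μ ν
  refine ⟨c, hc0, fun h hh => ?_⟩
  have hi : Integrable (fun z => h (coordHomeo B z)) (ν.prod ν) := by
    rw [hc] at hh
    have := (integrable_smul_measure (by simpa using hc0) ENNReal.coe_ne_top).1 hh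
    exact ((measurableEmbedding_coordHomeo B).integrable_map_iff).1 this
  rw [hc, integral_smul_nnreal_measure, (measurableEmbedding_coordHomeo B).integral_map,
    integral_prod_symm _ hi]
  congr 1
  refine integral_congr_ae ?_
  filter_upwards [ae_ne_zero ν] with y hy
  have h1 := integral_mul_left_eq ν hy fun v => h (coordHomeo B (v, y))
  have h2 (v : F) : h (algebraMap F E y * (algebraMap F E v + α)) =
      h (coordHomeo B (y * v, y)) := by
    congr 1
    rw [coordHomeo_apply, hB]
    simp [Algebra.smul_def]
    ring
  simp_rw [h2]
  rw [integral_const_mul, h1, Complex.real_smul, ← mul_assoc, Complex.ofReal_inv, mul_inv_cancel₀,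
    one_mul]
  exact_mod_cast (nabs_pos hy).ne'

/-- The quotient `ξ = x₂ / x̄ = x (x₂ / N(x))`. For `x = y (v + α)` with `y, v ∈ F` it is equal to
`(v - α)⁻¹`, and it vanishes on the line `F`. -/
noncomputable def invSlope (d : F) (x : E) : E := x * algebraMap F E (B.repr x 1 / normForm B d x)

include hα hB in
lemma nabs_invSlope (x : E) : nabs (invSlope B d x) = nabs (B.repr x 1) ^ 2 * (nabs x)⁻¹ := by
  by_cases hx : x = 0
  · simp [invSlope, hx]
  have := nabs_pos hx
  rw [invSlope, nabs_mul, nabs_algebraMap B, nabs_div, nabs_normForm B hα hB]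
  field_simp

include hα hB in
lemma invSlope_mul {y : F} (hy : y ≠ 0) (v : F) :
    invSlope B d (algebraMap F E y * (algebraMap F E v + α)) = (algebraMap F E v - α)⁻¹ := by
  have hy' : algebraMap F E y ≠ 0 := by simpa using hy
  have h0 : B.repr (algebraMap F E v + α) 0 = v := by
    simpa using repr_add_mul B hB v 1 0
  have h1 : B.repr (algebraMap F E v + α) 1 = 1 := by
    simpa using repr_add_mul B hB v 1 1
  have hne : algebraMap F E v + α ≠ 0 := by
    intro h
    rw [h] at h1
    simp at h1
  have hc : conjugate B α (algebraMap F E v + α) = algebraMap F E v - α := by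
    rw [conjugate, h0, h1, map_one, one_mul]
  have hN := mul_conjugate B hα hB (algebraMap F E v + α)
  rw [hc] at hN
  rw [invSlope, normForm_algebraMap_mul, repr_algebraMap_mul, h1, mul_one, map_div₀, map_mul,
    map_pow, ← hN]
  have hc0 : algebraMap F E v - α ≠ 0 := by
    rw [← hc]
    exact fun h => hne ((conjugate_eq_zero B hα hB).1 h)
  field_simp

lemma measurable_nabs_invSlope : Measurable fun x : E => nabs (invSlope B d x) := by
  borelize F
  have h1 : Measurable fun x : E => B.repr x 1 := (continuous_repr B 1).measurable
  have h2 : Measurable fun x : E => normForm B d x := (continuous_normForm B).measurable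
  have h3 : Measurable fun x : E => nabs x * nabs (B.repr x 1) ^ 2 *
      (nabs (normForm B d x) ^ 2)⁻¹ :=
    (continuous_nabs.measurable.mul ((continuous_nabs.measurable.comp h1).pow_const 2)).mul
      ((continuous_nabs.measurable.comp h2).pow_const 2).inv
  convert h3 using 2 with x
  rw [invSlope, nabs_mul, nabs_algebraMap B, nabs_div, div_pow]
  ring

omit [MeasurableSpace E] [BorelSpace E] [MeasurableSpace F] [BorelSpace F] in
/-- Along a line on which all dilation factors are `1`, the kernel depends on the parameter only
through a power of `|ξ|`, where `ξ = x₂ / x̄`. -/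
lemma kernel_eq_of_dilFactor_eq_one {z : ℂ × ℂ}
    (hz : ∀ a : F, a ≠ 0 → dilFactor ϖF ϖE χ η a z = 1) {n : ℕ} (hn : 2 * (z.1 - 1 / 2) = n)
    (x : E) : kernel ϖF ϖE B d χ η z.1 z.2 x = charExt ϖE χ 0 (invSlope B d x) ^ 2 *
      (nabs (algebraMap F E (B.repr x 1 / normForm B d x)) : ℂ) *
        (nabs (invSlope B d x) : ℂ) ^ n := by
  rw [kernel_eq]
  by_cases hy : B.repr x 1 / normForm B d x = 0
  · simp [hy, invSlope]
  set y := B.repr x 1 / normForm B d x with hydef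
  have hx : x ≠ 0 := by
    rintro rfl
    simp [hydef] at hy
  have hη := charExt_ne_zero ϖF η (z.2 + 1 / 2) hy
  have h1 : charExt ϖF η (z.2 + 1 / 2) y =
      nabs (algebraMap F E y) * charExt ϖE χ (z.1 - 1 / 2) (algebraMap F E y) := by
    have := hz y hy
    rw [dilFactor] at this
    exact ((mul_inv_eq_one₀ hη).1 this).symm
  have hξ : invSlope B d x ≠ 0 := mul_ne_zero hx ((map_ne_zero _).2 hy)
  have h2 : charExt ϖE χ (z.1 - 1 / 2) (invSlope B d x) ^ 2 = charExt ϖE χ 0 (invSlope B d x) ^ 2 *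
      (nabs (invSlope B d x) : ℂ) ^ n := by
    rw [charExt_eq_mul_cpow _ _ _ hξ, mul_pow, ← Complex.cpow_natCast _ n, ← hn,
      ← Complex.cpow_nat_mul]
    norm_num
  have h3 : charExt ϖE χ (z.1 - 1 / 2) (invSlope B d x) =
      charExt ϖE χ (z.1 - 1 / 2) x * charExt ϖE χ (z.1 - 1 / 2) (algebraMap F E y) := by
    rw [invSlope, charExt_mul]
  rw [h1, charExt_pow, mul_right_comm, ← h2, h3]
  ring

end Fibre

/-! ### Non-vanishing on the lines in `//` -/

section NonVanishing

variable {F E : Type*} [Field F] [ValuativeRel F] [TopologicalSpace F]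
  [IsNonarchimedeanLocalField F]
  [Field E] [ValuativeRel E] [TopologicalSpace E] [IsNonarchimedeanLocalField E]
  [Algebra F E] [ValuativeExtension F E] (B : Module.Basis (Fin 2) F E)
  {α : E} {d : F} (hα : α ^ 2 = algebraMap F E d) (hB : ⇑B = ![1, α])
  [MeasurableSpace E] [BorelSpace E] (μ : Measure E) [μ.IsAddHaarMeasure]
  [MeasurableSpace F] [BorelSpace F] (ν : Measure F) [ν.IsAddHaarMeasure]
  (ϖF : Uniformizer F) (ϖE : Uniformizer E) (χ : PontryaginDual 𝒪[E]ˣ) (η : PontryaginDual 𝒪[F]ˣ)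

omit [MeasurableSpace E] [BorelSpace E] in
lemma charExt_inv_sq (x : E) : charExt ϖE (χ ^ 2)⁻¹ 0 x = charExt ϖE χ 0 x⁻¹ ^ 2 := by
  by_cases hx : x = 0
  · simp [hx]
  rw [charExt_inv, charExt_of_ne_zero ϖE χ _ hx, charExt_of_ne_zero ϖE _ _ hx]
  have h : (((χ ^ 2)⁻¹ : PontryaginDual 𝒪[E]ˣ) (unitPart ϖE x hx)) =
      (χ (unitPart ϖE x hx) ^ 2)⁻¹ := rfl
  rw [h]
  simp

/-- The line integral over `F - α` instead of `F + α`. -/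
lemma lineIntegral_neg (R : ℝ) : ∫ v : F, {v : F | nabs (algebraMap F E v - α) = R}.indicator
    (fun v => charExt ϖE χ 0 (algebraMap F E v - α)) v ∂ν =
      charExt ϖE χ 0 (-1) * lineIntegral ν ϖE χ α R := by
  rw [← integral_neg_eq_self, lineIntegral, ← integral_const_mul]
  refine integral_congr_ae (.of_forall fun v => ?_)
  have h : algebraMap F E (-v) - α = -1 * (algebraMap F E v + α) := by rw [map_neg]; ring
  simp only [Set.indicator_apply, Set.mem_ofPred_eq, h, charExt_mul, nabs_mul, nabs_neg, nabs_one,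
    one_mul]
  split_ifs <;> simp

/-- The coordinate box `|x₁| ≤ T`, `|x₂| ≤ 1` in `E`. -/
def coordBox (T : ℝ) : Set E := {x | nabs (B.repr x 0) ≤ T ∧ nabs (B.repr x 1) ≤ 1}

lemma indicator_coordBox_mem_testFunction {T : ℝ} (hT : 0 < T) :
    (coordBox B T).indicator (fun _ => (1 : ℂ)) ∈ TestFunction E := by
  have h0 := continuous_repr B 0
  have h1 := continuous_repr B 1
  refine indicator_mem_testFunction ⟨?_, ?_⟩ ?_
  · exact ((isClosed_nabs_le T).preimage h0).inter ((isClosed_nabs_le 1).preimage h1)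
  · exact ((isOpen_nabs_le hT).preimage h0).inter ((isOpen_nabs_le one_pos).preimage h1)
  · have h : coordBox B T = (coordHomeo B).symm ⁻¹'
        ({x : F | nabs x ≤ T} ×ˢ {x : F | nabs x ≤ 1}) := by
      ext x
      simp [coordBox, coordHomeo_symm_apply]
    rw [h, (coordHomeo B).symm.isCompact_preimage]
    exact (isCompact_nabs_le T).prod (isCompact_nabs_le 1)

include hB in
/-- On the rays `F (v + α)` with `|v| ≤ T`, the dilation difference of the box is the indicator
function of `|x₂| = 1`. -/
lemma dilDiff_coordBox {T : ℝ} {v : F} (hv : nabs v ≤ T) (y : F) :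
    dilDiff (ϖF : F) ((coordBox B T).indicator fun _ => (1 : ℂ))
      (algebraMap F E y * (algebraMap F E v + α)) =
      {y : F | nabs y = 1}.indicator (fun _ => 1) y := by
  have h0 : B.repr (algebraMap F E v + α) 0 = v := by
    simpa using repr_add_mul B hB v 1 0
  have h1 : B.repr (algebraMap F E v + α) 1 = 1 := by
    simpa using repr_add_mul B hB v 1 1
  have hmem (y : F) : algebraMap F E y * (algebraMap F E v + α) ∈ coordBox B T ↔ nabs y ≤ 1 := by
    simp only [coordBox, Set.mem_ofPred_eq, repr_algebraMap_mul, h0, h1, mul_one, nabs_mul]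
    refine and_iff_right_of_imp fun hy => ?_
    exact (mul_le_of_le_one_left (nabs_nonneg v) hy).trans hv
  have h2 : algebraMap F E (ϖF : F)⁻¹ * (algebraMap F E y * (algebraMap F E v + α)) =
      algebraMap F E ((ϖF : F)⁻¹ * y) * (algebraMap F E v + α) := by
    rw [map_mul]; ring
  have h3 : nabs ((ϖF : F)⁻¹ * y) ≤ 1 ↔ nabs y < 1 := by
    have := nabs_lt_iff_le_mul ϖF (x := y) (one_ne_zero (α := F))
    rw [nabs_one, mul_one] at this
    rw [this, nabs_mul, nabs_inv, inv_mul_le_iff₀ (nabs_pos ϖF.ne_zero), mul_one]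
  classical
  rw [dilDiff, h2]
  simp only [Set.indicator_apply, hmem, h3, Set.mem_ofPred_eq]
  rcases lt_trichotomy (nabs y) 1 with h | h | h
  · simp [h, h.le, h.ne]
  · simp [h]
  · simp [h.not_ge, h.not_gt, h.ne']

include hα hB in
/-- For test functions vanishing at `0`, the kernel is integrable in a larger domain. -/
lemma integrable_kernel_mul {ψ : E → ℂ} (hψ : ψ ∈ TestFunction E) (h0 : ψ 0 = 0) (p : ℂ × ℂ)
    (hp : 0 < (2 * p.1 + p.2 + 1 / 2).re) :
    Integrable (fun x => kernel ϖF ϖE B d χ η p.1 p.2 x * ψ x) μ := by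
  have hθ := ((IsTestFamily.of_testFunction hψ).smoothPart_mul B hα hB ϖF ϖE χ η
    (by funext p; exact h0)).mem_testFunction p
  have := integrable_mul_testFunction hθ
    (locallyIntegrable_restrChar_repr B μ ϖF ϖE χ η p.1 p.2 hp)
  refine this.congr (.of_forall fun x => ?_)
  simp only [kernel_eq_smoothPart_mul]
  ring

omit [MeasurableSpace F] [BorelSpace F] in
include hα hB in
/-- On a line where all dilation factors are `1`, the pairings of the kernel with differences
`φ - φ(ϖ⁻¹ ·)` do not vanish identically. Otherwise all moments of the function `|ξ|`, `ξ = x₂ / x̄`,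
with respect to such a pairing would vanish, and thus the integral over each of its fibres; but for
a suitable `φ` such an integral is a multiple of a `lineIntegral`. -/
lemma exists_integral_kernel_ne_zero {p : ℂ × ℂ}
    (hp : ∀ a : F, a ≠ 0 → ∀ h : ℂ, dilFactor ϖF ϖE χ η a (p + h • (1, 2)) = 1) :
    ∃ ψ ∈ TestFunction E, ∃ h : ℂ, 0 < (linPlus (p + h • (1, 2)) + 1 / 2).re ∧
      ∫ x, kernel ϖF ϖE B d χ η (p + h • (1, 2)).1 (p + h • (1, 2)).2 x *
        dilDiff (ϖF : F) ψ x ∂μ ≠ 0 := by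
  borelize F
  let ν : Measure F := Measure.addHaar
  obtain ⟨R, hR, hline⟩ := exists_lineIntegral_ne_zero B hα hB ν ϖE (χ ^ 2)⁻¹
  have hv₀ : ∃ v₀ : F, nabs (algebraMap F E v₀ - α) = R := by
    by_contra! hno
    have h1 := lineIntegral_neg (α := α) ν ϖE (χ ^ 2)⁻¹ R
    have h2 : {v : F | nabs (algebraMap F E v - α) = R} = ∅ := by
      ext v; simpa using hno v
    rw [h2] at h1
    simp only [Set.indicator_empty, integral_zero] at h1
    exact mul_ne_zero (charExt_ne_zero ϖE _ 0 (by simp)) hline h1.symm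
  obtain ⟨v₀, hv₀⟩ := hv₀
  set w : E := (algebraMap F E v₀ - α)⁻¹ with hw
  have hw0 : w ≠ 0 := by
    refine inv_ne_zero fun h => ?_
    rw [h, nabs_zero] at hv₀
    exact hR.ne hv₀
  have hwR : nabs w = R⁻¹ := by rw [hw, nabs_inv, hv₀]
  -- the box contains the part of the line `F - α` which is used
  let T : ℝ := 1 + (R + nabs α)
  have hT : 0 < T := by have := nabs_nonneg α; positivity
  have hvT (v : F) (hv : nabs (algebraMap F E v - α) = R) : nabs v ≤ T := by
    have h1 : nabs v ^ 2 ≤ R + nabs α := by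
      rw [← nabs_algebraMap B]
      have := nabs_add_le_max (algebraMap F E v - α) α
      rw [sub_add_cancel, hv] at this
      exact this.trans (max_le_add_of_nonneg hR.le (nabs_nonneg α))
    change nabs v ≤ 1 + (R + nabs α)
    nlinarith [sq_nonneg (nabs v - 1)]
  let φ : E → ℂ := (coordBox B T).indicator fun _ => (1 : ℂ)
  have hφ : φ ∈ TestFunction E := indicator_coordBox_mem_testFunction B hT
  refine ⟨φ, hφ, ?_⟩
  by_contra! hcon
  let ψ := dilDiff (ϖF : F) φ
  have hψ : ψ ∈ TestFunction E := dilDiff_mem_testFunction hφ ϖF.ne_zero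
  -- the points of the line at which `2 (s - 1 / 2)` is a natural number `n`
  let z : ℕ → ℂ × ℂ := fun n => p + ((n : ℂ) / 2 + 1 / 2 - p.1) • (1, 2)
  have hz1 (n : ℕ) : 2 * ((z n).1 - 1 / 2) = n := by
    simp [z]; ring
  have hzre (n : ℕ) : (linPlus (z n) + 1 / 2).re = 2 * n + (p.2 - 2 * p.1).re + 5 / 2 := by
    have : linPlus (z n) + 1 / 2 = 2 * n + (p.2 - 2 * p.1) + 5 / 2 := by
      simp [z, linPlus_apply]; ring
    rw [this]
    simp
  obtain ⟨N, hN⟩ := exists_nat_gt (-(p.2 - 2 * p.1).re)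
  have hpos (n : ℕ) : 0 < (linPlus (z (N + n)) + 1 / 2).re := by
    rw [hzre]
    push_cast
    have : (0 : ℝ) ≤ N := Nat.cast_nonneg N
    have : (0 : ℝ) ≤ n := Nat.cast_nonneg n
    linarith
  let g : E → ℂ := fun x => kernel ϖF ϖE B d χ η (z N).1 (z N).2 x * ψ x
  have hg : Integrable g μ :=
    integrable_kernel_mul B hα hB μ ϖF ϖE χ η hψ (dilDiff_zero _ _) (z N) (by
      simpa using hpos 0)
  have hker (n : ℕ) (x : E) := kernel_eq_of_dilFactor_eq_one B (d := d) ϖF ϖE χ η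
    (fun a ha => hp a ha _) (hz1 n) x
  have hmom (n : ℕ) : ∫ x, g x * (nabs (invSlope B d x) : ℂ) ^ n ∂μ = 0 := by
    rw [← hcon _ (hpos n)]
    refine integral_congr_ae (.of_forall fun x => ?_)
    simp only [g]
    rw [hker N x]
    change _ = kernel ϖF ϖE B d χ η (z (N + n)).1 (z (N + n)).2 x * ψ x
    rw [hker (N + n) x, pow_add]
    ring
  obtain ⟨C, hC0, hC⟩ := exists_nabs_repr_sq_le (F := F) (E := E) B 1
  have hbd (x : E) : nabs (invSlope B d x) ∈ Set.Icc 0 C := by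
    refine ⟨nabs_nonneg _, ?_⟩
    rw [nabs_invSlope B hα hB]
    by_cases hx : x = 0
    · simp [hx, hC0.le]
    · rw [← div_eq_mul_inv, div_le_iff₀ (nabs_pos hx)]
      exact hC x
  -- isolate the fibre `|ξ| = R⁻¹`
  obtain ⟨Φ, hΦ, hΦw⟩ := exists_continuous_isolating hw0
  have hzero := integral_mul_comp_eq_zero hg (measurable_nabs_invSlope B) hbd hmom hΦ
  simp_rw [hΦw] at hzero
  obtain ⟨c, hc0, hc⟩ := exists_integral_eq_slope B hB μ ν
  have hint : Integrable (fun x => g x *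
      (({x : E | nabs x = nabs w}.indicator (fun _ => (1 : ℝ)) (invSlope B d x) : ℝ) : ℂ)) μ := by
    refine hg.mul_bdd (c := 1) ?_ (.of_forall fun x => ?_)
    · simp_rw [← hΦw]
      exact (Complex.measurable_ofReal.comp
        (hΦ.measurable.comp (measurable_nabs_invSlope B))).aestronglyMeasurable
    · rw [Complex.norm_real, Set.indicator_apply]
      split_ifs <;> simp
  rw [hc _ hint] at hzero
  -- the integrand in the coordinates `x = y (v + α)`
  have hval (y : F) (hy : y ≠ 0) (v : F) : (nabs y : ℂ) *
      (g (algebraMap F E y * (algebraMap F E v + α)) *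
      (({x : E | nabs x = nabs w}.indicator (fun _ => (1 : ℝ))
        (invSlope B d (algebraMap F E y * (algebraMap F E v + α))) : ℝ) : ℂ)) =
      ({y : F | nabs y = 1}.indicator (fun _ => 1) y * (R⁻¹ : ℂ) ^ (N + 2)) *
        {v : F | nabs (algebraMap F E v - α) = R}.indicator
          (fun v => charExt ϖE (χ ^ 2)⁻¹ 0 (algebraMap F E v - α)) v := by
    by_cases hv : nabs (algebraMap F E v - α) = R
    · have h1 : nabs (invSlope B d (algebraMap F E y * (algebraMap F E v + α))) = nabs w := by
        rw [invSlope_mul B hα hB hy, nabs_inv, hv, hwR]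
      rw [Set.indicator_of_mem (by exact h1), Set.indicator_of_mem (a := v) (by exact hv)]
      simp only [g, ψ, φ]
      rw [dilDiff_coordBox B hB ϖF (hvT v hv), hker, h1, hwR, charExt_inv_sq,
        invSlope_mul B hα hB hy]
      by_cases hy1 : nabs y = 1
      · rw [Set.indicator_of_mem (by exact hy1), hy1]
        have h2 : nabs (algebraMap F E (B.repr (algebraMap F E y * (algebraMap F E v + α)) 1 /
            normForm B d (algebraMap F E y * (algebraMap F E v + α)))) = R⁻¹ ^ 2 := by
          have h3 := nabs_invSlope B hα hB (algebraMap F E y * (algebraMap F E v + α))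
          have h4 : B.repr (algebraMap F E y * (algebraMap F E v + α)) 1 = y := by
            have := repr_add_mul B hB v 1 1
            simp only [map_one, one_mul] at this
            rw [repr_algebraMap_mul, this]
            simp
          rw [h1, hwR, h4, hy1, one_pow, one_mul] at h3
          rw [nabs_algebraMap B, nabs_div, nabs_normForm B hα hB, h4, hy1, div_pow, one_pow,
            ← inv_inv (nabs (_ * _)), ← h3]
          simp
        rw [h2]
        push_cast
        ring
      · rw [Set.indicator_of_notMem (by exact hy1)]
        simp
    · have h1 : ¬ nabs (invSlope B d (algebraMap F E y * (algebraMap F E v + α))) = nabs w := by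
        rw [invSlope_mul B hα hB hy, nabs_inv, hwR, inv_inj]
        exact hv
      rw [Set.indicator_of_notMem (by exact h1), Set.indicator_of_notMem (a := v) (by exact hv)]
      simp
  have hinner : (fun y : F => ∫ v : F, (nabs y : ℂ) *
      (g (algebraMap F E y * (algebraMap F E v + α)) *
      (({x : E | nabs x = nabs w}.indicator (fun _ => (1 : ℝ))
        (invSlope B d (algebraMap F E y * (algebraMap F E v + α))) : ℝ) : ℂ)) ∂ν) =ᵐ[ν]
      {y : F | nabs y = 1}.indicator fun _ => (R⁻¹ : ℂ) ^ (N + 2) *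
        (charExt ϖE (χ ^ 2)⁻¹ 0 (-1) * lineIntegral ν ϖE (χ ^ 2)⁻¹ α R) := by
    filter_upwards [ae_ne_zero ν] with y hy
    simp_rw [hval y hy]
    rw [integral_const_mul, lineIntegral_neg]
    by_cases hy1 : nabs y = 1
    · simp [hy1]
    · simp [hy1]
  rw [integral_congr_ae hinner, integral_indicator_const _ (measurableSet_nabs_eq 1)] at hzero
  have hunits : ν.real {y : F | nabs y = 1} ≠ 0 :=
    (ENNReal.toReal_pos (measure_units_pos ν).ne' (measure_units_lt_top ν).ne).ne'
  have hR' : (R : ℂ) ≠ 0 := by exact_mod_cast hR.ne'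
  have hm1 : charExt ϖE (χ ^ 2)⁻¹ 0 (-1) ≠ 0 := charExt_ne_zero ϖE _ 0 (by simp)
  exact smul_ne_zero hc0 (smul_ne_zero hunits
    (mul_ne_zero (pow_ne_zero _ (inv_ne_zero hR')) (mul_ne_zero hm1 hline))) hzero

end NonVanishing

/-! ### The poles are not removable -/

lemma eq_of_eventually_eq_of_dense {X Y : Type*} [TopologicalSpace X] [TopologicalSpace Y]
    [T2Space Y] {S : Set X} (hS : Dense S) {f g : X → Y} {p : X} (hf : ContinuousAt f p)
    (hg : ContinuousAt g p) (h : ∀ᶠ z in 𝓝 p, z ∈ S → f z = g z) : f p = g p := by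
  have hne : (𝓝[S] p).NeBot := mem_closure_iff_nhdsWithin_neBot.1 (hS p)
  refine tendsto_nhds_unique_of_eventuallyEq (l := 𝓝[S] p) (hf.tendsto.mono_left nhdsWithin_le_nhds)
    (hg.tendsto.mono_left nhdsWithin_le_nhds) ?_
  exact eventually_nhdsWithin_iff.2 h

section Poles

variable {F E : Type*} [Field F] [ValuativeRel F] [TopologicalSpace F]
  [IsNonarchimedeanLocalField F]
  [Field E] [ValuativeRel E] [TopologicalSpace E] [IsNonarchimedeanLocalField E]
  [Algebra F E] [ValuativeExtension F E] (B : Module.Basis (Fin 2) F E)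
  {α : E} {d : F} (hα : α ^ 2 = algebraMap F E d) (hB : ⇑B = ![1, α])
  [MeasurableSpace E] [BorelSpace E] (μ : Measure E) [μ.IsAddHaarMeasure]
  (ϖF : Uniformizer F) (ϖE : Uniformizer E) (χ : PontryaginDual 𝒪[E]ˣ) (η : PontryaginDual 𝒪[F]ˣ)

/-- The coordinate box `|x₁ - 1| ≤ r`, `|x₂| ≤ r` around `1 ∈ E`. -/
def oneBox (r : ℝ) : Set E := {x | nabs (B.repr x 0 - 1) ≤ r ∧ nabs (B.repr x 1) ≤ r}

lemma continuous_repr_sub_one : Continuous fun x : E => B.repr x 0 - 1 :=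
  (continuous_repr B 0).sub continuous_const

lemma isClopen_oneBox {r : ℝ} (hr : 0 < r) : IsClopen (oneBox B r) :=
  ⟨((isClosed_nabs_le r).preimage (continuous_repr_sub_one B)).inter
      ((isClosed_nabs_le r).preimage (continuous_repr B 1)),
    ((isOpen_nabs_le hr).preimage (continuous_repr_sub_one B)).inter
      ((isOpen_nabs_le hr).preimage (continuous_repr B 1))⟩

lemma isCompact_oneBox {r : ℝ} (hr : 0 < r) : IsCompact (oneBox B r) := by
  have h : IsCompact ((coordHomeo B).symm ⁻¹'
      ({x : F | nabs x ≤ max r 1} ×ˢ {x : F | nabs x ≤ r})) := by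
    rw [(coordHomeo B).symm.isCompact_preimage]
    exact (isCompact_nabs_le _).prod (isCompact_nabs_le _)
  refine h.of_isClosed_subset (isClopen_oneBox B hr).1 fun x hx => ⟨?_, hx.2⟩
  have := nabs_add_le_max (B.repr x 0 - 1) 1
  rw [sub_add_cancel, nabs_one] at this
  exact this.trans (max_le_max_right 1 hx.1)

include hB in
lemma exists_oneBox_subset {U : Set E} (hU : U ∈ 𝓝 (1 : E)) :
    ∃ b : F, b ≠ 0 ∧ nabs b < 1 ∧ oneBox B (nabs b) ⊆ U := by
  have h1 : coordHomeo B (1, 0) = 1 := by rw [coordHomeo_apply, hB]; simp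
  have h2 : coordHomeo B ⁻¹' U ∈ 𝓝 ((1 : F), (0 : F)) :=
    (coordHomeo B).continuous.continuousAt.preimage_mem_nhds (by rwa [h1])
  obtain ⟨u, hu, v, hv, huv⟩ := mem_nhds_prod_iff.1 h2
  obtain ⟨r, hr, hru⟩ := mem_nhds_iff_nabs.1 hu
  obtain ⟨r', hr', hrv⟩ := mem_nhds_zero_iff_nabs.1 hv
  obtain ⟨ϖ⟩ := exists_uniformizer F
  obtain ⟨m, hm⟩ := exists_pow_lt_of_lt_one (lt_min hr (lt_min hr' one_pos)) ϖ.nabs_lt_one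
  rw [← nabs_pow, lt_min_iff, lt_min_iff] at hm
  refine ⟨(ϖ : F) ^ m, pow_ne_zero _ ϖ.ne_zero, hm.2.2, fun x hx => ?_⟩
  have h3 : ((B.repr x 0, B.repr x 1) : F × F) ∈ u ×ˢ v :=
    ⟨hru (by exact hx.1.trans_lt hm.1), hrv (by exact hx.2.trans_lt hm.2.1)⟩
  have h4 := huv h3
  rwa [← coordHomeo_symm_apply, Set.mem_preimage, Homeomorph.apply_symm_apply] at h4

lemma stretchDiff_oneBox {b : F} (hb : b ≠ 0) (x : E) :
    stretchDiff B (ϖF : F) ((oneBox B (nabs b)).indicator fun _ => (1 : ℂ)) x =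
      {x : E | nabs (B.repr x 0 - 1) ≤ nabs b ∧ nabs (B.repr x 1) = nabs b}.indicator
        (fun _ => 1) x := by
  have h1 : diagMap B 1 (ϖF : F)⁻¹ x ∈ oneBox B (nabs b) ↔
      nabs (B.repr x 0 - 1) ≤ nabs b ∧ nabs (B.repr x 1) < nabs b := by
    rw [nabs_lt_iff_le_mul ϖF hb, nabs_mul, oneBox, Set.mem_ofPred_eq, diagMap, coordHomeo_apply,
      repr_comb_zero, repr_comb_one, one_mul, nabs_mul, nabs_inv,
      inv_mul_le_iff₀ (nabs_pos ϖF.ne_zero)]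
  classical
  simp only [stretchDiff, Set.indicator_apply, h1]
  simp only [oneBox, Set.mem_ofPred_eq]
  by_cases h0 : nabs (B.repr x 0 - 1) ≤ nabs b
  · rcases lt_trichotomy (nabs (B.repr x 1)) (nabs b) with h | h | h
    · simp [h0, h, h.le, h.ne]
    · simp [h0, h]
    · simp [h0, h.not_ge, h.not_gt, h.ne']
  · simp [h0]

include hα hB in
/-- For test functions vanishing at `0`, the regularization by dilations is not needed. -/
lemma regDist_eq_of_apply_zero {φ : E → ℂ} (hφ : φ ∈ TestFunction E) (h0 : φ 0 = 0) {a₁ a₂ : F}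
    (h₁ : a₁ ≠ 0) (h₂ : a₂ ≠ 0) : ∃ v : ℂ × ℂ → ℂ, (∀ p, AnalyticAt ℂ v p) ∧
      (∀ p, v p = ∫ x, restrChar ϖF ϖE χ η p.1 p.2 (B.repr x 1) *
        stretchDiff B a₂ (fun y => smoothPart B ϖF ϖE χ η p.1 p.2 d y * φ y) x ∂μ) ∧
      ∀ p, regDist B hα hB ϖF ϖE χ η μ h₁ h₂ p ⟨φ, hφ⟩ =
        (1 - dilFactor ϖF ϖE χ η a₁ p) * v p := by
  have hfam : IsTestFamily fun x (p : ℂ × ℂ) => restrChar ϖF ϖE χ η p.1 p.2 (B.repr x 1) *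
      stretchDiff B a₂ (fun y => smoothPart B ϖF ϖE χ η p.1 p.2 d y * φ y) x := by
    refine IsTestFamily.mul_restrChar B ϖF ϖE χ η (((IsTestFamily.of_testFunction
      hφ).smoothPart_mul B hα hB ϖF ϖE χ η ?_).stretchDiff B h₂) ?_
    · funext p; exact h0
    · intro x hx
      funext p
      exact stretchDiff_eq_zero B _ _ hx
  have hv := fun p => hfam.analyticAt_integral μ p
  refine ⟨_, hv, fun p => rfl, ?_⟩
  refine congrFun (eq_of_analytic_of_eq (fun p => analyticAt_regDist B hα hB ϖF ϖE χ η μ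
    (IsTestFamily.of_testFunction hφ) h₁ h₂ p)
    (fun p => (analyticAt_const.sub (analyticAt_dilFactor ϖF ϖE χ η h₁ p)).mul (hv p)) ?_)
  intro p hp₁ hp₂
  rw [integral_stretchDiff_smoothPart B hα hB ϖF ϖE χ η μ hφ h0 h₂ p hp₁, ← mul_assoc]
  exact regDist_eq_integral B hα hB ϖF ϖE χ η μ h₁ h₂ p hp₁ hp₂ ⟨φ, hφ⟩

include hB in
lemma integral_restrChar_stretchDiff_ne_zero {p : ℂ × ℂ} (hp : p ∈ backslashes ϖF ϖE χ η) {b : F}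
    (hb : b ≠ 0) (hW : ∀ x ∈ oneBox B (nabs b),
      smoothPart B ϖF ϖE χ η p.1 p.2 d x = smoothPart B ϖF ϖE χ η p.1 p.2 d 1)
    (h1 : smoothPart B ϖF ϖE χ η p.1 p.2 d (1 : E) ≠ 0) :
    ∫ x, restrChar ϖF ϖE χ η p.1 p.2 (B.repr x 1) * stretchDiff B (ϖF : F) (fun y =>
      smoothPart B ϖF ϖE χ η p.1 p.2 d y *
        (oneBox B (nabs b)).indicator (fun _ => (1 : ℂ)) y) x ∂μ ≠ 0 := by
  let A : Set E := {x : E | nabs (B.repr x 0 - 1) ≤ nabs b ∧ nabs (B.repr x 1) = nabs b}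
  have hAo : IsOpen A := ((isOpen_nabs_le (nabs_pos hb)).preimage (continuous_repr_sub_one B)).inter
    ((isOpen_nabs_preimage {nabs b} (nabs_pos hb).ne).preimage (continuous_repr B 1))
  have hA0 : μ A ≠ 0 := (hAo.measure_pos μ ⟨coordHomeo B (1, b), by
    simp only [A, Set.mem_ofPred_eq, coordHomeo_apply, repr_comb_zero, repr_comb_one, sub_self,
      nabs_zero]
    exact ⟨nabs_nonneg b, trivial⟩⟩).ne'
  have hA1 : μ A ≠ ⊤ := ((measure_mono (t := oneBox B (nabs b)) fun x hx => ⟨hx.1, hx.2.le⟩).trans_lt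
    (isCompact_oneBox B (nabs_pos hb)).measure_lt_top).ne
  have hunit (u : F) (hu : nabs u = nabs b) :
      restrChar ϖF ϖE χ η p.1 p.2 u = restrChar ϖF ϖE χ η p.1 p.2 b := by
    have hq : nabs (u / b) = 1 := by rw [nabs_div, hu, div_self (nabs_pos hb).ne']
    have h := hp.1 (u / b) (nabs_eq_one_iff.1 hq).1 (nabs_eq_one_iff.1 hq).2
    rw [← div_mul_cancel₀ u hb, restrChar_mul, restrChar, charExt_of_nabs_eq_one ϖF η _ hq,
      charExt_of_nabs_eq_one ϖE χ _ (by rw [nabs_algebraMap B, hq, one_pow]), h, one_mul]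
  have hint : ∀ x, restrChar ϖF ϖE χ η p.1 p.2 (B.repr x 1) * stretchDiff B (ϖF : F) (fun y =>
      smoothPart B ϖF ϖE χ η p.1 p.2 d y *
        (oneBox B (nabs b)).indicator (fun _ => (1 : ℂ)) y) x =
      A.indicator (fun _ => restrChar ϖF ϖE χ η p.1 p.2 b *
        smoothPart B ϖF ϖE χ η p.1 p.2 d (1 : E)) x := by
    intro x
    have h2 (y : E) : smoothPart B ϖF ϖE χ η p.1 p.2 d y *
        (oneBox B (nabs b)).indicator (fun _ => (1 : ℂ)) y =
        smoothPart B ϖF ϖE χ η p.1 p.2 d (1 : E) *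
          (oneBox B (nabs b)).indicator (fun _ => (1 : ℂ)) y := by
      by_cases hy : y ∈ oneBox B (nabs b)
      · rw [hW y hy]
      · simp [hy]
    have h3 := stretchDiff_oneBox B ϖF hb x
    simp only [stretchDiff] at h3 ⊢
    rw [h2, h2, ← mul_sub, h3]
    by_cases hx : x ∈ A
    · rw [Set.indicator_of_mem hx, Set.indicator_of_mem hx, hunit _ hx.2, mul_one]
    · rw [Set.indicator_of_notMem hx, Set.indicator_of_notMem hx, mul_zero, mul_zero]
  simp_rw [hint]
  rw [integral_indicator_const _ hAo.measurableSet]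
  exact smul_ne_zero (ENNReal.toReal_pos hA0 hA1).ne'
    (mul_ne_zero (restrChar_ne_zero _ _ _ _ _ _ hb) h1)

variable {a₁ a₂ : F} (h₁ : a₁ ≠ 0) (h₂ : a₂ ≠ 0)

/-- The family `((1 - c₁) (1 - c₂))⁻¹ T₀`, where `T₀` is the regularized distribution; it is the
meromorphic extension of the family of distributions given by the kernels. -/
noncomputable def kernelDist (p : ℂ × ℂ) : Distribution E :=
  ((1 - dilFactor ϖF ϖE χ η a₁ p) * (1 - stretchFactor ϖF ϖE χ η a₂ p))⁻¹ •
    regDist B hα hB ϖF ϖE χ η μ h₁ h₂ p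

variable {κ₁ κ₂ : ℂ}
  (hP : PoleDatum linPlus (stretchFactor ϖF ϖE χ η a₂) (backslashes ϖF ϖE χ η)
    (fun p => localL ϖF (1 / 2) (charPlus ϖF ϖE χ η p.1 p.2)) κ₁)
  (hQ : PoleDatum linMinus (dilFactor ϖF ϖE χ η a₁) (slashes ϖF ϖE χ η)
    (fun p => localL ϖF (1 / 2) (charMinus ϖF ϖE χ η p.1 p.2)) κ₂)

include hP hQ in
omit [ValuativeExtension F E] in
lemma dense_compl_poles : Dense (backslashes ϖF ϖE χ η ∪ slashes ϖF ϖE χ η)ᶜ :=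
  dense_compl_of_poleDatum hP hQ (by simp) (by simp)

include hP hQ in
/-- A holomorphic extension of the family at `p` determines the regularized distributions near
`p`. -/
lemma eventually_regDist_eq {φ : TestFunction E} {p : ℂ × ℂ} {g : ℂ × ℂ → ℂ}
    (hg : AnalyticAt ℂ g p) (h : ∀ᶠ z in 𝓝 p, z ∉ backslashes ϖF ϖE χ η ∪ slashes ϖF ϖE χ η →
      kernelDist B hα hB μ ϖF ϖE χ η h₁ h₂ z φ = g z) :
    ∀ᶠ z in 𝓝 p, regDist B hα hB ϖF ϖE χ η μ h₁ h₂ z φ =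
      (1 - dilFactor ϖF ϖE χ η a₁ z) * (1 - stretchFactor ϖF ϖE χ η a₂ z) * g z := by
  filter_upwards [hg.eventually_analyticAt, h.eventually_nhds] with z hgz hz
  refine eq_of_eventually_eq_of_dense (dense_compl_poles ϖF ϖE χ η hP hQ)
    (analyticAt_regDist B hα hB ϖF ϖE χ η μ (IsTestFamily.of_testFunction φ.2) h₁ h₂ z).continuousAt
    (((analyticAt_const.sub (hQ.analyticAt z)).mul (analyticAt_const.sub
      (hP.analyticAt z))).mul hgz).continuousAt ?_
  filter_upwards [hz] with w hw hwS
  have hw' : w ∉ backslashes ϖF ϖE χ η ∪ slashes ϖF ϖE χ η := hwS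
  have e1 : 1 - dilFactor ϖF ϖE χ η a₁ w ≠ 0 :=
    sub_ne_zero.2 (hQ.ne_one w fun h => hw' (Or.inr h)).symm
  have e2 : 1 - stretchFactor ϖF ϖE χ η a₂ w ≠ 0 :=
    sub_ne_zero.2 (hP.ne_one w fun h => hw' (Or.inl h)).symm
  simp only [Pi.mul_apply, Pi.sub_apply]
  rw [← hw hw', kernelDist, LinearMap.smul_apply, smul_eq_mul, mul_inv_cancel_left₀
    (mul_ne_zero e1 e2)]

include hP hQ in
/-- The poles along `\\` are detected by test functions supported near `1 ∈ F`, where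
`K` is `χ_{s-1/2} η_{t+1/2}` of the second coordinate. -/
lemma exists_not_extends_backslashes {p : ℂ × ℂ} (hp : p ∈ backslashes ϖF ϖE χ η)
    (ha : a₂ = ϖF) : ∃ φ : TestFunction E, ¬ ExtendsHolomorphicallyAt
      (fun z => kernelDist B hα hB μ ϖF ϖE χ η h₁ h₂ z φ)
      (backslashes ϖF ϖE χ η ∪ slashes ϖF ϖE χ η) p := by
  subst ha
  obtain ⟨b, hb, hb1, hbU⟩ := exists_oneBox_subset B hB
    (eventually_smoothPart_eq B hα hB ϖF ϖE χ η (one_ne_zero (α := E)))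
  have hφ := indicator_mem_testFunction (isClopen_oneBox B (nabs_pos hb))
    (isCompact_oneBox B (nabs_pos hb))
  have h0 : (oneBox B (nabs b)).indicator (fun _ => (1 : ℂ)) 0 = 0 := by
    refine Set.indicator_of_notMem (fun h => ?_) _
    have := h.1
    simp only [map_zero, Finsupp.coe_zero, Pi.zero_apply, zero_sub, nabs_neg, nabs_one] at this
    exact this.not_gt hb1
  obtain ⟨v, hv, hvint, hreg⟩ := regDist_eq_of_apply_zero B hα hB μ ϖF ϖE χ η hφ h0 h₁ h₂
  refine ⟨⟨_, hφ⟩, fun ⟨g, hg, hgT⟩ => ?_⟩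
  have hs1 : smoothPart B ϖF ϖE χ η p.1 p.2 d (1 : E) ≠ 0 :=
    mul_ne_zero (charExt_ne_zero _ _ _ (by simp)) (inv_ne_zero
      (restrChar_ne_zero _ _ _ _ _ _ (normForm_ne_zero B hα hB one_ne_zero)))
  refine integral_restrChar_stretchDiff_ne_zero B hB μ ϖF ϖE χ η hp hb
    (fun x hx => hbU hx _ _) hs1 ?_
  rw [← hvint]
  have hev := eventually_regDist_eq B hα hB μ ϖF ϖE χ η h₁ h₂ hP hQ hg hgT
  have key := eq_of_eventually_eq_of_dense (dense_compl_poles ϖF ϖE χ η hP hQ) (hv p).continuousAt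
    ((analyticAt_const (v := (1 : ℂ)).sub (hP.analyticAt p)).mul hg).continuousAt ?_
  · rw [key]
    simp [hP.eq_one hp]
  · filter_upwards [hev] with z hz hzS
    have e1 : 1 - dilFactor ϖF ϖE χ η a₁ z ≠ 0 :=
      sub_ne_zero.2 (hQ.ne_one z fun h => hzS (Or.inr h)).symm
    rw [hreg, mul_assoc] at hz
    exact mul_left_cancel₀ e1 hz

omit [MeasurableSpace E] [BorelSpace E] in
include B hQ in
lemma dilFactor_eq_one_of_mem_slashes {p : ℂ × ℂ} (hp : p ∈ slashes ϖF ϖE χ η) (ha : a₁ = ϖF)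
    {a : F} (ha0 : a ≠ 0) (h : ℂ) : dilFactor ϖF ϖE χ η a (p + h • (1, 2)) = 1 := by
  subst ha
  refine eq_one_of_multiplicative ϖF (f := fun a => dilFactor ϖF ϖE χ η a (p + h • (1, 2)))
    (fun x y => ?_) ?_ (fun u hu => ?_) ha0
  · simp only [dilFactor, map_mul, nabs_mul, charExt_mul, mul_inv, Complex.ofReal_mul]
    ring
  · obtain ⟨l, -, hl⟩ := hQ.exp_eq p hp
    simp only [hl]
    rw [map_add, add_sub_cancel_left, map_smul, linMinus_apply]
    simp
  · have hE : nabs (algebraMap F E u) = 1 := by rw [nabs_algebraMap B, hu, one_pow]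
    simp only [dilFactor]
    rw [hE, charExt_of_nabs_eq_one ϖE χ _ hE, charExt_of_nabs_eq_one ϖF η _ hu,
      Complex.ofReal_one, one_mul]
    exact hp.1 u (nabs_eq_one_iff.1 hu).1 (nabs_eq_one_iff.1 hu).2

include hP hQ in
/-- If the pole along a line in `//` was removable at a point, then the regularized distributions
would vanish on the line, by uniqueness of analytic continuation. -/
lemma exists_not_extends_slashes {p : ℂ × ℂ} (hp : p ∈ slashes ϖF ϖE χ η)
    (ha : a₁ = ϖF) : ∃ φ : TestFunction E, ¬ ExtendsHolomorphicallyAt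
      (fun z => kernelDist B hα hB μ ϖF ϖE χ η h₁ h₂ z φ)
      (backslashes ϖF ϖE χ η ∪ slashes ϖF ϖE χ η) p := by
  have hone {a : F} (ha0 : a ≠ 0) (h : ℂ) :=
    dilFactor_eq_one_of_mem_slashes B ϖF ϖE χ η hQ hp ha ha0 h
  obtain ⟨φ, hφ, h, hre, hne⟩ := exists_integral_kernel_ne_zero B hα hB μ ϖF ϖE χ η
    (p := p) fun a ha0 h => hone ha0 h
  refine ⟨⟨φ, hφ⟩, fun ⟨g, hg, hgT⟩ => ?_⟩
  have hev := eventually_regDist_eq B hα hB μ ϖF ϖE χ η h₁ h₂ hP hQ hg hgT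
  let f : ℂ → ℂ := fun u => regDist B hα hB ϖF ϖE χ η μ h₁ h₂ (p + u • (1, 2)) ⟨φ, hφ⟩
  have hline (u : ℂ) : AnalyticAt ℂ (fun u : ℂ => p + u • ((1, 2) : ℂ × ℂ)) u :=
    analyticAt_const.add (analyticAt_id.smul analyticAt_const)
  have hf : AnalyticOnNhd ℂ f Set.univ := fun u _ =>
    (analyticAt_regDist B hα hB ϖF ϖE χ η μ (IsTestFamily.of_testFunction hφ) h₁ h₂
      (p + u • ((1, 2) : ℂ × ℂ))).comp (f := fun u : ℂ => p + u • ((1, 2) : ℂ × ℂ)) (hline u)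
  have hf0 : f =ᶠ[𝓝 0] fun _ => 0 := by
    have ht : Filter.Tendsto (fun u : ℂ => p + u • ((1, 2) : ℂ × ℂ)) (𝓝 0) (𝓝 p) := by
      have := (hline 0).continuousAt.tendsto
      simpa using this
    filter_upwards [ht.eventually hev] with u hu
    simp only [f]
    rw [hu, hone h₁, sub_self, zero_mul, zero_mul]
  have hfz : f h = 0 := congrFun (hf.eq_of_eventuallyEq (fun u _ => analyticAt_const) hf0) h
  have hP1 : 1 - stretchFactor ϖF ϖE χ η a₂ (p + h • (1, 2)) ≠ 0 :=
    sub_ne_zero.2 (hP.ne_one _ (hP.notMem _ hre)).symm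
  simp only [f, regDist_apply, regIntegrand] at hfz
  rw [integral_stretchDiff_smoothPart B hα hB ϖF ϖE χ η μ (dilDiff_mem_testFunction hφ h₁)
    (dilDiff_zero _ _) h₂ (p + h • (1, 2))
      (by rwa [linPlus_apply] at hre), ha] at hfz
  exact mul_ne_zero hP1 hne hfz

end Poles

/-! ### The meromorphic family -/

section Family

variable {F E : Type*} [Field F] [ValuativeRel F] [TopologicalSpace F]
  [IsNonarchimedeanLocalField F]
  [Field E] [ValuativeRel E] [TopologicalSpace E] [IsNonarchimedeanLocalField E]
  [Algebra F E] [ValuativeExtension F E] (B : Module.Basis (Fin 2) F E)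
  {α : E} {d : F} (hα : α ^ 2 = algebraMap F E d) (hB : ⇑B = ![1, α])
  [MeasurableSpace E] [BorelSpace E] (μ : Measure E) [μ.IsAddHaarMeasure]
  (ϖF : Uniformizer F) (ϖE : Uniformizer E) (χ : PontryaginDual 𝒪[E]ˣ) (η : PontryaginDual 𝒪[F]ˣ)
  {a₁ a₂ : F} (h₁ : a₁ ≠ 0) (h₂ : a₂ ≠ 0) {κ₁ κ₂ : ℂ}
  (hP : PoleDatum linPlus (stretchFactor ϖF ϖE χ η a₂) (backslashes ϖF ϖE χ η)
    (fun p => localL ϖF (1 / 2) (charPlus ϖF ϖE χ η p.1 p.2)) κ₁)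
  (hQ : PoleDatum linMinus (dilFactor ϖF ϖE χ η a₁) (slashes ϖF ϖE χ η)
    (fun p => localL ϖF (1 / 2) (charMinus ϖF ϖE χ η p.1 p.2)) κ₂)

include hP hQ

lemma kernelDist_apply_eq_integral (s t : ℂ) (hs : 0 < (2 * s + t + 1 / 2).re)
    (ht : 0 < (2 * s - t + 1 / 2).re) (φ : TestFunction E) :
    kernelDist B hα hB μ ϖF ϖE χ η h₁ h₂ (s, t) φ =
      ∫ x, kernel ϖF ϖE B d χ η s t x * φ.1 x ∂μ := by
  have e1 : 1 - dilFactor ϖF ϖE χ η a₁ (s, t) ≠ 0 :=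
    sub_ne_zero.2 (hQ.ne_one _ (hQ.notMem _ ht)).symm
  have e2 : 1 - stretchFactor ϖF ϖE χ η a₂ (s, t) ≠ 0 :=
    sub_ne_zero.2 (hP.ne_one _ (hP.notMem _ hs)).symm
  rw [kernelDist, LinearMap.smul_apply, smul_eq_mul,
    regDist_eq_integral B hα hB ϖF ϖE χ η μ h₁ h₂ (s, t) hs ht,
    inv_mul_cancel_left₀ (mul_ne_zero e1 e2)]

open Classical in
lemma extendsHolomorphicallyAt_kernelDist (φ : TestFunction E) (p : ℂ × ℂ) :
    ExtendsHolomorphicallyAt (fun z =>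
      (if p ∈ backslashes ϖF ϖE χ η then (2 * z.1 + z.2) - (2 * p.1 + p.2) else 1) *
      (if p ∈ slashes ϖF ϖE χ η then (2 * z.1 - z.2) - (2 * p.1 - p.2) else 1) *
        kernelDist B hα hB μ ϖF ϖE χ η h₁ h₂ z φ)
      (backslashes ϖF ϖE χ η ∪ slashes ϖF ϖE χ η) p := by
  obtain ⟨g₁, hg₁, h₁z⟩ := hP.exists_analyticAt p
  obtain ⟨g₂, hg₂, h₂z⟩ := hQ.exists_analyticAt p
  refine ⟨fun z => g₁ z * g₂ z * regDist B hα hB ϖF ϖE χ η μ h₁ h₂ z φ, (hg₁.mul hg₂).mul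
    (analyticAt_regDist B hα hB ϖF ϖE χ η μ (IsTestFamily.of_testFunction φ.2) h₁ h₂ p), ?_⟩
  filter_upwards [h₁z, h₂z] with z hz₁ hz₂ hzS
  rw [← hz₁ fun h => hzS (Or.inl h), ← hz₂ fun h => hzS (Or.inr h), kernelDist,
    LinearMap.smul_apply, smul_eq_mul, mul_inv, linPlus_apply, linPlus_apply, linMinus_apply,
    linMinus_apply]
  ring

lemma smul_regDist_eq (s t : ℂ) (hst : (s, t) ∉ backslashes ϖF ϖE χ η ∪ slashes ϖF ϖE χ η) :
    (κ₁ * κ₂) • regDist B hα hB ϖF ϖE χ η μ h₁ h₂ (s, t) =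
      ((localL ϖF (1 / 2) (charPlus ϖF ϖE χ η s t))⁻¹ *
        (localL ϖF (1 / 2) (charMinus ϖF ϖE χ η s t))⁻¹) •
        kernelDist B hα hB μ ϖF ϖE χ η h₁ h₂ (s, t) := by
  rw [← hP.inv_mul_inv (s, t) fun h => hst (Or.inl h),
    ← hQ.inv_mul_inv (s, t) fun h => hst (Or.inr h), kernelDist, smul_smul]
  congr 1
  rw [mul_inv]
  ring

end Family

end SymBreak

theorem theoremA
    {F E : Type*}
    [Field F] [ValuativeRel F] [TopologicalSpace F] [IsNonarchimedeanLocalField F]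
    [Field E] [ValuativeRel E] [TopologicalSpace E] [IsNonarchimedeanLocalField E]
    [Algebra F E] [ValuativeExtension F E]
    [MeasurableSpace E] [BorelSpace E]
    -- the Haar measure on `E` with `μ(𝒪_E) = 1`
    (μ : MeasureTheory.Measure E) [μ.IsAddHaarMeasure]
    (hμ : μ ((Valuation.integer (ValuativeRel.valuation E) : Subring E) : Set E) = 1)
    -- uniformizers
    (ϖF : SymBreak.Uniformizer F) (ϖE : SymBreak.Uniformizer E)
    -- `E = F ⊕ F α` with `α² = d ∈ F`
    (α : E) (d : F) (hα : α ^ 2 = algebraMap F E d)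
    (B : Module.Basis (Fin 2) F E) (hB : ⇑B = ![1, α])
    (χ : PontryaginDual (Valuation.integer (ValuativeRel.valuation E))ˣ)
    (η : PontryaginDual (Valuation.integer (ValuativeRel.valuation F))ˣ) :
    (∀ s t : ℂ, 0 < (2 * s + t + 1 / 2).re → 0 < (2 * s - t + 1 / 2).re →
      MeasureTheory.LocallyIntegrable (SymBreak.kernel ϖF ϖE B d χ η s t) μ) ∧
    ∃ T T' : ℂ × ℂ → SymBreak.Distribution E,
      -- `T` is the meromorphic extension of the family of distributions given by the kernels
      (∀ s t : ℂ, 0 < (2 * s + t + 1 / 2).re → 0 < (2 * s - t + 1 / 2).re →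
        ∀ φ : SymBreak.TestFunction E,
          T (s, t) φ = ∫ x, SymBreak.kernel ϖF ϖE B d χ η s t x * φ.1 x ∂μ) ∧
      SymBreak.HasSimplePolesExactlyAlong T
        (SymBreak.backslashes ϖF ϖE χ η) (SymBreak.slashes ϖF ϖE χ η) ∧
      (∀ s t : ℂ, (s, t) ∉ SymBreak.backslashes ϖF ϖE χ η ∪ SymBreak.slashes ϖF ϖE χ η →
        SymBreak.IsSymmetryBreakingKernel ϖF ϖE χ s η t (T (s, t))) ∧
      -- `T'` is the renormalized family
      (∀ s t : ℂ, (s, t) ∉ SymBreak.backslashes ϖF ϖE χ η ∪ SymBreak.slashes ϖF ϖE χ η →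
        T' (s, t) =
          ((SymBreak.localL ϖF (1 / 2) (SymBreak.charPlus ϖF ϖE χ η s t))⁻¹ *
            (SymBreak.localL ϖF (1 / 2) (SymBreak.charMinus ϖF ϖE χ η s t))⁻¹) • T (s, t)) ∧
      SymBreak.IsHolomorphicFamily T' ∧
      (∀ s t : ℂ, SymBreak.IsSymmetryBreakingKernel ϖF ϖE χ s η t (T' (s, t))) := by
  obtain ⟨a₂, h₂, κ₁, hP, ha₂⟩ := SymBreak.exists_poleDatum_plus B ϖF ϖE χ η
  obtain ⟨a₁, h₁, κ₂, hQ, ha₁⟩ := SymBreak.exists_poleDatum_minus B ϖF ϖE χ η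
  have hsbk (p : ℂ × ℂ) :=
    SymBreak.isSymmetryBreakingKernel_regDist B hα hB ϖF ϖE χ η μ h₁ h₂ p
  refine ⟨fun s t hs ht => SymBreak.locallyIntegrable_kernel B μ hα hB ϖF ϖE χ η s t hs ht,
    SymBreak.kernelDist B hα hB μ ϖF ϖE χ η h₁ h₂,
    fun p => (κ₁ * κ₂) • SymBreak.regDist B hα hB ϖF ϖE χ η μ h₁ h₂ p,
    SymBreak.kernelDist_apply_eq_integral B hα hB μ ϖF ϖE χ η h₁ h₂ hP hQ, ⟨?_, ?_⟩,
    fun s t _ => SymBreak.IsSymmetryBreakingKernel.smul ϖF ϖE χ η (hsbk (s, t)) _,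
    SymBreak.smul_regDist_eq B hα hB μ ϖF ϖE χ η h₁ h₂ hP hQ, fun φ p => ?_,
    fun s t => SymBreak.IsSymmetryBreakingKernel.smul ϖF ϖE χ η (hsbk (s, t)) _⟩
  · exact SymBreak.extendsHolomorphicallyAt_kernelDist B hα hB μ ϖF ϖE χ η h₁ h₂ hP hQ
  · rintro p (hp | hp)
    · exact SymBreak.exists_not_extends_backslashes B hα hB μ ϖF ϖE χ η h₁ h₂ hP hQ hp
        (ha₂ ⟨p, hp⟩)
    · exact SymBreak.exists_not_extends_slashes B hα hB μ ϖF ϖE χ η h₁ h₂ hP hQ hp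
        (ha₁ ⟨p, hp⟩)
  · have := SymBreak.analyticAt_regDist B hα hB ϖF ϖE χ η μ
      (SymBreak.IsTestFamily.of_testFunction φ.2) h₁ h₂ p
    exact (this.const_smul (c := κ₁ * κ₂)).differentiableAt
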